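/- **Setting.** Let $V$ be a locally compact, Hausdorff, second countable abelian Lie group (written additively), with Lie algebra $\mathfrak g$ (finite-dimensional over $\mathbb R$) and exponential map $\exp:\mathfrak g\to V$ (for instance $V=\mathfrak g=\mathbb R^n$), and let $\hat V$ be its Pontryagin dual. Let $e$ be a continuous symmetric bicharacter on $V$ which is nondegenerate, i.e. $e^1:V\to\hat V$, $e^1_u=e(u,\cdot)$, is an isomorphism of topological groups, and let $dv$ be the Haar measure on $V$ for which the Fourier transform $\hat\psi(v)=\int e(s,v)\psi(s)\,ds$ is unitary on $L^2(V)$. Let $\sigma$ be a continuous antisymmetric bicharacter on $\hat V$, $\sigma(\xi,\eta)=\sigma(\eta,\xi)^{-1}$; define $\sigma^1:\hat V\to V$ by $\eta(\sigma^1_\xi)=\sigma(\xi,\eta)$, put $T=\sigma^1\circ e^1:V\to V$, and let $T^*$ be the adjoint, $e(T^*u,w)=e(u,Tw)$. Let $A$ be a C*-algebra with a strongly continuous action $\alpha$ of $V$ by $*$-automorphisms. A vector $c\in A$ is *smooth* if $v\mapsto\alpha_v(c)$ is a $C^\infty$ map from $V$ to $A$, equivalently if $x\mapsto\alpha_{\exp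 x}(c)$ is $C^\infty$ on $\mathfrak g$. Let $B=A\rtimes_\alpha V$ be the crossed product, realised on $L^2(V;H)$ by means of a faithful nondegenerate representation $\pi$ of $A$ on a Hilbert space $H$: with $(\tilde\pi(c)h)(v)=\pi(\alpha_{-v}(c))h(v)$ and $(\lambda_uh)(v)=h(v-u)$, $B$ is the C*-algebra generated by the operators $\int\tilde\pi(f(u))\lambda_u\,du$, $f\in C_c(V,A)$. Its multiplier algebra is $M(B)=\{m: mB\subseteq B,\ Bm\subseteq B\}\subseteq\mathcal B(L^2(V;H))$. The dual action of $\hat V$ on $M(B)$ is $\hat\alpha_\xi(m)=M_\xi mM_\xi^*$, where $M_\xi$ is multiplication by $\xi$, and the deformed dual action is $\hat\alpha^\sigma_\xi(m)=U_\xi^*\hat\alpha_\xi(m)U_\xi$, $U_\xi=\lambda_{\sigma^1_\xi}$. **Regularised integrals.** A *summation kernel* supported in a neighbourhood $N$ of $0\in V$ is a continuous, compactly supported function $\psi\ge0$ with support in $N$, $\int\psi=1$ and $\hat\psi\in L^1(V)$; as $N$ shrinks to $0$, $\hat\psi\to1$. For $c,d\in A$, the deformed product is the oscillatory integral $$c\star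 d=\int\!\!\int e(u,w)\,\alpha_{T^*u}(c)\,\alpha_w(d)\,du\,dw ,$$ meaning the norm limit, as $N$ shrinks to $0$, of the integrals with $\hat\psi_1(u)\hat\psi_2(w)$ inserted, where $\psi_1,\psi_2$ are summation kernels supported in $N$. An operator $m$ on $L^2(V;H)$ has the form $m=\int\tilde\pi(a(v))\lambda_v\,dv$ for an $A$-valued pseudomeasure $a$, that is, a bounded linear map $L^1(V)\to A$ written $\psi\mapsto\int\hat\psi(v)a(v)\,dv$, if for all $\psi\in L^1(V)$ and $k\in H$ such that $h=\hat\psi\otimes k\in L^2(V;H)$ one has $(mh)(v)=\pi\big(\alpha_{-v}\big(\int\hat\psi(v-u)a(u)\,du\big)\big)k$ for almost every $v$. For such $m$ we write $I(m)=\int a(v)\,dv$ for the norm limit, if it exists, of $\int\hat\psi(v)a(v)\,dv$ over summation kernels $\psi$ supported in $N$, as $N$ shrinks to $0$. **Theorem.** Suppose that $T$ is invertible. Let $a,b\in M(B)$ be fixed by $\hat\alpha^\sigma_\xi$ for all $\xi\in\hat V$, and suppose that $I(a)$ and $I(b)$ exist and are smooth vectors of $A$. Then the product $a*b$ in $M(B)$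 is again fixed by the deformed dual action, the integrals defining $I(a)\star I(b)$ and $I(a*b)$ exist, their common value is a smooth vector, and $$I(a*b)=I(a)\star I(b).$$ Moreover, for every $z\in\mathbb C$, $a+zb$ is fixed by the deformed dual action and $I(a+zb)$ exists and equals $I(a)+zI(b)$. Thus $I$ is an algebra homomorphism from (the smooth part of) Kasprzak's deformation to Rieffel's. -/

import Mathlib

open MeasureTheory Filter Topology
open scoped ENNReal ContDiff

noncomputable section

namespace LandstadKasprzak

/-! ### Bicharacters and the endomorphism `T` -/

section Bichar

/-- The Pontryagin dual of an abelian topological group, written additively: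
continuous homomorphisms to the circle, with the compact-open topology. -/
abbrev DualGroup (V : Type*) [AddCommGroup V] [TopologicalSpace V] : Type _ :=
  V →ₜ+ Additive Circle

variable {V : Type*} [AddCommGroup V] [TopologicalSpace V]

/-- The value `ξ(v) ∈ ℂ` of a character. -/
def charVal (ξ : DualGroup V) (v : V) : ℂ := ((Additive.toMul (ξ v) : Circle) : ℂ)

/-- A nondegenerate continuous bicharacter on `V` is an isomorphism of topological groups
`e¹ : V → V^`; this is the number `e(u, v) = e¹_u(v)`. -/
def pair (e : V ≃ₜ+ DualGroup V) (u v : V) : ℂ := charVal (e u) v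

/-- `e¹` as a continuous homomorphism. -/
def eHom (e : V ≃ₜ+ DualGroup V) : V →ₜ+ DualGroup V where
  toFun := e
  map_zero' := map_zero e
  map_add' := map_add e
  continuous_toFun := e.continuous_toFun

/-- The inverse of `e¹` as a continuous homomorphism. -/
def eInv (e : V ≃ₜ+ DualGroup V) : DualGroup V →ₜ+ V where
  toFun := e.symm
  map_zero' := map_zero e.symm
  map_add' := map_add e.symm
  continuous_toFun := e.continuous_invFun

/-- A continuous bicharacter `σ` on `V^` defines `σ¹ : V^ → V^^ ≅ V`, with
`η(σ¹ ξ) = σ(ξ, η)`.  The identification of the bidual with `V` is made through the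
(symmetric) self-duality `e`; the defining property is `apply_sigmaOne` below. -/
def sigmaOne (e : V ≃ₜ+ DualGroup V) (σ : DualGroup V →ₜ+ DualGroup (DualGroup V)) :
    DualGroup V →ₜ+ V :=
  (eInv e).comp ((ContinuousAddMonoidHom.compLeft (Additive Circle) (eHom e)).comp σ)

/-- `T = σ¹ ∘ e¹ : V → V`. -/
def opT (e : V ≃ₜ+ DualGroup V) (σ : DualGroup V →ₜ+ DualGroup (DualGroup V)) : V →ₜ+ V :=
  (sigmaOne e σ).comp (eHom e)

/-- The adjoint of `S : V → V` with respect to `e`: `e(S* u, w) = e(u, S w)`. -/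
def adjointE (e : V ≃ₜ+ DualGroup V) (S : V →ₜ+ V) : V →ₜ+ V :=
  (eInv e).comp ((ContinuousAddMonoidHom.compLeft (Additive Circle) S).comp (eHom e))

theorem apply_sigmaOne (e : V ≃ₜ+ DualGroup V) (he : ∀ u v, e u v = e v u)
    (σ : DualGroup V →ₜ+ DualGroup (DualGroup V)) (ξ η : DualGroup V) :
    η (sigmaOne e σ ξ) = σ ξ η := by
  obtain ⟨u, rfl⟩ := e.surjective η
  rw [he]
  have h : e (sigmaOne e σ ξ) = (σ ξ).comp (eHom e) := e.apply_symm_apply _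
  rw [h]
  rfl

theorem pair_adjointE (e : V ≃ₜ+ DualGroup V) (S : V →ₜ+ V) (u w : V) :
    pair e (adjointE e S u) w = pair e u (S w) := by
  have h : e (adjointE e S u) = (e u).comp S := e.apply_symm_apply _
  unfold pair
  rw [h]
  rfl

theorem continuous_charVal (ξ : DualGroup V) : Continuous (charVal ξ) := by
  unfold charVal
  exact continuous_subtype_val.comp (continuous_toMul.comp ξ.continuous_toFun)

theorem norm_charVal (ξ : DualGroup V) (v : V) : ‖charVal ξ v‖ = 1 :=
  Circle.norm_coe _

theorem pair_neg_left_eq (e : V ≃ₜ+ DualGroup V) (he : ∀ u v, e u v = e v u) (s v : V) :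
    pair e (-s) v = charVal (e v) (-s) := by
  unfold pair charVal
  rw [he]

end Bichar

/-! ### Fourier transform, test functions and summation kernels -/

section Fourier

variable {V : Type*} [AddCommGroup V] [TopologicalSpace V] [IsTopologicalAddGroup V]
  [MeasurableSpace V]

/-- The Fourier transform `ψ^(v) = ∫ e(s, v) ψ(s) ds`. -/
def fourierE (e : V ≃ₜ+ DualGroup V) (μ : Measure V) (ψ : V → ℂ) (v : V) : ℂ :=
  ∫ s, pair e s v * ψ s ∂μ

/-- The measure is normalised so that the Fourier transform (with `V^` identified with `V`
through `e`) is unitary. -/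
def UnitaryNormalised (e : V ≃ₜ+ DualGroup V) (μ : Measure V) : Prop :=
  ∀ f : V → ℂ, Integrable f μ → MemLp f 2 μ →
    ∫⁻ v, ‖fourierE e μ f v‖ₑ ^ 2 ∂μ = ∫⁻ v, ‖f v‖ₑ ^ 2 ∂μ

/-- `ψ` is a continuous, compactly supported probability density with support in `N` and
with integrable Fourier transform.  As `N` shrinks to `0`, the transforms `ψ^` are integrable
functions bounded by `1` which converge to `1` uniformly on compact sets: they are the
convergence factors in the regularised integrals below. -/
structure IsSummationKernel (e : V ≃ₜ+ DualGroup V) (μ : Measure V) (N : Set V)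
    (ψ : V → ℂ) : Prop where
  continuous : Continuous ψ
  hasCompactSupport : HasCompactSupport ψ
  support_subset : Function.support ψ ⊆ N
  nonneg : ∀ v, ∃ r : ℝ, 0 ≤ r ∧ ψ v = r
  integral_eq_one : ∫ v, ψ v ∂μ = 1
  integrable_fourier : Integrable (fourierE e μ ψ) μ

/-- The function `s ↦ e(-s, v) ψ(-s)`, whose Fourier transform is `u ↦ ψ^(v - u)`. -/
def reflectAt (e : V ≃ₜ+ DualGroup V) (ψ : V → ℂ) (v : V) (s : V) : ℂ :=
  pair e (-s) v * ψ (-s)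

theorem integrable_reflectAt [BorelSpace V] (e : V ≃ₜ+ DualGroup V)
    (he : ∀ u v, e u v = e v u) (μ : Measure V) [μ.IsNegInvariant]
    {ψ : V → ℂ} (hψ : Integrable ψ μ) (v : V) : Integrable (reflectAt e ψ v) μ := by
  have h1 : Integrable (fun s => ψ (-s)) μ := hψ.comp_neg
  have hc : Continuous fun s => pair e (-s) v := by
    simp only [pair_neg_left_eq e he]
    exact (continuous_charVal (e v)).comp continuous_neg
  exact h1.bdd_mul hc.aestronglyMeasurable
    (c := 1) (Eventually.of_forall fun s => (norm_charVal _ _).le)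

theorem fourierE_reflectAt [BorelSpace V] (e : V ≃ₜ+ DualGroup V)
    (μ : Measure V) [μ.IsNegInvariant] (ψ : V → ℂ) (v u : V) :
    fourierE e μ (reflectAt e ψ v) u = fourierE e μ ψ (v - u) := by
  unfold fourierE
  rw [← integral_neg_eq_self]
  congr 1
  ext s
  unfold reflectAt
  rw [neg_neg, ← mul_assoc]
  congr 1
  unfold pair charVal
  rw [← Circle.coe_mul]
  congr 1
  rw [← toMul_add]
  congr 1
  rw [map_neg, sub_eq_neg_add, map_add, map_neg]
  rfl

end Fourier

/-! ### Actions, smooth vectors and Rieffel's product -/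

/-- A strongly continuous action of `V` on a C*-algebra by *-automorphisms. -/
structure CStarAction (V A : Type*) [AddCommGroup V] [TopologicalSpace V]
    [NonUnitalCStarAlgebra A] where
  aut : V → (A ≃⋆ₐ[ℂ] A)
  aut_add : ∀ u v x, aut (u + v) x = aut u (aut v x)
  continuous_aut : ∀ x, Continuous fun v => aut v x

section Rieffel

variable {V : Type*} [AddCommGroup V] [TopologicalSpace V]
  {A : Type*} [NonUnitalCStarAlgebra A]

/-- `c` is a smooth vector: `v ↦ α_v(c)` is smooth on the Lie group `V`.  The smooth structure
is that given by the exponential map `exp : 𝔤 → V`, a local homeomorphism. -/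
def IsSmoothVector {𝔤 : Type*} [NormedAddCommGroup 𝔤] [NormedSpace ℝ 𝔤] (exp : 𝔤 →+ V)
    (α : CStarAction V A) (c : A) : Prop :=
  ContDiff ℝ ∞ fun x : 𝔤 => α.aut (exp x) c

/-- `x` is the deformed product `c ⋆ d = ∫∫ e(u, w) α_{T* u}(c) α_w(d) du dw`, the oscillatory
integral being the limit of the absolutely convergent integrals obtained by inserting the
convergence factors `ψ₁^(u) ψ₂^(w)`, with `ψ₁`, `ψ₂` concentrating at `0`. -/
def IsRieffelProduct [IsTopologicalAddGroup V] [MeasurableSpace V]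
    (e : V ≃ₜ+ DualGroup V) (σ : DualGroup V →ₜ+ DualGroup (DualGroup V)) (μ : Measure V)
    (α : CStarAction V A) (c d x : A) : Prop :=
  ∀ ε > 0, ∃ N ∈ 𝓝 (0 : V), ∀ ψ₁ ψ₂ : V → ℂ,
    IsSummationKernel e μ N ψ₁ → IsSummationKernel e μ N ψ₂ →
      ‖(∫ u, ∫ w, (fourierE e μ ψ₁ u * fourierE e μ ψ₂ w * pair e u w) •
          (α.aut (adjointE e (opT e σ) u) c * α.aut w d) ∂μ ∂μ) - x‖ < ε

end Rieffel

/-! ### The crossed product, its multipliers, and the deformed dual action -/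

section Crossed

variable {V : Type*} [AddCommGroup V] [TopologicalSpace V] [IsTopologicalAddGroup V]
  [LocallyCompactSpace V] [SecondCountableTopology V] [MeasurableSpace V] [BorelSpace V]
  {A : Type*} [NonUnitalCStarAlgebra A]
  {H : Type*} [NormedAddCommGroup H] [InnerProductSpace ℂ H] [CompleteSpace H]

/-- Pointwise multiplication by an essentially bounded operator valued function on
`L²(V; H)`. -/
def mulOp {H : Type*} [NormedAddCommGroup H] [InnerProductSpace ℂ H] (μ : Measure V) (F : V → H →L[ℂ] H) (hF : MemLp F ∞ μ) :
    Lp H 2 μ →L[ℂ] Lp H 2 μ :=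
  (ContinuousLinearMap.id ℂ (H →L[ℂ] H)).holderL μ ∞ 2 2 (hF.toLp F)

theorem memLp_orbit (μ : Measure V) (α : CStarAction V A) (π : A →⋆ₙₐ[ℂ] (H →L[ℂ] H)) (c : A) :
    MemLp (fun v => π (α.aut (-v) c)) ∞ μ := by
  have hπ : Continuous π := by
    refine AddMonoidHomClass.continuous_of_bound π 1 fun x => ?_
    simpa using NonUnitalStarAlgHom.norm_apply_le π x
  refine memLp_top_of_bound (C := ‖c‖) ?_ ?_
  · exact (hπ.comp ((α.continuous_aut c).comp continuous_neg)).aestronglyMeasurable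
  · refine Eventually.of_forall fun v => ?_
    refine (NonUnitalStarAlgHom.norm_apply_le π _).trans ?_
    exact NonUnitalStarAlgHom.norm_apply_le ((α.aut (-v) : A ≃⋆ₐ[ℂ] A) : A →⋆ₙₐ[ℂ] A) c

theorem memLp_char (H : Type*) [NormedAddCommGroup H] [InnerProductSpace ℂ H]
    (μ : Measure V) (ξ : DualGroup V) :
    MemLp (fun v => charVal ξ v • ContinuousLinearMap.id ℂ H) ∞ μ := by
  refine memLp_top_of_bound (C := ‖ContinuousLinearMap.id ℂ H‖) ?_ ?_
  · exact ((continuous_charVal ξ).smul continuous_const).aestronglyMeasurable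
  · refine Eventually.of_forall fun v => ?_
    rw [norm_smul, norm_charVal, one_mul]

/-- The regular representation of `A` on `L²(V; H)`: `(π~(c) h)(v) = π(α_{-v}(c)) h(v)`. -/
def regRep (μ : Measure V) (α : CStarAction V A) (π : A →⋆ₙₐ[ℂ] (H →L[ℂ] H)) (c : A) :
    Lp H 2 μ →L[ℂ] Lp H 2 μ :=
  mulOp μ (fun v => π (α.aut (-v) c)) (memLp_orbit μ α π c)

/-- The unitary implementing the dual action: multiplication by the character `ξ`. -/
def charOp (H : Type*) [NormedAddCommGroup H] [InnerProductSpace ℂ H] (μ : Measure V)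
    (ξ : DualGroup V) : Lp H 2 μ →L[ℂ] Lp H 2 μ :=
  mulOp μ (fun v => charVal ξ v • ContinuousLinearMap.id ℂ H) (memLp_char H μ ξ)

/-- The unitaries `λ_u` on `L²(V; H)`: `(λ_u h)(v) = h(v - u)`. -/
def lam (H : Type*) [NormedAddCommGroup H] [InnerProductSpace ℂ H] (μ : Measure V)
    [μ.IsAddLeftInvariant] (u : V) : Lp H 2 μ →L[ℂ] Lp H 2 μ :=
  (Lp.compMeasurePreservingₗᵢ ℂ (fun v => v - u)
    (measurePreserving_sub_right μ u)).toContinuousLinearMap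

/-- The crossed product `B = A ×_α V`, realised on `L²(V; H)`: the C*-algebra generated by the
operators `∫ π~(f(u)) λ_u du` with `f : V → A` continuous and compactly supported. -/
def crossedProduct (μ : Measure V) [μ.IsAddLeftInvariant] (α : CStarAction V A)
    (π : A →⋆ₙₐ[ℂ] (H →L[ℂ] H)) :
    NonUnitalStarSubalgebra ℂ (Lp H 2 μ →L[ℂ] Lp H 2 μ) :=
  (NonUnitalStarAlgebra.adjoin ℂ
    {X : Lp H 2 μ →L[ℂ] Lp H 2 μ | ∃ f : V → A, Continuous f ∧ HasCompactSupport f ∧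
      ∀ h, X h = ∫ u, regRep μ α π (f u) (lam H μ u h) ∂μ}).topologicalClosure

/-- The multiplier algebra of `B`, realised as the idealiser of the (nondegenerately
represented) C*-algebra `B` in the bounded operators on `L²(V; H)`. -/
def multiplierAlgebra (μ : Measure V) [μ.IsAddLeftInvariant] (α : CStarAction V A)
    (π : A →⋆ₙₐ[ℂ] (H →L[ℂ] H)) : Set (Lp H 2 μ →L[ℂ] Lp H 2 μ) :=
  {m | ∀ X ∈ crossedProduct μ α π, m * X ∈ crossedProduct μ α π ∧ X * m ∈ crossedProduct μ α π}

/-- The dual action: `a(v) ↦ ξ(v) a(v)`, so that `λ_v ↦ ξ(v) λ_v`. -/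
def dualAction (μ : Measure V) (ξ : DualGroup V)
    (m : Lp H 2 μ →L[ℂ] Lp H 2 μ) : Lp H 2 μ →L[ℂ] Lp H 2 μ :=
  charOp H μ ξ * m * star (charOp H μ ξ)

/-- The dual action deformed by `σ`: `m ↦ U_ξ^* α^_ξ(m) U_ξ`, where `U_ξ = λ(σ¹_ξ)`. -/
def deformedDualAction (e : V ≃ₜ+ DualGroup V) (σ : DualGroup V →ₜ+ DualGroup (DualGroup V))
    (μ : Measure V) [μ.IsAddLeftInvariant] (ξ : DualGroup V)
    (m : Lp H 2 μ →L[ℂ] Lp H 2 μ) : Lp H 2 μ →L[ℂ] Lp H 2 μ :=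
  star (lam H μ (sigmaOne e σ ξ)) * dualAction μ ξ m * lam H μ (sigmaOne e σ ξ)

/-- The fixed point algebra of the deformed dual action in the multiplier algebra. -/
def fixedPointAlgebra (e : V ≃ₜ+ DualGroup V) (σ : DualGroup V →ₜ+ DualGroup (DualGroup V))
    (μ : Measure V) [μ.IsAddLeftInvariant] (α : CStarAction V A)
    (π : A →⋆ₙₐ[ℂ] (H →L[ℂ] H)) : Set (Lp H 2 μ →L[ℂ] Lp H 2 μ) :=
  {m | m ∈ multiplierAlgebra μ α π ∧ ∀ ξ, deformedDualAction e σ μ ξ m = m}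

/-- The operator `m` is `∫ a(v) λ_v dv` for the `A`-valued pseudomeasure `a(v) dv` on `V`, given
by its pairings `a(ψ) = ∫ ψ^(v) a(v) dv` with the elements `ψ^`, `ψ ∈ L¹(V)`, of the Fourier
algebra.  That is, `m` is the (covariant) convolution with `a`:
`(m h)(v) = ∫ π(α_{-v}(a(u))) h(v - u) du`, where it suffices to let `h = ψ^ ⊗ k` with `ψ` in
`L¹(V)`, `ψ^` in `L²(V)` and `k ∈ H`. -/
def HasSymbol (e : V ≃ₜ+ DualGroup V) (he : ∀ u v, e u v = e v u)
    (μ : Measure V) [μ.IsAddHaarMeasure] (α : CStarAction V A)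
    (π : A →⋆ₙₐ[ℂ] (H →L[ℂ] H)) (m : Lp H 2 μ →L[ℂ] Lp H 2 μ)
    (a : Lp ℂ 1 μ →L[ℂ] A) : Prop :=
  ∀ (ψ : V → ℂ) (hψ : Integrable ψ μ) (k : H) (h : Lp H 2 μ),
    (h =ᵐ[μ] fun v => fourierE e μ ψ v • k) →
      m h =ᵐ[μ] fun v =>
        π (α.aut (-v) (a ((integrable_reflectAt e he μ hψ v).toL1 (reflectAt e ψ v)))) k

/-- `I(m) = x`: the operator `m` is `∫ a(v) λ_v dv` for an `A`-valued pseudomeasure `a`, and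
`x = ∫ a(v) dv`, the limit of `∫ ψ^(v) a(v) dv` as the convergence factor `ψ^` tends to `1`. -/
def HasIntegral (e : V ≃ₜ+ DualGroup V) (he : ∀ u v, e u v = e v u)
    (μ : Measure V) [μ.IsAddHaarMeasure] (α : CStarAction V A)
    (π : A →⋆ₙₐ[ℂ] (H →L[ℂ] H)) (m : Lp H 2 μ →L[ℂ] Lp H 2 μ) (x : A) : Prop :=
  ∃ a : Lp ℂ 1 μ →L[ℂ] A, HasSymbol e he μ α π m a ∧
    ∀ ε > 0, ∃ N ∈ 𝓝 (0 : V), ∀ (ψ : V → ℂ) (hψ : Integrable ψ μ),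
      IsSummationKernel e μ N ψ → ‖a (hψ.toL1 ψ) - x‖ < ε

end Crossed

end LandstadKasprzak

end

open MeasureTheory Filter Topology
open scoped ENNReal ContDiff

noncomputable section

set_option linter.unusedSectionVars false

namespace LandstadKasprzak

/-! ### Bicharacters -/

section PairLemmas

variable {V : Type*} [AddCommGroup V] [TopologicalSpace V]

/-! For s in V let W_s be the unitary M_{e(s)}^* λ_{Ts}. Since e¹ is onto, being fixed by the
deformed dual action means commuting with every W_s (`deformedDualAction_eq_iff`). If m is such an
operator with pseudomeasure q, comparing m W_s h and W_s m h for h = ψ^ ⊗ k shows that q is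
covariant: translating ρ by s applies α_{Ts} to q(ρ) (`HasSymbol.translate`). Approximating ψ by
convolutions ρ_n * ψ with kernels ρ_n concentrating at 0 then gives q(ψ) = ∫ ψ(s) α_{Ts}(c) ds with
c = I(m) (`HasSymbol.eq_orbitSymbol`). So the symbol of m is recovered from I(m). Conversely, an
operator with the symbol `orbitSymbol μ α T x` has integral x by strong continuity of α
(`hasIntegral_of_hasSymbol_orbitSymbol`). Multiplicativity thus becomes a statement about symbols:
those of c and d compose to that of c ⋆ d (`HasSymbol.mul`).

For the composition, a is approximated by a after a cut-off and a mollification; this is an integral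
operator whose kernel is explicit on all of L² (`HasSymbol.apply_mollify`). Applied to b(ψ^ ⊗ k),
Fubini and two substitutions (`integral_convKernel_mul`) give an average of α_{-v-Ts}(R_n(s, v))
against e(s, v)ψ(s), where R_n(s, v) is a regularised integral for c ⋆ d. Here T* = -T, by
antisymmetry of σ. The convergence factors in R_n come from kernels multiplied by characters
depending on s and v. These kernels are not positive, so the defining limit of c ⋆ d does not apply
to them directly.

The analytic core, `exists_regularised`, supplies what is needed: a bounded continuous Z on V × V
such that the integral with convergence factors ψ₁^, ψ₂^ equals ∫∫ ψ₁(p) ψ₂(q) Z(p, q), for all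
integrable ψ₁, ψ₂ with integrable transforms. Formally Z(p, q) = ∫∫ e(p, u) e(q, w) e(u, w)
α_{T*u}(c) α_w(d) du dw. The value Z(0) is then c ⋆ d, and characters multiplying ψ₁ and ψ₂ become
harmless factors tending to 1.

Z is made absolutely convergent by a coordinate-free integration by parts. Taylor's formula writes c
as an average over t in [0, 1] of α_{exp(tX)} applied to c and to its derivative. Moving the
translation onto u, which needs T invertible, produces the factor ∫ ω(t) e(E(tX), w) dt, where T*E =
-exp. Over all coordinate directions these factors multiply to the Fourier transform of a bounded
function on a cube, which lies in L² by Plancherel. Doing this twice gives a product of two L²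
functions, hence decay in L¹(w). The same procedure applied to d and the w-integral gives decay in
L¹(u) (`oscLeft_smoothing`, `oscRight_smoothing`). -/

theorem charVal_add (ξ : DualGroup V) (u v : V) :
    charVal ξ (u + v) = charVal ξ u * charVal ξ v := by
  unfold charVal
  rw [map_add, toMul_add, Circle.coe_mul]

theorem charVal_neg (ξ : DualGroup V) (v : V) :
    charVal ξ (-v) = star (charVal ξ v) := by
  unfold charVal
  rw [map_neg, toMul_neg, Circle.coe_inv_eq_conj]
  rfl

theorem pair_comm {e : V ≃ₜ+ DualGroup V} (he : ∀ u v, e u v = e v u) (u v : V) :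
    pair e u v = pair e v u := by
  unfold pair charVal
  rw [he]

theorem pair_add_right (e : V ≃ₜ+ DualGroup V) (u v w : V) :
    pair e u (v + w) = pair e u v * pair e u w := charVal_add _ _ _

theorem pair_add_left (e : V ≃ₜ+ DualGroup V) (u v w : V) :
    pair e (u + v) w = pair e u w * pair e v w := by
  unfold pair charVal
  rw [map_add, ← Circle.coe_mul, ← toMul_add]
  rfl

theorem pair_zero_right (e : V ≃ₜ+ DualGroup V) (u : V) : pair e u 0 = 1 := by
  unfold pair charVal
  simp

theorem pair_zero_left (e : V ≃ₜ+ DualGroup V) (u : V) : pair e 0 u = 1 := by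
  unfold pair charVal
  rw [map_zero]
  rfl

theorem norm_pair (e : V ≃ₜ+ DualGroup V) (u v : V) : ‖pair e u v‖ = 1 := norm_charVal _ _

theorem pair_neg_right (e : V ≃ₜ+ DualGroup V) (u v : V) :
    pair e u (-v) = star (pair e u v) := charVal_neg _ _

theorem pair_neg_left (e : V ≃ₜ+ DualGroup V) (u v : V) :
    pair e (-u) v = star (pair e u v) := by
  have h : pair e (-u) v * pair e u v = 1 := by
    rw [← pair_add_left, neg_add_cancel, pair_zero_left]
  have h2 : star (pair e u v) * pair e u v = 1 := by
    rw [← pair_neg_right, ← pair_add_right, neg_add_cancel, pair_zero_right]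
  have h3 : pair e u v ≠ 0 := by
    intro h0
    simpa [h0] using norm_pair e u v
  exact mul_right_cancel₀ h3 (h.trans h2.symm)

/-- Local compactness makes evaluation jointly continuous for the compact-open topology. -/
theorem continuous_pair [LocallyCompactSpace V] (e : V ≃ₜ+ DualGroup V) :
    Continuous fun p : V × V => pair e p.1 p.2 := by
  have h : Continuous fun p : V × V => (e p.1) p.2 :=
    (e.continuous_toFun.comp continuous_fst).eval continuous_snd
  exact continuous_subtype_val.comp (continuous_toMul.comp h)

@[fun_prop]
theorem Continuous.pair [LocallyCompactSpace V] (e : V ≃ₜ+ DualGroup V) {X : Type*}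
    [TopologicalSpace X] {f g : X → V} (hf : Continuous f) (hg : Continuous g) :
    Continuous fun x => pair e (f x) (g x) :=
  (continuous_pair e).comp (hf.prodMk hg)

end PairLemmas

/-! ### The Fourier transform on integrable functions -/

section FourierLemmas

variable {V : Type*} [AddCommGroup V] [TopologicalSpace V]
  [LocallyCompactSpace V] [SecondCountableTopology V] [MeasurableSpace V] [BorelSpace V]
  (e : V ≃ₜ+ DualGroup V) {μ : Measure V}

theorem integrable_pair_mul {ψ : V → ℂ} (hψ : Integrable ψ μ) (v : V) :
    Integrable (fun s => pair e s v * ψ s) μ :=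
  hψ.bdd_mul (c := 1) (by fun_prop : Continuous fun s => pair e s v).aestronglyMeasurable
    (Eventually.of_forall fun s => (norm_pair _ _ _).le)

theorem integrable_pair_mul' {ψ : V → ℂ} (hψ : Integrable ψ μ) (v : V) :
    Integrable (fun s => pair e v s * ψ s) μ :=
  hψ.bdd_mul (c := 1) (by fun_prop : Continuous fun s => pair e v s).aestronglyMeasurable
    (Eventually.of_forall fun s => (norm_pair _ _ _).le)

theorem norm_fourierE_le (ψ : V → ℂ) (v : V) : ‖fourierE e μ ψ v‖ ≤ ∫ s, ‖ψ s‖ ∂μ := by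
  refine (norm_integral_le_integral_norm _).trans_eq ?_
  simp [norm_pair]

theorem continuous_fourierE {ψ : V → ℂ} (hψ : Integrable ψ μ) : Continuous (fourierE e μ ψ) := by
  refine continuous_of_dominated (bound := fun s => ‖ψ s‖)
    (fun v => (integrable_pair_mul e hψ v).aestronglyMeasurable) ?_ hψ.norm ?_
  · intro v
    simp [norm_pair]
  · refine Eventually.of_forall fun s => ?_
    fun_prop

theorem fourierE_pair_mul {ψ : V → ℂ} (p v : V) (he : ∀ u v, e u v = e v u) :
    fourierE e μ (fun s => pair e p s * ψ s) v = fourierE e μ ψ (v + p) := by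
  unfold fourierE
  congr 1
  ext s
  simp only []
  rw [pair_add_right, pair_comm he p s]
  ring

end FourierLemmas

/-! ### Actions by automorphisms -/

section ActionLemmas

variable {V : Type*} [AddCommGroup V] [TopologicalSpace V]
  {A : Type*} [NonUnitalCStarAlgebra A] (α : CStarAction V A)

theorem CStarAction.norm_aut (v : V) (x : A) : ‖α.aut v x‖ = ‖x‖ := by
  exact NonUnitalStarAlgHom.norm_map ((α.aut v : A ≃⋆ₐ[ℂ] A) : A →⋆ₙₐ[ℂ] A)
    (α.aut v).injective x

theorem CStarAction.aut_zero (x : A) : α.aut 0 x = x := by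
  have h : α.aut 0 (α.aut 0 x) = α.aut 0 x := by rw [← α.aut_add, add_zero]
  exact (α.aut 0).injective h

/-- The automorphism `α_v` as a continuous linear map. -/
def CStarAction.autL (v : V) : A →L[ℂ] A :=
  LinearMap.mkContinuous
    { toFun := α.aut v
      map_add' := map_add (α.aut v)
      map_smul' := map_smul (α.aut v) } 1 fun x => by
      rw [one_mul]
      exact (α.norm_aut v x).le

@[simp]
theorem CStarAction.autL_apply (v : V) (x : A) : α.autL v x = α.aut v x := rfl

/-- The automorphisms are isometric, hence equicontinuous, so strong continuity upgrades to joint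
continuity. -/
theorem CStarAction.continuous_aut₂ : Continuous fun p : V × A => α.aut p.1 p.2 := by
  rw [continuous_iff_continuousAt]
  rintro ⟨v, x⟩
  rw [ContinuousAt, tendsto_iff_norm_sub_tendsto_zero]
  have h1 : Tendsto (fun p : V × A => ‖p.2 - x‖ + ‖α.aut p.1 x - α.aut v x‖) (𝓝 (v, x)) (𝓝 0) := by
    have hc : Continuous (fun p : V × A => ‖p.2 - x‖ + ‖α.aut p.1 x - α.aut v x‖) := by
      have := (α.continuous_aut x).comp (continuous_fst : Continuous (Prod.fst : V × A → V))
      exact ((continuous_snd.sub continuous_const).norm).add ((this.sub continuous_const).norm)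
    simpa using hc.tendsto (v, x)
  refine squeeze_zero (fun _ => norm_nonneg _) (fun p => ?_) h1
  calc ‖α.aut p.1 p.2 - α.aut v x‖
      = ‖α.aut p.1 (p.2 - x) + (α.aut p.1 x - α.aut v x)‖ := by rw [map_sub]; congr 1; abel
    _ ≤ _ := (norm_add_le _ _).trans_eq (by rw [α.norm_aut])

@[fun_prop]
theorem CStarAction.continuous_aut_comp {X : Type*} [TopologicalSpace X] {f : X → V} {g : X → A}
    (hf : Continuous f) (hg : Continuous g) : Continuous fun x => α.aut (f x) (g x) :=
  α.continuous_aut₂.comp (hf.prodMk hg)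

/-- Integrability is not needed: α_v is invertible, so f and α_v ∘ f are integrable together, and
otherwise both integrals are 0 by convention. -/
theorem CStarAction.aut_integral {X : Type*} [MeasurableSpace X] (m : Measure X) (v : V)
    (f : X → A) : α.aut v (∫ x, f x ∂m) = ∫ x, α.aut v (f x) ∂m := by
  by_cases hf : Integrable f m
  · exact ((α.autL v).integral_comp_comm hf).symm
  · rw [integral_undef hf, map_zero, integral_undef]
    intro h
    apply hf
    have := (α.autL (-v)).integrable_comp h
    refine this.congr (Eventually.of_forall fun x => ?_)
    simp [← α.aut_add, α.aut_zero]

theorem continuous_of_nonUnitalStarAlgHom {B : Type*} [NonUnitalCStarAlgebra B]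
    (π : A →⋆ₙₐ[ℂ] B) : Continuous π := by
  refine AddMonoidHomClass.continuous_of_bound π 1 fun x => ?_
  simpa using NonUnitalStarAlgHom.norm_apply_le π x

/-- A *-homomorphism of C*-algebras as a continuous linear map. -/
def starHomL {B : Type*} [NonUnitalCStarAlgebra B] (π : A →⋆ₙₐ[ℂ] B) : A →L[ℂ] B where
  toFun := π
  map_add' := map_add π
  map_smul' := map_smul π
  cont := continuous_of_nonUnitalStarAlgHom π

end ActionLemmas

/-! ### Plancherel's formula and summation kernels -/

section Plancherel

variable {V : Type*} [AddCommGroup V] [TopologicalSpace V] [IsTopologicalAddGroup V]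
  [LocallyCompactSpace V] [SecondCountableTopology V] [MeasurableSpace V] [BorelSpace V]
  {e : V ≃ₜ+ DualGroup V} {μ : Measure V}

theorem UnitaryNormalised.memLp_fourierE (hμ : UnitaryNormalised e μ) {f : V → ℂ}
    (h1 : Integrable f μ) (h2 : MemLp f 2 μ) : MemLp (fourierE e μ f) 2 μ := by
  refine ⟨(continuous_fourierE e h1).aestronglyMeasurable, ?_⟩
  have h3 := h2.2
  rw [eLpNorm_lt_top_iff_lintegral_rpow_enorm_lt_top (by norm_num) (by norm_num)] at h3 ⊢
  have h4 := hμ f h1 h2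
  simp only [ENNReal.toReal_ofNat, ENNReal.rpow_ofNat] at h3 ⊢
  rwa [h4]

theorem UnitaryNormalised.integral_norm_sq (hμ : UnitaryNormalised e μ) {f : V → ℂ}
    (h1 : Integrable f μ) (h2 : MemLp f 2 μ) :
    ∫ v, ((‖fourierE e μ f v‖ : ℂ)) ^ 2 ∂μ = ∫ v, ((‖f v‖ : ℂ)) ^ 2 ∂μ := by
  have h4 := hμ f h1 h2
  have key : ∀ g : V → ℂ, AEStronglyMeasurable g μ →
      ∫ v, ((‖g v‖ : ℂ)) ^ 2 ∂μ = ((∫⁻ v, ‖g v‖ₑ ^ 2 ∂μ).toReal : ℂ) := by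
    intro g hg
    have : ∫ v, ‖g v‖ ^ 2 ∂μ = (∫⁻ v, ‖g v‖ₑ ^ 2 ∂μ).toReal := by
      rw [integral_eq_lintegral_of_nonneg_ae
        (Eventually.of_forall fun v => sq_nonneg _) (by exact hg.norm.pow 2)]
      congr 2
      ext v
      rw [ENNReal.ofReal_pow (norm_nonneg _), ofReal_norm]
    rw [← this, ← integral_complex_ofReal]
    simp
  rw [key _ (continuous_fourierE e h1).aestronglyMeasurable, key _ h1.aestronglyMeasurable, h4]

theorem fourierE_add {f g : V → ℂ} (hf : Integrable f μ) (hg : Integrable g μ) (v : V) :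
    fourierE e μ (fun s => f s + g s) v = fourierE e μ f v + fourierE e μ g v := by
  unfold fourierE
  simp only [mul_add]
  exact integral_add (integrable_pair_mul e hf v) (integrable_pair_mul e hg v)

theorem fourierE_const_mul (c : ℂ) (f : V → ℂ) (v : V) :
    fourierE e μ (fun s => c * f s) v = c * fourierE e μ f v := by
  unfold fourierE
  rw [← integral_const_mul]
  congr 1
  ext s
  ring

/-- Polarisation of the norm identity; the norms are cast to ℂ so that the four terms can be
combined with coefficients ±i. -/
theorem UnitaryNormalised.integral_inner (hμ : UnitaryNormalised e μ) {f g : V → ℂ}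
    (hf : Integrable f μ) (hf2 : MemLp f 2 μ) (hg : Integrable g μ) (hg2 : MemLp g 2 μ) :
    ∫ v, inner ℂ (fourierE e μ f v) (fourierE e μ g v) ∂μ = ∫ v, inner ℂ (f v) (g v) ∂μ := by
  have key : ∀ c : ℂ, ∫ v, ((‖fourierE e μ f v + c * fourierE e μ g v‖ : ℂ)) ^ 2 ∂μ =
      ∫ v, ((‖f v + c * g v‖ : ℂ)) ^ 2 ∂μ := by
    intro c
    have := hμ.integral_norm_sq (hf.add (hg.const_mul c)) (hf2.add (hg2.const_mul c))
    calc _ = ∫ v, ((‖fourierE e μ (f + fun x => c * g x) v‖ : ℂ)) ^ 2 ∂μ := by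
          congr 1
          ext v
          rw [← fourierE_const_mul, ← fourierE_add hf (hg.const_mul c)]
          rfl
      _ = _ := this
  have hint : ∀ (p q : V → ℂ), MemLp p 2 μ → MemLp q 2 μ → ∀ c : ℂ,
      Integrable (fun v => ((‖p v + c * q v‖ : ℂ)) ^ 2) μ := by
    intro p q hp hq c
    have h := (hp.add (hq.const_mul c))
    have := ((memLp_two_iff_integrable_sq_norm h.1).1 h).ofReal (𝕜 := ℂ)
    refine this.congr (Eventually.of_forall fun v => ?_)
    simp
  have pol : ∀ (p q : V → ℂ), MemLp p 2 μ → MemLp q 2 μ → ∫ v, inner ℂ (p v) (q v) ∂μ =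
      (∫ v, ((‖p v + 1 * q v‖ : ℂ)) ^ 2 ∂μ - ∫ v, ((‖p v + (-1) * q v‖ : ℂ)) ^ 2 ∂μ +
      (∫ v, ((‖p v + (-Complex.I) * q v‖ : ℂ)) ^ 2 ∂μ -
        ∫ v, ((‖p v + Complex.I * q v‖ : ℂ)) ^ 2 ∂μ) * Complex.I) / 4 := by
    intro p q hp hq
    have h1 := hint p q hp hq
    have h2 : ∀ v, inner ℂ (p v) (q v) =
        ((((‖p v + 1 * q v‖ : ℂ)) ^ 2 - ((‖p v + (-1) * q v‖ : ℂ)) ^ 2) +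
        (((‖p v + (-Complex.I) * q v‖ : ℂ)) ^ 2 - ((‖p v + Complex.I * q v‖ : ℂ)) ^ 2)
          * Complex.I) / 4 := by
      intro v
      rw [inner_eq_sum_norm_sq_div_four]
      simp [sub_eq_add_neg]
    simp only [h2]
    rw [integral_div, integral_add, integral_mul_const, integral_sub (h1 _) (h1 _),
      integral_sub (h1 _) (h1 _)]
    · exact (h1 _).sub (h1 _)
    · exact ((h1 _).sub (h1 _)).mul_const _
  rw [pol _ _ (hμ.memLp_fourierE hf hf2) (hμ.memLp_fourierE hg hg2), pol _ _ hf2 hg2]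
  simp only [key]

end Plancherel

/-! ### Existence of summation kernels, and averaging against them. -/

section Kernels

variable {V : Type*} [AddCommGroup V] [TopologicalSpace V] [IsTopologicalAddGroup V]
  [LocallyCompactSpace V] [SecondCountableTopology V] [MeasurableSpace V] [BorelSpace V]
  {e : V ≃ₜ+ DualGroup V} {μ : Measure V}

theorem exists_compactSupport_real [μ.IsAddHaarMeasure] {W : Set V} (hW : W ∈ 𝓝 (0 : V)) :
    ∃ f : V → ℝ, Continuous f ∧ HasCompactSupport f ∧ Function.support f ⊆ W ∧ (∀ v, 0 ≤ f v) ∧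
      ∫ v, f v ∂μ = 1 := by
  obtain ⟨f, hf1, hf0, hfc, hf01⟩ := exists_continuous_one_zero_of_isCompact
    (isCompact_singleton (x := (0 : V))) (isOpen_interior (s := W)).isClosed_compl
    (by
      rw [Set.disjoint_compl_right_iff_subset]
      simpa using mem_interior_iff_mem_nhds.2 hW)
  have hpos : 0 < ∫ v, f v ∂μ := by
    refine f.continuous.integral_pos_of_hasCompactSupport_nonneg_nonzero hfc
      (fun v => (hf01 v).1) (x := 0) ?_
    rw [hf1 rfl]
    exact one_ne_zero
  refine ⟨fun v => (∫ v, f v ∂μ)⁻¹ * f v, by fun_prop, hfc.mul_left, ?_, ?_, ?_⟩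
  · intro v hv
    by_contra hvW
    apply hv
    have : f v = 0 := hf0 (fun h => hvW (interior_subset h))
    simp [this]
  · intro v
    have := (hf01 v).1
    positivity
  · rw [integral_const_mul, inv_mul_cancel₀ hpos.ne']

/-- The kernel is the autocorrelation of a bump f, whose transform |f^|² is integrable because f^ is
in L². The inversion clause comes without a general inversion theorem: it is the polarised
Plancherel formula for f and one of its translates. -/
theorem exists_summationKernel (he : ∀ u v, e u v = e v u) [μ.IsAddHaarMeasure]
    (hμ : UnitaryNormalised e μ)
    {N : Set V} (hN : N ∈ 𝓝 (0 : V)) : ∃ ψ : V → ℂ, IsSummationKernel e μ N ψ ∧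
      ∀ v, fourierE e μ (fourierE e μ ψ) v = ψ (-v) := by
  obtain ⟨W, hW, hWN⟩ : ∃ W ∈ 𝓝 (0 : V), ∀ x ∈ W, ∀ y ∈ W, x - y ∈ N := by
    have h : Tendsto (fun p : V × V => p.1 - p.2) (𝓝 (0, 0)) (𝓝 0) := by
      have : Continuous (fun p : V × V => p.1 - p.2) := by fun_prop
      simpa using this.tendsto (0, 0)
    rw [nhds_prod_eq] at h
    obtain ⟨W, hW, h2⟩ := (Filter.mem_prod_self_iff).1 (h hN)
    exact ⟨W, hW, fun x hx y hy => h2 (Set.mk_mem_prod hx hy)⟩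
  obtain ⟨g, hgc, hgs, hgW, hg0, hg1⟩ := exists_compactSupport_real (μ := μ) hW
  set f : V → ℂ := fun v => (g v : ℂ) with hf
  have hfc : Continuous f := by fun_prop
  have hfs : HasCompactSupport f := hgs.comp_left (g := fun x : ℝ => (x : ℂ)) (by simp)
  have hfi : Integrable f μ := hfc.integrable_of_hasCompactSupport hfs
  have hf2 : MemLp f 2 μ := hfc.memLp_of_hasCompactSupport hfs
  set F := fourierE e μ f with hF
  have hFr : ∀ r, F r = ∫ s, pair e s r * f s ∂μ := fun _ => rfl
  have hF2 : MemLp F 2 μ := hμ.memLp_fourierE hfi hf2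
  set P : V → ℂ := fun r => ((‖F r‖ ^ 2 : ℝ) : ℂ) with hP
  have hPi : Integrable P μ := ((memLp_two_iff_integrable_sq_norm hF2.1).1 hF2).ofReal
  set ψ : V → ℂ := fun v => ∫ s, f s * f (s + v) ∂μ with hψ
  -- `ψ` is the Fourier transform of `P`
  have h1 : ∀ v, fourierE e μ P v = ψ (-v) := by
    intro v
    have htr : ∀ r, fourierE e μ (fun s => f (s + -v)) r = pair e v r * F r := by
      intro r
      unfold fourierE
      rw [← integral_add_right_eq_self _ v, hFr, ← integral_const_mul]
      congr 1
      ext s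
      simp only []
      rw [pair_add_left, add_neg_cancel_right]
      ring
    have hti : Integrable (fun s => f (s + -v)) μ := hfi.comp_add_right (-v)
    -- Translating f multiplies its transform by a character, so pairing f with its translate on the
    -- Fourier side gives the transform of |f^|².
    have ht2 : MemLp (fun s => f (s + -v)) 2 μ :=
      hf2.comp_measurePreserving (measurePreserving_add_right μ (-v))
    have := hμ.integral_inner hfi hf2 hti ht2
    simp only [htr] at this
    rw [hψ]
    simp only
    rw [show (∫ s, f s * f (s + -v) ∂μ) = ∫ s, inner ℂ (f s) (f (s + -v)) ∂μ by
      congr 1; ext s; simp [hf, mul_comm], ← this]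
    refine integral_congr_ae (Eventually.of_forall fun r => ?_)
    simp only []
    rw [pair_comm he r v, ← hF, ← smul_eq_mul (a := pair e v r) (b := F r),
      inner_smul_right, hP, inner_self_eq_norm_sq_to_K]
    simp
  -- the Fourier transform of `ψ` is `P`
  have h2 : ∀ r, fourierE e μ ψ r = P r := by
    intro r
    have hint : Integrable (fun z : V × V => f z.1 * f (z.1 + z.2)) (μ.prod μ) :=
      (measurePreserving_prod_add μ μ).integrable_comp_of_integrable (hfi.mul_prod hfi)
    have hint2 : Integrable (fun z : V × V => pair e z.2 r * (f z.1 * f (z.1 + z.2)))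
        (μ.prod μ) := by
      refine hint.bdd_mul (c := 1) ?_ (Eventually.of_forall fun z => (norm_pair _ _ _).le)
      exact (by fun_prop : Continuous fun z : V × V => pair e z.2 r).aestronglyMeasurable
    have hF' : ∀ s, ∫ v, pair e v r * (f s * f (s + v)) ∂μ = (star (pair e s r) * f s) * F r := by
      intro s
      rw [hFr, ← integral_const_mul, ← integral_add_left_eq_self (μ := μ) (fun v =>
        star (pair e s r) * f s * (pair e v r * f v)) s]
      congr 1
      ext v
      rw [pair_add_left]
      have : star (pair e s r) * pair e s r = 1 := by
        rw [← pair_neg_left, ← pair_add_left, neg_add_cancel, pair_zero_left]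
      linear_combination (-(f s * pair e v r * f (s + v))) * this
    calc fourierE e μ ψ r = ∫ v, ∫ s, pair e v r * (f s * f (s + v)) ∂μ ∂μ := by
          unfold fourierE
          congr 1
          ext v
          rw [← integral_const_mul]
      _ = ∫ s, ∫ v, pair e v r * (f s * f (s + v)) ∂μ ∂μ :=
          (integral_integral_swap (f := fun s v => pair e v r * (f s * f (s + v))) hint2).symm
      _ = star (F r) * F r := by
          simp only [hF']
          rw [integral_mul_const]
          congr 1
          rw [hF]
          unfold fourierE
          rw [← starRingEnd_apply, ← integral_conj]
          congr 1
          ext s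
          simp [hf]
      _ = P r := by
          rw [hP, mul_comm]
          simp only
          rw [← starRingEnd_apply, Complex.mul_conj, Complex.normSq_eq_norm_sq]
  have hψP : ψ = fun v => fourierE e μ P (-v) := by
    ext v
    rw [h1, neg_neg]
  have hK : IsCompact ((fun p : V × V => p.1 - p.2) '' (tsupport f ×ˢ tsupport f)) :=
    (hfs.isCompact.prod hfs.isCompact).image (by fun_prop)
  have hsupp : Function.support ψ ⊆
      ((fun p : V × V => p.1 - p.2) '' (tsupport f ×ˢ tsupport f)) ∩ N := by
    intro v hv
    obtain ⟨s, hs⟩ : ∃ s, f s * f (s + v) ≠ 0 := by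
      by_contra! h
      apply hv
      simp [hψ, h]
    have hs1 : f s ≠ 0 := left_ne_zero_of_mul hs
    have hs2 : f (s + v) ≠ 0 := right_ne_zero_of_mul hs
    have hv' : v = (s + v) - s := by abel
    refine ⟨?_, ?_⟩
    · exact ⟨(s + v, s), ⟨subset_tsupport f hs2, subset_tsupport f hs1⟩, hv'.symm⟩
    · rw [hv']
      refine hWN _ (hgW ?_) _ (hgW ?_)
      · simpa [hf] using hs2
      · simpa [hf] using hs1
  refine ⟨ψ, ⟨?_, ?_, ?_, ?_, ?_, ?_⟩, ?_⟩
  · rw [hψP]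
    exact (continuous_fourierE e hPi).comp continuous_neg
  · exact HasCompactSupport.of_support_subset_isCompact hK (fun v hv => (hsupp hv).1)
  · exact fun v hv => (hsupp hv).2
  · intro v
    refine ⟨∫ s, g s * g (s + v) ∂μ, integral_nonneg fun s => mul_nonneg (hg0 _) (hg0 _), ?_⟩
    rw [← integral_complex_ofReal]
    simp [hψ, hf]
  · have h3 := h2 0
    have h4 : F 0 = 1 := by
      rw [hF]
      unfold fourierE
      simp only [pair_zero_right, one_mul]
      rw [hf, integral_complex_ofReal, hg1]
      simp
    unfold fourierE at h3
    simp only [pair_zero_right, one_mul] at h3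
    rw [h3, hP]
    simp [h4]
  · rw [show fourierE e μ ψ = P from funext h2]
    exact hPi
  · intro v
    rw [show fourierE e μ ψ = P from funext h2, h1]

namespace IsSummationKernel

variable {N : Set V} {ψ : V → ℂ}

theorem integrable [IsFiniteMeasureOnCompacts μ] (h : IsSummationKernel e μ N ψ) :
    Integrable ψ μ :=
  h.continuous.integrable_of_hasCompactSupport h.hasCompactSupport

theorem mono {N' : Set V} (h : IsSummationKernel e μ N ψ) (hN : N ⊆ N') :
    IsSummationKernel e μ N' ψ :=
  ⟨h.1, h.2, h.3.trans hN, h.4, h.5, h.6⟩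

theorem norm_eq (h : IsSummationKernel e μ N ψ) (v : V) : ((‖ψ v‖ : ℝ) : ℂ) = ψ v := by
  obtain ⟨r, hr, h⟩ := h.nonneg v
  rw [h, Complex.norm_real, Real.norm_of_nonneg hr]

theorem integral_norm (h : IsSummationKernel e μ N ψ) : ∫ v, ‖ψ v‖ ∂μ = 1 := by
  have h1 := h.integral_eq_one
  rw [show (∫ v, ψ v ∂μ) = ∫ v, ((‖ψ v‖ : ℝ) : ℂ) ∂μ by
    congr 1; ext v; exact (h.norm_eq v).symm, integral_complex_ofReal] at h1
  exact_mod_cast h1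

theorem norm_fourierE_le_one (h : IsSummationKernel e μ N ψ) (v : V) :
    ‖fourierE e μ ψ v‖ ≤ 1 :=
  (norm_fourierE_le e ψ v).trans_eq h.integral_norm

/-- ψ is a probability density vanishing off N, so its average of Z stays as close to z as Z does on
N. -/
theorem norm_integral_smul_sub_le [IsFiniteMeasureOnCompacts μ] {E : Type*}
    [NormedAddCommGroup E] [NormedSpace ℂ E] [CompleteSpace E]
    (h : IsSummationKernel e μ N ψ) {Z : V → E} {z : E} {ε : ℝ}
    (hi : Integrable (fun p => ψ p • Z p) μ) (hZ : ∀ p ∈ N, ‖Z p - z‖ ≤ ε) :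
    ‖(∫ p, ψ p • Z p ∂μ) - z‖ ≤ ε := by
  · have h1 : (∫ p, ψ p • Z p ∂μ) - z = ∫ p, ψ p • (Z p - z) ∂μ := by
      simp only [smul_sub]
      rw [integral_sub hi (h.integrable.smul_const z), integral_smul_const, h.integral_eq_one,
        one_smul]
    rw [h1]
    calc ‖∫ p, ψ p • (Z p - z) ∂μ‖ ≤ ∫ p, ‖ψ p‖ * ε ∂μ := by
          refine norm_integral_le_of_norm_le (h.integrable.norm.mul_const ε)
            (Eventually.of_forall fun p => ?_)
          rw [norm_smul]
          by_cases hp : ψ p = 0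
          · simp [hp]
          · exact mul_le_mul_of_nonneg_left (hZ p (h.support_subset hp)) (norm_nonneg _)
      _ = ε := by rw [integral_mul_const, h.integral_norm, one_mul]

end IsSummationKernel

/-- A sequence of summation kernels concentrating at `0`. -/
def IsKernelSeq (e : V ≃ₜ+ DualGroup V) (μ : Measure V) (ψ : ℕ → V → ℂ) : Prop :=
  ∀ N ∈ 𝓝 (0 : V), ∀ᶠ n in atTop, IsSummationKernel e μ N (ψ n)

theorem exists_kernelSeq (he : ∀ u v, e u v = e v u) [μ.IsAddHaarMeasure]
    (hμ : UnitaryNormalised e μ) : ∃ ψ : ℕ → V → ℂ, IsKernelSeq e μ ψ ∧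
      (∀ n, IsSummationKernel e μ Set.univ (ψ n)) ∧
      ∀ n v, fourierE e μ (fourierE e μ (ψ n)) v = ψ n (-v) := by
  obtain ⟨N, hN⟩ := (𝓝 (0 : V)).exists_antitone_basis
  choose ψ hψ hψ2 using fun n => exists_summationKernel he hμ (hN.1.mem_of_mem (i := n) trivial)
  refine ⟨ψ, ?_, fun n => (hψ n).mono (Set.subset_univ _), hψ2⟩
  intro U hU
  obtain ⟨n, hn⟩ := hN.mem_iff.1 hU
  filter_upwards [eventually_ge_atTop n] with m hm
  exact (hψ m).mono ((hN.2 hm).trans hn)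

end Kernels

/-! ### Fourier transforms of functions on a cube -/

section Cube

variable {V : Type*} [AddCommGroup V] [TopologicalSpace V] [IsTopologicalAddGroup V]
  [T2Space V] [LocallyCompactSpace V] [SecondCountableTopology V] [MeasurableSpace V] [BorelSpace V]
  {e : V ≃ₜ+ DualGroup V} {μ : Measure V} {ι : Type*} [Fintype ι]

/-- The unit cube. -/
def cube (ι : Type*) : Set (ι → ℝ) := Set.Icc 0 1

theorem isCompact_cube : IsCompact (cube ι) := isCompact_Icc

theorem measurableSet_cube : MeasurableSet (cube ι) := measurableSet_Icc

instance : IsFiniteMeasure ((volume : Measure (ι → ℝ)).restrict (cube ι)) :=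
  ⟨by
    rw [Measure.restrict_apply_univ]
    exact isCompact_cube.measure_lt_top⟩

/-- E need not be injective (V may contain a torus), so instead of a Jacobian Fubini is used. For v
= E(y) with y in the cube, the set of x in [-1, 1]^ι with E(x) + v ∈ S contains the translate by -y
of E⁻¹(S) ∩ cube. Integrating over v in E(cube) and using invariance of μ bounds the push-forward of
S by a fixed multiple of μ(S). -/
theorem exists_map_cube_le [μ.IsAddHaarMeasure] {E : (ι → ℝ) →+ V} (hE : Continuous E)
    (hEo : IsOpenMap E) :
    ∃ C : ℝ≥0∞, C ≠ (⊤ : ℝ≥0∞) ∧ ((volume : Measure (ι → ℝ)).restrict (cube ι)).map E ≤ C • μ := by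
  have hc : IsCompact (E '' cube ι) := isCompact_cube.image hE
  have hpos : 0 < μ (E '' cube ι) := by
    have hU : IsOpen (Set.univ.pi fun _ : ι => Set.Ioo (0 : ℝ) 1) :=
      isOpen_set_pi Set.finite_univ fun _ _ => isOpen_Ioo
    refine (hEo _ hU).measure_pos μ ?_ |>.trans_le (measure_mono ?_)
    · exact ⟨_, (fun _ => 1 / 2), fun i _ => by norm_num, rfl⟩
    · refine Set.image_mono fun x hx => ?_
      exact ⟨fun i => (hx i trivial).1.le, fun i => (hx i trivial).2.le⟩
  have hfin : μ (E '' cube ι) ≠ (⊤ : ℝ≥0∞) := hc.measure_lt_top.ne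
  set Q' : Set (ι → ℝ) := Set.Icc (-1) 1 with hQ'
  have hQ'fin : volume Q' ≠ (⊤ : ℝ≥0∞) := isCompact_Icc.measure_lt_top.ne
  refine ⟨volume Q' / μ (E '' cube ι), (ENNReal.div_lt_top hQ'fin hpos.ne').ne, ?_⟩
  refine Measure.le_iff.2 fun S hS => ?_
  rw [Measure.map_apply hE.measurable hS, Measure.restrict_apply (hE.measurable hS),
    Measure.smul_apply, smul_eq_mul, mul_comm, ← mul_div_assoc,
    ENNReal.le_div_iff_mul_le (Or.inl hpos.ne') (Or.inl hfin), mul_comm]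
  set f : V → (ι → ℝ) → ℝ≥0∞ := fun v x => S.indicator 1 (E x + v) with hf
  have hfm : Measurable (Function.uncurry f) := by
    have h1 : Measurable (fun p : V × (ι → ℝ) => E p.2 + p.1) :=
      ((hE.comp continuous_snd).add continuous_fst).measurable
    exact (measurable_one.indicator hS).comp h1
  calc μ (E '' cube ι) * volume (E ⁻¹' S ∩ cube ι)
      ≤ ∫⁻ v in (E '' cube ι), ∫⁻ x in Q', f v x ∂volume ∂μ := by
        rw [mul_comm, ← setLIntegral_const]
        refine setLIntegral_mono' hc.measurableSet ?_
        rintro _ ⟨y, hy, rfl⟩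
        have hm : MeasurableSet {x | E x + E y ∈ S} :=
          (hE.add continuous_const).measurable hS
        have h1 : ∀ x, f (E y) x = {x | E x + E y ∈ S}.indicator 1 x := fun x => rfl
        simp only [h1]
        rw [lintegral_indicator_one hm, Measure.restrict_apply hm,
          ← measure_preimage_add_right volume y]
        refine measure_mono fun x hx => ⟨?_, ?_⟩
        · change E x + E y ∈ S
          rw [← map_add]
          exact hx.1
        · have h2 : x + y ∈ cube ι := hx.2
          constructor
          · intro i
            have h3 := h2.1 i
            have h4 := hy.2 i
            simp only [Pi.add_apply, Pi.zero_apply, Pi.one_apply, Pi.neg_apply] at *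
            linarith
          · intro i
            have h3 := h2.2 i
            have h4 := hy.1 i
            simp only [Pi.add_apply, Pi.zero_apply, Pi.one_apply] at *
            linarith
    _ = ∫⁻ x in Q', ∫⁻ v in (E '' cube ι), f v x ∂μ ∂volume :=
        lintegral_lintegral_swap hfm.aemeasurable
    _ ≤ ∫⁻ x in Q', μ S ∂volume := by
        refine lintegral_mono fun x => ?_
        calc ∫⁻ v in (E '' cube ι), f v x ∂μ ≤ ∫⁻ v, f v x ∂μ := setLIntegral_le_lintegral _ _
          _ = ∫⁻ v, S.indicator 1 v ∂μ :=
            lintegral_add_left_eq_self (μ := μ) (S.indicator (1 : V → ℝ≥0∞)) (E x)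
          _ = μ S := lintegral_indicator_one hS
    _ = μ S * volume Q' := setLIntegral_const _ _

/-- The Fourier transform `w ↦ ∫ φ(x) e(E x, w) dx` over the unit cube. -/
def cubeFT (e : V ≃ₜ+ DualGroup V) (E : (ι → ℝ) →+ V) (φ : (ι → ℝ) → ℂ) (w : V) : ℂ :=
  ∫ x in cube ι, φ x * pair e (E x) w

/-- Measurable functions that are bounded on the unit cube. -/
def IsCubeBounded (φ : (ι → ℝ) → ℂ) : Prop :=
  Measurable φ ∧ ∃ C, ∀ x ∈ cube ι, ‖φ x‖ ≤ C

theorem IsCubeBounded.integrableOn {φ : (ι → ℝ) → ℂ} (h : IsCubeBounded φ) :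
    IntegrableOn φ (cube ι) := by
  obtain ⟨hm, C, hC⟩ := h
  refine Integrable.of_bound hm.aestronglyMeasurable C ?_
  exact (ae_restrict_iff' measurableSet_cube).2 (Eventually.of_forall hC)

theorem IsCubeBounded.integrableOn_mul_pair {φ : (ι → ℝ) → ℂ} (h : IsCubeBounded φ)
    {E : (ι → ℝ) →+ V} (hE : Continuous E) (w : V) :
    IntegrableOn (fun x => φ x * pair e (E x) w) (cube ι) := by
  refine Integrable.mul_bdd (c := 1) h.integrableOn ?_
    (Eventually.of_forall fun x => (norm_pair _ _ _).le)
  exact (by fun_prop : Continuous fun x => pair e (E x) w).aestronglyMeasurable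

theorem continuous_cubeFT {φ : (ι → ℝ) → ℂ} (h : IsCubeBounded φ)
    {E : (ι → ℝ) →+ V} (hE : Continuous E) : Continuous (cubeFT e E φ) := by
  refine continuous_of_dominated (bound := fun x => ‖φ x‖)
    (fun w => (h.integrableOn_mul_pair hE w).aestronglyMeasurable) ?_ h.integrableOn.norm ?_
  · exact fun w => Eventually.of_forall fun x => by simp [norm_pair]
  · exact Eventually.of_forall fun x => by fun_prop

/-- The image under E of φ dx is a finite measure bounded by a multiple of μ, hence has a bounded
integrable density. That density is in L², and Plancherel applies to its transform, which is
`cubeFT`. -/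
theorem memLp_cubeFT_real [μ.IsAddHaarMeasure] (hμ : UnitaryNormalised e μ)
    {E : (ι → ℝ) →+ V} (hE : Continuous E) (hEo : IsOpenMap E) {φ : (ι → ℝ) → ℝ}
    (hφ : Measurable φ) {M : ℝ} (h0 : ∀ x, 0 ≤ φ x) (hM : ∀ x ∈ cube ι, φ x ≤ M) :
    MemLp (cubeFT e E fun x => (φ x : ℂ)) 2 μ := by
  obtain ⟨C, hC, hle⟩ := exists_map_cube_le (μ := μ) hE hEo
  set ν := (volume : Measure (ι → ℝ)).restrict (cube ι)
  set m := (ν.withDensity fun x => ENNReal.ofReal (φ x)).map E with hm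
  have hmle : m ≤ (ENNReal.ofReal M * C) • μ := by
    have h1 : ν.withDensity (fun x => ENNReal.ofReal (φ x)) ≤ ENNReal.ofReal M • ν := by
      rw [← withDensity_const]
      refine withDensity_mono ?_
      exact (ae_restrict_iff' measurableSet_cube).2
        (Eventually.of_forall fun x hx => ENNReal.ofReal_le_ofReal (hM x hx))
    calc m ≤ (ENNReal.ofReal M • ν).map E := Measure.map_mono h1 hE.measurable
      _ = ENNReal.ofReal M • ν.map E := Measure.map_smul _ _ _
      _ ≤ ENNReal.ofReal M • (C • μ) := by gcongr
      _ = _ := by rw [smul_smul]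
  set D := ENNReal.ofReal M * C with hD
  have hDtop : D ≠ (⊤ : ℝ≥0∞) := ENNReal.mul_ne_top ENNReal.ofReal_ne_top hC
  have hmac : m ≪ μ := Measure.absolutelyContinuous_of_le_smul hmle
  have hφi : Integrable φ ν := by
    refine Integrable.of_bound hφ.aestronglyMeasurable M ?_
    refine (ae_restrict_iff' measurableSet_cube).2 (Eventually.of_forall fun x hx => ?_)
    rw [Real.norm_of_nonneg (h0 x)]
    exact hM x hx
  have hfin : IsFiniteMeasure (ν.withDensity fun x => ENNReal.ofReal (φ x)) :=
    isFiniteMeasure_withDensity_ofReal hφi.2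
  have hmfin : IsFiniteMeasure m := by
    rw [hm]
    infer_instance
  have hbd : m.rnDeriv μ ≤ᵐ[μ] fun _ => D := by
    refine ae_le_of_forall_setLIntegral_le_of_sigmaFinite (Measure.measurable_rnDeriv _ _)
      fun S hS _ => ?_
    calc ∫⁻ x in S, m.rnDeriv μ x ∂μ ≤ m S := Measure.setLIntegral_rnDeriv_le _
      _ ≤ (D • μ) S := hmle S
      _ = _ := by rw [setLIntegral_const]; rfl
  set f : V → ℂ := fun v => ((m.rnDeriv μ v).toReal : ℂ) with hf
  have hf1 : Integrable f μ := Measure.integrable_toReal_rnDeriv.ofReal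
  have hfb : ∀ᵐ v ∂μ, ‖f v‖ ≤ D.toReal := by
    filter_upwards [hbd] with v hv
    simp only [hf, Complex.norm_real, Real.norm_of_nonneg ENNReal.toReal_nonneg]
    exact ENNReal.toReal_mono hDtop hv
  have hf2 : MemLp f 2 μ := by
    rw [memLp_two_iff_integrable_sq_norm hf1.1]
    refine (hf1.norm.const_mul D.toReal).mono (hf1.1.norm.pow 2) ?_
    filter_upwards [hfb] with v hv
    rw [norm_pow, norm_mul, norm_norm, sq, Real.norm_of_nonneg ENNReal.toReal_nonneg]
    gcongr
  have hFT : fourierE e μ f = cubeFT e E fun x => (φ x : ℂ) := by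
    ext w
    calc fourierE e μ f w = ∫ s, (m.rnDeriv μ s).toReal • pair e s w ∂μ := by
          unfold fourierE
          congr 1
          ext s
          rw [mul_comm, hf, Complex.real_smul]
      _ = ∫ s, pair e s w ∂m := integral_rnDeriv_smul hmac
      _ = ∫ x, pair e (E x) w ∂(ν.withDensity fun x => ENNReal.ofReal (φ x)) := by
          refine integral_map hE.aemeasurable ?_
          exact (by fun_prop : Continuous fun s => pair e s w).aestronglyMeasurable
      _ = ∫ x, (ENNReal.ofReal (φ x)).toReal • pair e (E x) w ∂ν :=
          integral_withDensity_eq_integral_toReal_smul hφ.ennreal_ofReal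
            (Eventually.of_forall fun _ => ENNReal.ofReal_lt_top) _
      _ = _ := by
          unfold cubeFT
          congr 1
          ext x
          rw [ENNReal.toReal_ofReal (h0 x), Complex.real_smul]
  rw [← hFT]
  exact hμ.memLp_fourierE hf1 hf2

theorem memLp_cubeFT [μ.IsAddHaarMeasure] (hμ : UnitaryNormalised e μ)
    {E : (ι → ℝ) →+ V} (hE : Continuous E) (hEo : IsOpenMap E) {φ : (ι → ℝ) → ℂ}
    (hφ : IsCubeBounded φ) : MemLp (cubeFT e E φ) 2 μ := by
  obtain ⟨hm, C, hC⟩ := hφ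
  -- The nonnegative case is applied to the positive and negative parts of the real and imaginary
  -- parts of φ.
  have key : ∀ g : ℂ → ℝ, Measurable g → (∀ z, |g z| ≤ ‖z‖) →
      MemLp (cubeFT e E fun x => ((max (g (φ x)) 0 : ℝ) : ℂ)) 2 μ ∧
        IsCubeBounded (fun x => ((max (g (φ x)) 0 : ℝ) : ℂ)) := by
    intro g hg hgb
    have h1 : Measurable fun x => max (g (φ x)) 0 := (hg.comp hm).max measurable_const
    have h2 : ∀ x ∈ cube ι, max (g (φ x)) 0 ≤ C := fun x hx =>
      max_le ((le_abs_self _).trans ((hgb _).trans (hC x hx))) ((norm_nonneg _).trans (hC x hx))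
    refine ⟨memLp_cubeFT_real hμ hE hEo h1 (fun x => le_max_right _ _) h2, ?_, C, ?_⟩
    · exact Complex.measurable_ofReal.comp h1
    · intro x hx
      rw [Complex.norm_real, Real.norm_of_nonneg (le_max_right _ _)]
      exact h2 x hx
  obtain ⟨k1, b1⟩ := key Complex.re Complex.measurable_re Complex.abs_re_le_norm
  obtain ⟨k2, b2⟩ := key (fun z => -z.re) Complex.measurable_re.neg
    (fun z => by rw [abs_neg]; exact Complex.abs_re_le_norm z)
  obtain ⟨k3, b3⟩ := key Complex.im Complex.measurable_im Complex.abs_im_le_norm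
  obtain ⟨k4, b4⟩ := key (fun z => -z.im) Complex.measurable_im.neg
    (fun z => by rw [abs_neg]; exact Complex.abs_im_le_norm z)
  convert (k1.sub k2).add ((k3.sub k4).const_mul Complex.I) using 1
  ext w
  have i1 := b1.integrableOn_mul_pair (e := e) hE w
  have i2 := b2.integrableOn_mul_pair (e := e) hE w
  have i3 := b3.integrableOn_mul_pair (e := e) hE w
  have i4 := b4.integrableOn_mul_pair (e := e) hE w
  simp only [Pi.add_apply, Pi.sub_apply]
  unfold cubeFT
  rw [← integral_sub i1 i2, ← integral_sub i3 i4, ← integral_const_mul, ← integral_add]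
  · congr 1
    ext x
    have hr : ∀ r : ℝ, r = max r 0 - max (-r) 0 := fun r => by
      rcases le_total 0 r with h | h
      · rw [max_eq_left h, max_eq_right (by linarith)]; ring
      · rw [max_eq_right h, max_eq_left (by linarith)]; ring
    have hz : φ x = ((max (φ x).re 0 : ℝ) - (max (-(φ x).re) 0 : ℝ) : ℂ) +
        Complex.I * ((max (φ x).im 0 : ℝ) - (max (-(φ x).im) 0 : ℝ) : ℂ) := by
      rw [← Complex.ofReal_sub, ← Complex.ofReal_sub, ← hr, ← hr, mul_comm, Complex.re_add_im]
    conv_lhs => rw [hz]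
    ring
  · exact i1.sub i2
  · exact (i3.sub i4).const_mul _

end Cube

/-! ### Amplitudes: products of two Fourier transforms over the cube -/

section Amplitudes

variable {V : Type*} [AddCommGroup V] [TopologicalSpace V] [IsTopologicalAddGroup V]
  [T2Space V] [LocallyCompactSpace V] [SecondCountableTopology V] [MeasurableSpace V]
  [BorelSpace V] {e : V ≃ₜ+ DualGroup V} {μ : Measure V} {ι : Type*} [Fintype ι]

/-- Characters are differentiable along one-parameter subgroups. -/
theorem exists_hasDerivAt_pair {E : (ι → ℝ) →+ V} (hE : Continuous E) {γ : ℝ →+ V}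
    (hγ : Continuous γ) : ∃ θ : (ι → ℝ) → ℂ, IsCubeBounded θ ∧ ∀ x ∈ cube ι, ∀ t,
      HasDerivAt (fun t => pair e (E x) (γ t)) (θ x * pair e (E x) (γ t)) t := by
  set χ : (ι → ℝ) → ℝ → ℂ := fun x t => pair e (E x) (γ t) with hχ
  have hχc : Continuous (Function.uncurry χ) :=
    (continuous_pair e).comp ((hE.comp continuous_fst).prodMk (hγ.comp continuous_snd))
  have hχx : ∀ x, Continuous (χ x) := fun x => hχc.comp (Continuous.prodMk_right x)
  have hadd : ∀ x s t, χ x (s + t) = χ x s * χ x t := fun x s t => by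
    simp only [hχ, map_add, pair_add_right]
  -- Compactness of the cube makes the smallness of t uniform in x.
  have h1 : ∀ᶠ t in 𝓝 (0 : ℝ), ∀ x ∈ cube ι, ‖χ x t - 1‖ < 1 / 2 := by
    refine isCompact_cube.eventually_forall_of_forall_eventually fun x _ => ?_
    have hc : Continuous fun z : ℝ × (ι → ℝ) => ‖χ z.2 z.1 - 1‖ :=
      ((hχc.comp continuous_swap).sub continuous_const).norm
    refine hc.continuousAt.eventually_lt continuousAt_const ?_
    simp [hχ, pair_zero_right]
  obtain ⟨δ, hδ, hδ2⟩ := Metric.eventually_nhds_iff.1 h1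
  set d := δ / 2 with hd
  have hdpos : 0 < d := by positivity
  have h2 : ∀ x ∈ cube ι, ∀ t ∈ Set.uIoc 0 d, ‖χ x t - 1‖ ≤ 1 / 2 := by
    intro x hx t ht
    rw [Set.uIoc_of_le hdpos.le] at ht
    refine (hδ2 ?_ x hx).le
    rw [Real.dist_eq, sub_zero, abs_of_pos ht.1]
    have := ht.2
    linarith
  set J : (ι → ℝ) → ℂ := fun x => ∫ s in (0 : ℝ)..d, χ x s with hJ
  have hJc : Continuous J :=
    intervalIntegral.continuous_parametric_intervalIntegral_of_continuous' hχc 0 d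
  have hJb : ∀ x ∈ cube ι, d / 2 ≤ ‖J x‖ := by
    intro x hx
    have h3 : ‖J x - d‖ ≤ 1 / 2 * |d - 0| := by
      have : J x - d = ∫ s in (0 : ℝ)..d, (χ x s - 1) := by
        rw [intervalIntegral.integral_sub ((hχx x).intervalIntegrable _ _)
          (by simp)]
        simp [hJ]
      rw [this]
      exact intervalIntegral.norm_integral_le_of_norm_le_const (h2 x hx)
    rw [sub_zero, abs_of_pos hdpos] at h3
    have h4 : ‖(d : ℂ)‖ ≤ ‖J x - d‖ + ‖J x‖ := by
      rw [norm_sub_rev]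
      simpa using norm_add_le ((d : ℂ) - J x) (J x)
    rw [Complex.norm_real, Real.norm_of_nonneg hdpos.le] at h4
    linarith
  -- Multiplicativity gives χ(t) J = ∫ χ over [t, t + d], so χ is differentiable with χ'(t) = χ(t)
  -- (χ(d) - 1)/J. The bound combines |χ(d) - 1| ≤ 2 with |J| ≥ d/2, which holds because χ is within
  -- 1/2 of 1 on (0, d].
  refine ⟨fun x => (χ x d - 1) / J x, ⟨?_, 2 / (d / 2), fun x hx => ?_⟩, fun x hx t => ?_⟩
  · refine Measurable.div ?_ hJc.measurable
    exact ((hχc.comp (Continuous.prodMk_left d)).sub continuous_const).measurable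
  · rw [norm_div]
    have h5 : ‖χ x d - 1‖ ≤ 2 := by
      refine (norm_sub_le _ _).trans ?_
      rw [hχ]
      simp only [norm_pair, norm_one]
      norm_num
    have := hJb x hx
    gcongr
  · have hJ0 : J x ≠ 0 := by
      intro h0
      have := hJb x hx
      rw [h0, norm_zero] at this
      linarith
    have h6 : ∀ t, χ x t = ((∫ s in (0 : ℝ)..(t + d), χ x s) - ∫ s in (0 : ℝ)..t, χ x s) / J x := by
      intro t
      rw [eq_div_iff hJ0, intervalIntegral.integral_interval_sub_left
        ((hχx x).intervalIntegrable _ _) ((hχx x).intervalIntegrable _ _), hJ]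
      simp only
      rw [← intervalIntegral.integral_const_mul]
      simp only [← hadd]
      rw [intervalIntegral.integral_comp_add_left (χ x), add_zero]
    have h7 : HasDerivAt (fun t => ((∫ s in (0 : ℝ)..(t + d), χ x s) -
        ∫ s in (0 : ℝ)..t, χ x s) / J x) ((χ x (t + d) - χ x t) / J x) t := by
      refine HasDerivAt.div_const (HasDerivAt.sub ?_ ?_) _
      · exact HasDerivAt.comp_add_const t d
          (intervalIntegral.integral_hasDerivAt_right ((hχx x).intervalIntegrable _ _)
            ((hχx x).stronglyMeasurableAtFilter _ _) (hχx x).continuousAt)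
      · exact intervalIntegral.integral_hasDerivAt_right ((hχx x).intervalIntegrable _ _)
            ((hχx x).stronglyMeasurableAtFilter _ _) (hχx x).continuousAt
    have h8 : (fun t => pair e (E x) (γ t)) = fun t =>
        ((∫ s in (0 : ℝ)..(t + d), χ x s) - ∫ s in (0 : ℝ)..t, χ x s) / J x := funext h6
    rw [h8]
    convert h7 using 1
    rw [hadd]
    simp only [hχ]
    ring

theorem IsCubeBounded.mul {φ θ : (ι → ℝ) → ℂ} (hφ : IsCubeBounded φ) (hθ : IsCubeBounded θ) :
    IsCubeBounded fun x => φ x * θ x := by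
  obtain ⟨h1, C, hC⟩ := hφ
  obtain ⟨h2, D, hD⟩ := hθ
  refine ⟨h1.mul h2, C * D, fun x hx => ?_⟩
  rw [norm_mul]
  exact mul_le_mul (hC x hx) (hD x hx) (norm_nonneg _) ((norm_nonneg _).trans (hC x hx))

theorem hasDerivAt_cubeFT {E : (ι → ℝ) →+ V} (hE : Continuous E) {γ : ℝ →+ V}
    {φ θ : (ι → ℝ) → ℂ} (hφ : IsCubeBounded φ) (hθ : IsCubeBounded θ)
    (h : ∀ x ∈ cube ι, ∀ t,
      HasDerivAt (fun t => pair e (E x) (γ t)) (θ x * pair e (E x) (γ t)) t) (w : V) (t : ℝ) :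
    HasDerivAt (fun t => cubeFT e E φ (w + γ t))
      (cubeFT e E (fun x => φ x * θ x) (w + γ t)) t := by
  have hm := hφ.mul hθ
  refine (hasDerivAt_integral_of_dominated_loc_of_deriv_le (bound := fun x => ‖φ x * θ x‖)
    (F' := fun t x => (φ x * θ x) * pair e (E x) (w + γ t)) univ_mem
    (Eventually.of_forall fun s => (hφ.integrableOn_mul_pair hE _).aestronglyMeasurable)
    (hφ.integrableOn_mul_pair hE _) (hm.integrableOn_mul_pair hE _).aestronglyMeasurable
    (Eventually.of_forall fun x s _ => by simp [norm_pair]) hm.integrableOn.norm ?_).2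
  refine (ae_restrict_iff' measurableSet_cube).2 (Eventually.of_forall fun x hx s _ => ?_)
  have h1 := ((h x hx s).const_mul (pair e (E x) w)).const_mul (φ x)
  simp only [pair_add_right]
  exact h1.congr_deriv (by ring)

/-- The space of amplitudes: sums of products of two Fourier transforms over the cube. -/
def amplitudes (e : V ≃ₜ+ DualGroup V) (E : (ι → ℝ) →+ V) : Submodule ℂ (V → ℂ) :=
  Submodule.span ℂ {F | ∃ φ φ', IsCubeBounded φ ∧ IsCubeBounded φ' ∧
    F = fun w => cubeFT e E φ w * cubeFT e E φ' w}

theorem continuous_of_mem_amplitudes {E : (ι → ℝ) →+ V} (hE : Continuous E) {F : V → ℂ}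
    (hF : F ∈ amplitudes e E) : Continuous F := by
  induction hF using Submodule.span_induction with
  | mem F h =>
    obtain ⟨φ, φ', h1, h2, rfl⟩ := h
    exact (continuous_cubeFT h1 hE).mul (continuous_cubeFT h2 hE)
  | zero => exact continuous_const
  | add F G _ _ h1 h2 => exact h1.add h2
  | smul c F _ h => exact h.const_smul c

/-- This is why amplitudes have two factors: each lies only in L², their product in L¹. -/
theorem integrable_of_mem_amplitudes [μ.IsAddHaarMeasure] (hμ : UnitaryNormalised e μ)
    {E : (ι → ℝ) →+ V} (hE : Continuous E) (hEo : IsOpenMap E) {F : V → ℂ}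
    (hF : F ∈ amplitudes e E) : Integrable F μ := by
  induction hF using Submodule.span_induction with
  | mem F h =>
    obtain ⟨φ, φ', h1, h2, rfl⟩ := h
    exact (memLp_cubeFT hμ hE hEo h1).integrable_mul (memLp_cubeFT hμ hE hEo h2)
  | zero => exact integrable_zero _ _ _
  | add F G _ _ h1 h2 => exact h1.add h2
  | smul c F _ h => exact h.smul c

/-- Differentiating a cube transform along γ multiplies its density by the bounded function θ, so
the Leibniz rule stays inside the space. The second smoothing needs this stability because it
differentiates the amplitude produced by the first. -/
theorem exists_deriv_mem_amplitudes {E : (ι → ℝ) →+ V} (hE : Continuous E) {γ : ℝ →+ V}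
    (hγ : Continuous γ) {F : V → ℂ} (hF : F ∈ amplitudes e E) :
    ∃ F' ∈ amplitudes e E, ∀ w t, HasDerivAt (fun t => F (w + γ t)) (F' (w + γ t)) t := by
  obtain ⟨θ, hθ, hd⟩ := exists_hasDerivAt_pair (e := e) hE hγ
  induction hF using Submodule.span_induction with
  | mem F h =>
    obtain ⟨φ, φ', h1, h2, rfl⟩ := h
    refine ⟨_, add_mem (Submodule.subset_span ⟨_, φ', h1.mul hθ, h2, rfl⟩)
      (Submodule.subset_span ⟨φ, _, h1, h2.mul hθ, rfl⟩), fun w t => ?_⟩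
    exact (hasDerivAt_cubeFT hE h1 hθ hd w t).mul (hasDerivAt_cubeFT hE h2 hθ hd w t)
  | zero => exact ⟨0, zero_mem _, fun w t => hasDerivAt_const t 0⟩
  | add F G _ _ h1 h2 =>
    obtain ⟨F', hF', h1⟩ := h1
    obtain ⟨G', hG', h2⟩ := h2
    exact ⟨F' + G', add_mem hF' hG', fun w t => (h1 w t).add (h2 w t)⟩
  | smul c F _ h =>
    obtain ⟨F', hF', h⟩ := h
    exact ⟨c • F', Submodule.smul_mem _ c hF', fun w t => (h w t).const_smul c⟩

end Amplitudes

/-! ### Differentiation of smooth vectors along one-parameter subgroups -/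

section Smooth

variable {V : Type*} [AddCommGroup V] [TopologicalSpace V]
  {A : Type*} [NonUnitalCStarAlgebra A] {α : CStarAction V A}
  {𝔤 : Type*} [NormedAddCommGroup 𝔤] [NormedSpace ℝ 𝔤]

/-- The vector c' is the derivative at 0 of the orbit of c in the direction X. The group law carries
this derivative to every point, and the orbit map of c' on 𝔤 is a directional derivative of that of
c, hence again smooth. -/
theorem IsSmoothVector.exists_deriv {exp : 𝔤 →+ V} {c : A} (hc : IsSmoothVector exp α c)
    (X : 𝔤) : ∃ c' : A, IsSmoothVector exp α c' ∧ ∀ v t,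
      HasDerivAt (fun t : ℝ => α.aut (v + exp (t • X)) c) (α.aut (v + exp (t • X)) c') t := by
  set f : 𝔤 → A := fun x => α.aut (exp x) c with hf
  have hfd : Differentiable ℝ f := ContDiff.differentiable hc (by simp)
  have h0 : HasDerivAt (fun h : ℝ => f (h • X)) (fderiv ℝ f 0 X) 0 := by
    have h1 : HasFDerivAt f (fderiv ℝ f 0) ((0 : ℝ) • X) := by
      rw [zero_smul]
      exact (hfd 0).hasFDerivAt
    have h2 : HasDerivAt (fun h : ℝ => h • X) X 0 := by
      simpa using (hasDerivAt_id (0 : ℝ)).smul_const X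
    exact h1.comp_hasDerivAt (0 : ℝ) h2
  have h3 : ∀ v t, HasDerivAt (fun t : ℝ => α.aut (v + exp (t • X)) c)
      (α.aut (v + exp (t • X)) (fderiv ℝ f 0 X)) t := by
    intro v t
    have h4 : HasDerivAt (fun h : ℝ => f (h • X)) (fderiv ℝ f 0 X) (t + -t) := by
      rwa [add_neg_cancel]
    have h5 := (((α.autL (v + exp (t • X))).restrictScalars ℝ).hasFDerivAt.comp_hasDerivAt (t + -t)
      h4).comp_add_const t (-t)
    refine h5.congr_of_eventuallyEq (Eventually.of_forall fun s => ?_)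
    simp only [Function.comp, hf]
    change _ = α.aut _ (α.aut _ c)
    rw [← α.aut_add, add_assoc, ← map_add, ← add_smul]
    have : t + (s + -t) = s := by ring
    rw [this]
  refine ⟨fderiv ℝ f 0 X, ?_, h3⟩
  have h6 : (fun x => α.aut (exp x) (fderiv ℝ f 0 X)) = fun x => fderiv ℝ f x X := by
    ext x
    have h7 := h3 (exp x) 0
    have h8 : HasDerivAt (fun h : ℝ => f (x + h • X)) (fderiv ℝ f x X) 0 := by
      have h1 : HasFDerivAt f (fderiv ℝ f x) (x + (0 : ℝ) • X) := by
        rw [zero_smul, add_zero]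
        exact (hfd x).hasFDerivAt
      have h2 : HasDerivAt (fun h : ℝ => x + h • X) X 0 := by
        simpa using ((hasDerivAt_id (0 : ℝ)).smul_const X).const_add x
      exact h1.comp_hasDerivAt (0 : ℝ) h2
    have h9 := h7.unique (by simpa only [hf, map_add] using h8)
    simpa using h9
  unfold IsSmoothVector
  rw [h6]
  exact (hc.fderiv_right (m := ∞) (by simp)).clm_apply contDiff_const

/-- The two weights on `[0, 1]` in the first order Taylor formula. -/
def taylorWeight (b : Bool) (t : ℝ) : ℂ := if b then 1 else (t : ℂ) - 1

theorem continuous_taylorWeight (b : Bool) : Continuous (taylorWeight b) := by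
  unfold taylorWeight
  cases b <;> simp <;> fun_prop

theorem norm_taylorWeight_le (b : Bool) {t : ℝ} (ht : t ∈ Set.Icc (0 : ℝ) 1) :
    ‖taylorWeight b t‖ ≤ 1 := by
  unfold taylorWeight
  cases b
  · simp only [Bool.false_eq_true, if_false]
    rw [← Complex.ofReal_one, ← Complex.ofReal_sub, Complex.norm_real, Real.norm_eq_abs, abs_le]
    constructor <;> linarith [ht.1, ht.2]
  · simp

theorem integrable_taylorWeight (b : Bool) :
    Integrable (taylorWeight b) ((volume : Measure ℝ).restrict (Set.Icc 0 1)) :=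
  (continuous_taylorWeight b).continuousOn.integrableOn_compact isCompact_Icc

/-- The derivative of (t - 1) Y(t) is Y(t) + (t - 1) Y'(t), and its integral over [0, 1] is Y(0).
This expresses a value as an average of translates, with no boundary term. -/
theorem taylor_unit_interval {E : Type*} [NormedAddCommGroup E] [NormedSpace ℂ E]
    [CompleteSpace E] {Y Y' : ℝ → E} (h : ∀ t, HasDerivAt Y (Y' t) t) (hY' : Continuous Y') :
    Y 0 = (∫ t in Set.Icc (0 : ℝ) 1, taylorWeight true t • Y t) +
      ∫ t in Set.Icc (0 : ℝ) 1, taylorWeight false t • Y' t := by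
  have hY : Continuous Y := continuous_iff_continuousAt.2 fun t => (h t).continuousAt
  have hw : ∀ t, HasDerivAt (taylorWeight false) 1 t := by
    intro t
    have : HasDerivAt (fun t : ℝ => (t : ℂ) - 1) 1 t := by
      simpa using (Complex.ofRealCLM.hasDerivAt (x := t)).sub_const 1
    have h2 : taylorWeight false = fun t : ℝ => (t : ℂ) - 1 := by
      ext t
      simp [taylorWeight]
    rwa [h2]
  have h1 : ∀ t, HasDerivAt (fun t => taylorWeight false t • Y t)
      (taylorWeight true t • Y t + taylorWeight false t • Y' t) t := by
    intro t
    refine ((hw t).smul (h t)).congr_deriv ?_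
    rw [add_comm]
    simp [taylorWeight]
  have c1 : Continuous fun t => taylorWeight true t • Y t := (continuous_taylorWeight _).smul hY
  have c2 : Continuous fun t => taylorWeight false t • Y' t := (continuous_taylorWeight _).smul hY'
  have h2 := intervalIntegral.integral_eq_sub_of_hasDerivAt (a := 0) (b := 1)
    (fun t _ => h1 t) ((c1.add c2).intervalIntegrable _ _)
  rw [intervalIntegral.integral_add (c1.intervalIntegrable _ _) (c2.intervalIntegrable _ _),
    intervalIntegral.integral_of_le zero_le_one, intervalIntegral.integral_of_le zero_le_one,
    ← integral_Icc_eq_integral_Ioc, ← integral_Icc_eq_integral_Ioc] at h2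
  rw [h2]
  simp [taylorWeight]

end Smooth

/-! ### Fourier transforms of parametrised measures -/

section ParamFT

variable {V : Type*} [AddCommGroup V] [TopologicalSpace V] [IsTopologicalAddGroup V]
  [T2Space V] [LocallyCompactSpace V] [SecondCountableTopology V] [MeasurableSpace V]
  [BorelSpace V] {e : V ≃ₜ+ DualGroup V} {μ : Measure V}
  {Ω : Type*} [MeasurableSpace Ω] {m : Measure Ω}

/-- The Fourier transform `w ↦ ∫ φ(x) e(g(x), w) dm(x)` of the image of `φ dm` under `g`. -/
def paramFT (e : V ≃ₜ+ DualGroup V) (m : Measure Ω) (φ : Ω → ℂ) (g : Ω → V) (w : V) : ℂ :=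
  ∫ x, φ x * pair e (g x) w ∂m

theorem norm_paramFT_le (φ : Ω → ℂ) (g : Ω → V) (w : V) :
    ‖paramFT e m φ g w‖ ≤ ∫ x, ‖φ x‖ ∂m := by
  refine (norm_integral_le_integral_norm _).trans_eq ?_
  simp [norm_pair]

theorem measurable_pair_comp {X : Type*} [MeasurableSpace X] {f g : X → V} (hf : Measurable f)
    (hg : Measurable g) : Measurable fun x => pair e (f x) (g x) :=
  (continuous_pair e).measurable.comp (hf.prodMk hg)

theorem continuous_paramFT {φ : Ω → ℂ} (hφ : Integrable φ m) {g : Ω → V} (hg : Measurable g) :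
    Continuous (paramFT e m φ g) := by
  refine continuous_of_dominated (bound := fun x => ‖φ x‖) (fun w => ?_) ?_ hφ.norm ?_
  · exact hφ.aestronglyMeasurable.mul
      (measurable_pair_comp hg measurable_const).aestronglyMeasurable
  · exact fun w => Eventually.of_forall fun x => by simp [norm_pair]
  · exact Eventually.of_forall fun x => by fun_prop

/-- Multiplication by the transform of a measure becomes averaging of translates of ψ^ over that
measure; the offset w enters only through unimodular factors. -/
theorem fourierE_mul_paramFT [SFinite m] [SFinite μ] (he : ∀ u v, e u v = e v u) {ψ : V → ℂ}
    (hψ : Integrable ψ μ) {φ : Ω → ℂ}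
    (hφ : Integrable φ m) {g : Ω → V} (hg : Measurable g) (w u : V) :
    fourierE e μ (fun p => ψ p * paramFT e m φ g (w + p)) u =
      ∫ x, (φ x * pair e (g x) w) * fourierE e μ ψ (u + g x) ∂m := by
  have hint : Integrable (fun z : V × Ω => (pair e z.1 u * pair e (g z.2) (w + z.1)) *
      (ψ z.1 * φ z.2)) (μ.prod m) := by
    refine (hψ.mul_prod hφ).bdd_mul (c := 1) ?_ (Eventually.of_forall fun z => by simp [norm_pair])
    refine Measurable.aestronglyMeasurable ?_
    refine (measurable_pair_comp measurable_fst measurable_const).mul ?_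
    exact measurable_pair_comp (hg.comp measurable_snd) (measurable_const.add measurable_fst)
  calc fourierE e μ (fun p => ψ p * paramFT e m φ g (w + p)) u
      = ∫ p, ∫ x, (pair e p u * pair e (g x) (w + p)) * (ψ p * φ x) ∂m ∂μ := by
        unfold fourierE paramFT
        congr 1
        ext p
        simp only []
        rw [← integral_const_mul, ← integral_const_mul]
        congr 1
        ext x
        ring
    _ = ∫ x, ∫ p, (pair e p u * pair e (g x) (w + p)) * (ψ p * φ x) ∂μ ∂m :=
        integral_integral_swap hint
    _ = _ := by
        congr 1
        ext x
        unfold fourierE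
        rw [← integral_const_mul]
        congr 1
        ext p
        rw [pair_add_right, pair_add_right, pair_comm he (g x) p]
        ring

/-- Translation by a parameter preserves integrability. -/
theorem integrable_comp_add_param [SFinite m] [SFinite μ] [μ.IsAddLeftInvariant]
    {E : Type*} [NormedAddCommGroup E]
    {f : V × Ω → E} (hf : Integrable f (μ.prod m)) {g : Ω → V} (hg : Measurable g) :
    Integrable (fun z : V × Ω => f (z.1 + g z.2, z.2)) (μ.prod m) := by
  have h1 : MeasurePreserving (fun z : Ω × V => (z.1, z.2 + g z.1)) (m.prod μ) (m.prod μ) :=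
    (MeasurePreserving.id m).skew_product (measurable_snd.add (hg.comp measurable_fst))
      (Eventually.of_forall fun x => map_add_right_eq_self μ (g x))
  have h2 := (h1.integrable_comp_of_integrable hf.swap).swap
  exact h2

/-- `F` is a multiplier, uniformly dominated under translation, of integrable functions with
integrable Fourier transform. -/
def IsFourierMultiplier (e : V ≃ₜ+ DualGroup V) (μ : Measure V) (F : V → ℂ) : Prop :=
  Continuous F ∧ (∃ C, ∀ w, ‖F w‖ ≤ C) ∧
  ∀ h : V → ℝ≥0∞, Measurable h → ∫⁻ u, h u ∂μ < ⊤ →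
    ∃ h' : V → ℝ≥0∞, Measurable h' ∧ ∫⁻ u, h' u ∂μ < ⊤ ∧ ∀ (w : V) (ψ : V → ℂ),
      Integrable ψ μ → (∀ u, ‖fourierE e μ ψ u‖ₑ ≤ h u) →
        ∀ u, ‖fourierE e μ (fun p => ψ p * F (w + p)) u‖ₑ ≤ h' u

/-- The majorant is the average of the translates of h weighted by |φ|. It does not see w, and its
integral is ‖φ‖₁ ∫ h. -/
theorem isFourierMultiplier_paramFT [SFinite m] [SFinite μ] [μ.IsAddLeftInvariant]
    (he : ∀ u v, e u v = e v u)
    {φ : Ω → ℂ} (hφm : Measurable φ) (hφ : Integrable φ m) {g : Ω → V} (hg : Measurable g) :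
    IsFourierMultiplier e μ (paramFT e m φ g) := by
  refine ⟨continuous_paramFT hφ hg, ⟨_, norm_paramFT_le φ g⟩, fun h hm hh => ?_⟩
  have hmeas : Measurable fun z : V × Ω => ‖φ z.2‖ₑ * h (z.1 + g z.2) :=
    (hφm.comp measurable_snd).enorm.mul
      (hm.comp (measurable_fst.add (hg.comp measurable_snd)))
  refine ⟨fun u => ∫⁻ x, ‖φ x‖ₑ * h (u + g x) ∂m, hmeas.lintegral_prod_right, ?_,
    fun w ψ hψ hb u => ?_⟩
  · rw [lintegral_lintegral_swap hmeas.aemeasurable]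
    calc ∫⁻ x, ∫⁻ u, ‖φ x‖ₑ * h (u + g x) ∂μ ∂m = ∫⁻ x, ‖φ x‖ₑ * ∫⁻ u, h u ∂μ ∂m := by
          congr 1
          ext x
          rw [lintegral_const_mul _ (by fun_prop : Measurable fun u => h (u + g x)),
            lintegral_add_right_eq_self h (g x)]
      _ = (∫⁻ x, ‖φ x‖ₑ ∂m) * ∫⁻ u, h u ∂μ := lintegral_mul_const _ hφm.enorm
      _ < ⊤ := ENNReal.mul_lt_top hφ.2 hh
  · rw [fourierE_mul_paramFT he hψ hφ hg]
    refine (enorm_integral_le_lintegral_enorm _).trans (lintegral_mono fun x => ?_)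
    have h1 : ‖pair e (g x) w‖ₑ = 1 := by
      rw [← ofReal_norm, norm_pair, ENNReal.ofReal_one]
    rw [enorm_mul, enorm_mul, h1, mul_one]
    gcongr
    exact hb _

theorem isFourierMultiplier_one : IsFourierMultiplier e μ fun _ => 1 :=
  ⟨continuous_const, ⟨1, fun _ => by simp⟩, fun h hm hh => ⟨h, hm, hh, fun w ψ _ hb u => by
    simpa using hb u⟩⟩

theorem IsFourierMultiplier.mul {F G : V → ℂ} (hF : IsFourierMultiplier e μ F)
    (hG : IsFourierMultiplier e μ G) : IsFourierMultiplier e μ fun w => F w * G w := by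
  obtain ⟨cF, ⟨C, hC⟩, h1⟩ := hF
  obtain ⟨cG, ⟨D, hD⟩, h2⟩ := hG
  refine ⟨cF.mul cG, ⟨C * D, fun w => ?_⟩, fun h hm hh => ?_⟩
  · rw [norm_mul]
    exact mul_le_mul (hC w) (hD w) (norm_nonneg _) ((norm_nonneg _).trans (hC w))
  -- Majorants are passed from one factor to the next; this is why the definition quantifies over
  -- arbitrary integrable majorants rather than over ψ^ alone.
  · obtain ⟨h', hm', hh', h3⟩ := h1 h hm hh
    obtain ⟨h'', hm'', hh'', h4⟩ := h2 h' hm' hh'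
    refine ⟨h'', hm'', hh'', fun w ψ hψ hb u => ?_⟩
    have hψF : Integrable (fun p => ψ p * F (w + p)) μ :=
      hψ.mul_bdd (c := C) (cF.comp (continuous_const.add continuous_id)).aestronglyMeasurable
        (Eventually.of_forall fun p => hC _)
    have := h4 w _ hψF (h3 w ψ hψ hb) u
    simpa only [mul_assoc] using this

theorem IsFourierMultiplier.prod {κ : Type*} (s : Finset κ) {F : κ → V → ℂ}
    (hF : ∀ i ∈ s, IsFourierMultiplier e μ (F i)) :
    IsFourierMultiplier e μ fun w => ∏ i ∈ s, F i w := by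
  classical
  induction s using Finset.induction_on with
  | empty => simpa using isFourierMultiplier_one
  | insert i s his ih =>
    simp only [Finset.prod_insert his]
    exact (hF i (Finset.mem_insert_self _ _)).mul
      (ih fun j hj => hF j (Finset.mem_insert_of_mem hj))

end ParamFT

/-! ### Smoothing of oscillatory integrals -/

section Oscillatory

variable {V : Type*} [AddCommGroup V] [TopologicalSpace V] [IsTopologicalAddGroup V]
  [T2Space V] [LocallyCompactSpace V] [SecondCountableTopology V] [MeasurableSpace V]
  [BorelSpace V] {e : V ≃ₜ+ DualGroup V} {μ : Measure V} [SFinite μ] [μ.IsAddLeftInvariant]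
  {A : Type*} [NonUnitalCStarAlgebra A] {α : CStarAction V A}
  {Ω : Type*} [MeasurableSpace Ω] {m : Measure Ω} [SFinite m]

/-- Integrable functions with integrable Fourier transform. -/
def FourierIntegrable (e : V ≃ₜ+ DualGroup V) (μ : Measure V) (ψ : V → ℂ) : Prop :=
  Integrable ψ μ ∧ Integrable (fourierE e μ ψ) μ

theorem FourierIntegrable.mul {ψ F : V → ℂ} (hψ : FourierIntegrable e μ ψ)
    (hF : IsFourierMultiplier e μ F) (w : V) :
    FourierIntegrable e μ fun p => ψ p * F (w + p) := by
  obtain ⟨cF, ⟨C, hC⟩, h1⟩ := hF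
  have hψF : Integrable (fun p => ψ p * F (w + p)) μ :=
    hψ.1.mul_bdd (c := C) (cF.comp (continuous_const.add continuous_id)).aestronglyMeasurable
      (Eventually.of_forall fun p => hC _)
  obtain ⟨h', hm', hh', h2⟩ := h1 (fun u => ‖fourierE e μ ψ u‖ₑ)
    (continuous_fourierE e hψ.1).measurable.enorm hψ.2.2
  refine ⟨hψF, (continuous_fourierE e hψF).aestronglyMeasurable, ?_⟩
  exact (lintegral_mono (h2 w ψ hψ.1 fun u => le_rfl)).trans_lt hh'

/-- The integral `∫ ψ^(u) e(u, w) α_{Su}(c) du`. -/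
def oscLeft (e : V ≃ₜ+ DualGroup V) (μ : Measure V) (α : CStarAction V A) (S : V →ₜ+ V)
    (ψ : V → ℂ) (c : A) (w : V) : A :=
  ∫ u, (fourierE e μ ψ u * pair e u w) • α.aut (S u) c ∂μ

/-- The integral `∫ e(u, w) F(w) α_{w+q}(d) dw`. -/
def oscRight (e : V ≃ₜ+ DualGroup V) (μ : Measure V) (α : CStarAction V A)
    (F : V → ℂ) (d : A) (u q : V) : A :=
  ∫ w, (pair e u w * F w) • α.aut (w + q) d ∂μ

theorem integrable_smul_aut {X : Type*} [TopologicalSpace X] [SecondCountableTopology X]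
    [MeasurableSpace X]
    [OpensMeasurableSpace X] {ν : Measure X} {f : X → ℂ} (hf : Integrable f ν) {g : X → V}
    (hg : Continuous g) (c : A) : Integrable (fun x => f x • α.aut (g x) c) ν := by
  refine hf.smul_bdd (C := ‖c‖) ?_ (Eventually.of_forall fun x => (α.norm_aut _ _).le)
  exact ((α.continuous_aut c).comp hg).aestronglyMeasurable

theorem integrable_fourierE_mul_pair {ψ : V → ℂ} (hψ : FourierIntegrable e μ ψ) (w : V) :
    Integrable (fun u => fourierE e μ ψ u * pair e u w) μ :=
  hψ.2.mul_bdd (c := 1) (by fun_prop : Continuous fun u => pair e u w).aestronglyMeasurable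
    (Eventually.of_forall fun u => (norm_pair _ _ _).le)

theorem norm_oscRight_le (F : V → ℂ) (d : A) (u q : V) :
    ‖oscRight e μ α F d u q‖ ≤ (∫ w, ‖F w‖ ∂μ) * ‖d‖ := by
  refine (norm_integral_le_integral_norm _).trans_eq ?_
  simp only [norm_smul, norm_mul, norm_pair, one_mul, α.norm_aut]
  rw [integral_mul_const]

/-- The translation by g(x) is moved from the orbit of c to the scalar factors by shifting u. The
factor e(g(x), w) arises from e(u, w), and ψ^ is translated by g(x), which is multiplication of ψ(p)
by e(g(x), p); together they give the multiplier at w + p. -/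
theorem integral_param_left (he : ∀ u v, e u v = e v u) {ψ : V → ℂ}
    (hψ : FourierIntegrable e μ ψ) {φ : Ω → ℂ} (hφ : Integrable φ m) {g : Ω → V}
    (hg : Measurable g) (S : V →ₜ+ V) (c : A) (w : V) :
    ∫ u, (fourierE e μ ψ u * pair e u w) • ∫ x, φ x • α.aut (S (u - g x)) c ∂m ∂μ =
      oscLeft e μ α S (fun p => ψ p * paramFT e m φ g (w + p)) c w := by
  set G : V × Ω → A := fun z =>
    (fourierE e μ ψ z.1 * pair e z.1 w * φ z.2) • α.aut (S (z.1 - g z.2)) c with hG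
  have hGi : Integrable G (μ.prod m) := by
    refine ((integrable_fourierE_mul_pair hψ w).mul_prod hφ).smul_bdd (C := ‖c‖) ?_
      (Eventually.of_forall fun x => (α.norm_aut _ _).le)
    have h1 : Measurable fun z : V × Ω => S (z.1 - g z.2) :=
      S.continuous_toFun.measurable.comp (measurable_fst.sub (hg.comp measurable_snd))
    exact ((α.continuous_aut c).stronglyMeasurable.comp_measurable h1).aestronglyMeasurable
  calc _ = ∫ u, ∫ x, G (u, x) ∂m ∂μ := by
        congr 1
        ext u
        rw [← integral_smul]
        simp only [hG, smul_smul]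
    _ = ∫ x, ∫ u, G (u, x) ∂μ ∂m := integral_integral_swap hGi
    _ = ∫ x, ∫ u, G (u + g x, x) ∂μ ∂m := by
        congr 1
        ext x
        exact (integral_add_right_eq_self (fun u => G (u, x)) (g x)).symm
    _ = ∫ u, ∫ x, G (u + g x, x) ∂m ∂μ :=
        (integral_integral_swap (f := fun u x => G (u + g x, x))
          (integrable_comp_add_param hGi hg)).symm
    _ = _ := by
        unfold oscLeft
        congr 1
        ext u
        rw [fourierE_mul_paramFT he hψ.1 hφ hg, ← integral_mul_const, ← integral_smul_const]
        congr 1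
        ext x
        simp only [hG, add_sub_cancel_right]
        congr 1
        rw [pair_add_left]
        ring

/-- An average of translates has as its transform the product of the transforms; shifting w back by
g(x) puts -g into the phase. -/
theorem integral_param_right (he : ∀ u v, e u v = e v u) {G : V → A} (hG : Integrable G μ)
    {φ : Ω → ℂ} (hφ : Integrable φ m) {g : Ω → V} (hg : Measurable g) (u : V) :
    ∫ w, pair e u w • ∫ x, φ x • G (w + g x) ∂m ∂μ =
      paramFT e m φ (fun x => - g x) u • ∫ w, pair e u w • G w ∂μ := by
  have h0 : Integrable (fun z : V × Ω => φ z.2 • G z.1) (μ.prod m) := (hφ.smul_prod hG).swap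
  have h1 : Integrable (fun z : V × Ω => φ z.2 • G (z.1 + g z.2)) (μ.prod m) :=
    integrable_comp_add_param h0 hg
  have h2 : Integrable (fun z : V × Ω => pair e u z.1 • (φ z.2 • G (z.1 + g z.2)))
      (μ.prod m) :=
    h1.bdd_smul (C := 1)
      ((by fun_prop : Continuous fun w => pair e u w).measurable.comp
        measurable_fst).aestronglyMeasurable
      (Eventually.of_forall fun z => (norm_pair _ _ _).le)
  calc _ = ∫ w, ∫ x, pair e u w • (φ x • G (w + g x)) ∂m ∂μ := by
        congr 1
        ext w
        rw [← integral_smul]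
    _ = ∫ x, ∫ w, pair e u w • (φ x • G (w + g x)) ∂μ ∂m := integral_integral_swap h2
    _ = ∫ x, (φ x * pair e (- g x) u) • ∫ w, pair e u w • G w ∂μ ∂m := by
        congr 1
        ext x
        rw [← integral_smul, ← integral_add_right_eq_self (μ := μ)
          (fun w => (φ x * pair e (-g x) u) • pair e u w • G w) (g x)]
        congr 1
        ext w
        rw [smul_smul, smul_smul, pair_add_right, pair_comm he (-g x) u]
        congr 1
        have : pair e u (-g x) * pair e u (g x) = 1 := by
          rw [← pair_add_right, neg_add_cancel, pair_zero_right]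
        linear_combination (-(φ x * pair e u w)) * this
    _ = _ := by
        rw [integral_smul_const]
        rfl

end Oscillatory

/-! ### Gaining decay by averaging over the edges of a cube. -/

section Smoothing

variable {V : Type*} [AddCommGroup V] [TopologicalSpace V] [IsTopologicalAddGroup V]
  [T2Space V] [LocallyCompactSpace V] [SecondCountableTopology V] [MeasurableSpace V]
  [BorelSpace V] {e : V ≃ₜ+ DualGroup V} {μ : Measure V} [μ.IsAddHaarMeasure]
  {A : Type*} [NonUnitalCStarAlgebra A] {α : CStarAction V A}
  {ι : Type*} [Fintype ι] [DecidableEq ι]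

/-- The multiplier `w ↦ ∫₀¹ ω_b(t) e(E(t eᵢ), w) dt`, with `ω_b` a Taylor weight. -/
def edgeFT (e : V ≃ₜ+ DualGroup V) (E : (ι → ℝ) →+ V) (i : ι) (b : Bool) (w : V) : ℂ :=
  paramFT e ((volume : Measure ℝ).restrict (Set.Icc 0 1)) (taylorWeight b)
    (fun t => E (t • Pi.single i 1)) w

theorem continuous_edge {E : (ι → ℝ) →+ V} (hE : Continuous E) (i : ι) :
    Continuous fun t : ℝ => E (t • Pi.single i 1) :=
  hE.comp (continuous_id.smul continuous_const)

theorem isFourierMultiplier_edgeFT (he : ∀ u v, e u v = e v u) {E : (ι → ℝ) →+ V}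
    (hE : Continuous E) (i : ι) (b : Bool) : IsFourierMultiplier e μ (edgeFT e E i b) :=
  isFourierMultiplier_paramFT he (continuous_taylorWeight b).measurable
    (integrable_taylorWeight b) (continuous_edge hE i).measurable

/-- Since E is additive, the character along E factors over the coordinates, and Fubini turns the
product of edge integrals into one integral over the cube. -/
theorem prod_edgeFT (E : (ι → ℝ) →+ V) (b : ι → Bool) :
    (fun w => ∏ i, edgeFT e E i (b i) w) =
      cubeFT e E fun x => ∏ i, taylorWeight (b i) (x i) := by
  ext w
  have h1 : ∀ x : ι → ℝ, pair e (E x) w = ∏ i, pair e (E (x i • Pi.single i 1)) w := by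
    intro x
    have h2 : ∀ s : Finset ι, pair e (E (∑ i ∈ s, x i • Pi.single i 1)) w =
        ∏ i ∈ s, pair e (E (x i • Pi.single i 1)) w := by
      intro s
      induction s using Finset.induction_on with
      | empty => simp [pair_zero_left]
      | insert i s his ih =>
        rw [Finset.sum_insert his, map_add, pair_add_left, Finset.prod_insert his, ih]
    rw [← h2]
    congr 2
    ext j
    simp [Finset.sum_apply, Pi.single_apply]
  have h3 : (volume : Measure (ι → ℝ)).restrict (cube ι) =
      Measure.pi fun _ => (volume : Measure ℝ).restrict (Set.Icc 0 1) := by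
    rw [← Measure.restrict_pi_pi, volume_pi, cube, ← Set.pi_univ_Icc]
    rfl
  unfold cubeFT edgeFT paramFT
  rw [h3, ← integral_fintype_prod_eq_prod]
  congr 1
  ext x
  rw [h1, Finset.prod_mul_distrib]

theorem isCubeBounded_prod_taylorWeight (b : ι → Bool) :
    IsCubeBounded fun x : ι → ℝ => ∏ i, taylorWeight (b i) (x i) := by
  refine ⟨?_, 1, fun x hx => ?_⟩
  · refine Finset.measurable_fun_prod _ fun i _ => ?_
    exact (continuous_taylorWeight _).measurable.comp (measurable_pi_apply i)
  · rw [norm_prod]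
    exact Finset.prod_le_one (fun _ _ => norm_nonneg _)
      fun i _ => norm_taylorWeight_le _ ⟨hx.1 i, hx.2 i⟩

theorem prod_edgeFT_mul_mem_amplitudes (E : (ι → ℝ) →+ V) (b b' : ι → Bool) :
    (fun w => (∏ i, edgeFT e E i (b i) w) * ∏ i, edgeFT e E i (b' i) w) ∈ amplitudes e E := by
  refine Submodule.subset_span ⟨_, _, isCubeBounded_prod_taylorWeight b,
    isCubeBounded_prod_taylorWeight b', ?_⟩
  rw [← prod_edgeFT, ← prod_edgeFT]

variable {exp : (ι → ℝ) →+ V}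

/-- Taylor's formula is applied to t ↦ α_{Su + exp(t eᵢ)}(c). Because S ∘ E = -exp, this motion is a
translation of u by -E(t eᵢ), which the change of variables converts into the multiplier along the
edge. -/
theorem oscLeft_edge (he : ∀ u v, e u v = e v u) (hexp : Continuous exp) {S : V →ₜ+ V}
    {E : (ι → ℝ) →+ V} (hE : Continuous E) (hSE : ∀ x, S (E x) = - exp x) {c : A}
    (hc : IsSmoothVector exp α c) (i : ι) : ∃ cs : Bool → A, (∀ b, IsSmoothVector exp α (cs b)) ∧
      ∀ ψ, FourierIntegrable e μ ψ → ∀ w, oscLeft e μ α S ψ c w =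
        ∑ b, oscLeft e μ α S (fun p => ψ p * edgeFT e E i b (w + p)) (cs b) w := by
  obtain ⟨c', hc', hd⟩ := hc.exists_deriv (Pi.single i 1)
  refine ⟨fun b => if b then c else c', fun b => by cases b <;> simpa, fun ψ hψ w => ?_⟩
  have key : ∀ (b : Bool) (x : A),
      oscLeft e μ α S (fun p => ψ p * edgeFT e E i b (w + p)) x w =
        ∫ u, (fourierE e μ ψ u * pair e u w) • ∫ t in Set.Icc (0 : ℝ) 1,
          taylorWeight b t • α.aut (S u + exp (t • Pi.single i 1)) x ∂volume ∂μ := by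
    intro b x
    refine (integral_param_left he hψ (integrable_taylorWeight b)
      (continuous_edge hE i).measurable S x w).symm.trans ?_
    simp only [map_sub, hSE, sub_neg_eq_add]
  have hint : ∀ (b : Bool) (x : A), Integrable (fun u => (fourierE e μ ψ u * pair e u w) •
      ∫ t in Set.Icc (0 : ℝ) 1,
          taylorWeight b t • α.aut (S u + exp (t • Pi.single i 1)) x) μ := by
    intro b x
    refine (integrable_fourierE_mul_pair hψ w).smul_bdd
      (C := (∫ t in Set.Icc (0 : ℝ) 1, ‖taylorWeight b t‖) * ‖x‖) ?_
      (Eventually.of_forall fun u => ?_)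
    · refine Continuous.aestronglyMeasurable ?_
      refine continuous_of_dominated (bound := fun t => ‖taylorWeight b t‖ * ‖x‖) (fun u => ?_) ?_
        ((integrable_taylorWeight b).norm.mul_const _) ?_
      · refine Continuous.aestronglyMeasurable ?_
        have := continuous_edge hexp i
        exact (continuous_taylorWeight b).smul
          (α.continuous_aut_comp (continuous_const.add this) continuous_const)
      · exact fun u => Eventually.of_forall fun t => by rw [norm_smul, α.norm_aut]
      · refine Eventually.of_forall fun t => ?_
        exact (α.continuous_aut_comp (S.continuous_toFun.add continuous_const)
          continuous_const).const_smul _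
    · refine (norm_integral_le_integral_norm _).trans_eq ?_
      simp only [norm_smul, α.norm_aut]
      rw [integral_mul_const]
  rw [Fintype.sum_bool]
  simp only [if_true, Bool.false_eq_true, if_false]
  rw [key, key, ← integral_add (hint _ _) (hint _ _)]
  unfold oscLeft
  congr 1
  ext u
  rw [← smul_add]
  congr 1
  have h1 := taylor_unit_interval (hd (S u))
    (α.continuous_aut_comp (continuous_const.add (continuous_edge hexp i)) continuous_const)
  simpa using h1

theorem oscLeft_faces (he : ∀ u v, e u v = e v u) (hexp : Continuous exp) {S : V →ₜ+ V}
    {E : (ι → ℝ) →+ V} (hE : Continuous E) (hSE : ∀ x, S (E x) = - exp x) {c : A}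
    (hc : IsSmoothVector exp α c) (s : Finset ι) :
    ∃ (J : Type) (_ : Fintype J) (b : J → ι → Bool) (cs : J → A),
      (∀ j, IsSmoothVector exp α (cs j)) ∧
      ∀ ψ, FourierIntegrable e μ ψ → ∀ w, oscLeft e μ α S ψ c w =
        ∑ j, oscLeft e μ α S (fun p => ψ p * ∏ i ∈ s, edgeFT e E i (b j i) (w + p)) (cs j) w := by
  induction s using Finset.induction_on with
  | empty =>
    exact ⟨Unit, inferInstance, fun _ _ => true, fun _ => c, fun _ => hc, fun ψ _ w => by simp⟩
  | insert i s his ih =>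
    obtain ⟨J, _, b, cs, hcs, h⟩ := ih
    choose cs' hcs' h' using fun j => oscLeft_edge (μ := μ) he hexp hE hSE (hcs j) i
    -- Each new direction splits every term into the two Taylor terms, recorded by the value of the
    -- weight at i.
    refine ⟨J × Bool, inferInstance, fun p => Function.update (b p.1) i p.2,
      fun p => cs' p.1 p.2, fun p => hcs' _ _, fun ψ hψ w => ?_⟩
    rw [h ψ hψ w, Fintype.sum_prod_type]
    congr 1
    ext j
    have hm : IsFourierMultiplier e μ fun w => ∏ i ∈ s, edgeFT e E i (b j i) w :=
      IsFourierMultiplier.prod s fun i _ => isFourierMultiplier_edgeFT he hE i _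
    rw [h' j _ (hψ.mul hm w) w]
    congr 1
    ext b'
    congr 1
    ext p
    simp only []
    rw [Finset.prod_insert his, Function.update_self, mul_assoc, mul_comm (edgeFT _ _ _ _ _)]
    congr 2
    refine Finset.prod_congr rfl fun k hk => ?_
    rw [Function.update_of_ne (fun h : k = i => his (h ▸ hk))]

/-- Smoothing of an oscillatory integral in the first variable. -/
theorem oscLeft_smoothing (he : ∀ u v, e u v = e v u) (hexp : Continuous exp) {S : V →ₜ+ V}
    {E : (ι → ℝ) →+ V} (hE : Continuous E) (hSE : ∀ x, S (E x) = - exp x) {c : A}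
    (hc : IsSmoothVector exp α c) :
    ∃ (J : Type) (_ : Fintype J) (F : J → V → ℂ) (cs : J → A),
      (∀ j, F j ∈ amplitudes e E) ∧ (∀ j, IsFourierMultiplier e μ (F j)) ∧
      (∀ j, IsSmoothVector exp α (cs j)) ∧
      ∀ ψ, FourierIntegrable e μ ψ → ∀ w, oscLeft e μ α S ψ c w =
        ∑ j, oscLeft e μ α S (fun p => ψ p * F j (w + p)) (cs j) w := by
  -- All directions are used twice: one pass yields a multiplier in L², two passes a product of two
  -- such, hence an integrable amplitude.
  obtain ⟨J, _, b, cs, hcs, h⟩ := oscLeft_faces (μ := μ) he hexp hE hSE hc Finset.univ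
  choose J' i' b' cs' hcs' h' using
    fun j => oscLeft_faces (μ := μ) he hexp hE hSE (hcs j) Finset.univ
  have hm : ∀ b : ι → Bool, IsFourierMultiplier e μ fun w => ∏ i, edgeFT e E i (b i) w :=
    fun b => IsFourierMultiplier.prod _ fun i _ => isFourierMultiplier_edgeFT he hE i _
  refine ⟨Σ j, J' j, inferInstance, fun p w => (∏ i, edgeFT e E i (b p.1 i) w) *
    ∏ i, edgeFT e E i (b' p.1 p.2 i) w, fun p => cs' p.1 p.2,
    fun p => prod_edgeFT_mul_mem_amplitudes _ _ _, fun p => (hm _).mul (hm _),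
    fun p => hcs' _ _, fun ψ hψ w => ?_⟩
  rw [h ψ hψ w, Fintype.sum_sigma]
  congr 1
  ext j
  rw [h' j _ (hψ.mul (hm (b j)) w) w]
  simp only [mul_assoc]

/-- Here the Taylor formula acts on w ↦ F(w) α_{w+q}(d). By the Leibniz rule the derivative term
splits in two, one with F differentiated and one with d. Undoing the shift of w by exp(t eᵢ) leaves
a phase in u, hence the edges of -exp. -/
theorem oscRight_edge (he : ∀ u v, e u v = e v u) (hμ : UnitaryNormalised e μ)
    (hexp : Continuous exp)
    {E : (ι → ℝ) →+ V} (hE : Continuous E) (hEo : IsOpenMap E) {d : A}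
    (hd : IsSmoothVector exp α d) {F : V → ℂ} (hF : F ∈ amplitudes e E) (i : ι) :
    ∃ (F' : V → ℂ) (d' : A), F' ∈ amplitudes e E ∧ IsSmoothVector exp α d' ∧
      ∀ u q, oscRight e μ α F d u q = edgeFT e (-exp) i true u • oscRight e μ α F d u q +
        (edgeFT e (-exp) i false u • oscRight e μ α F' d u q +
         edgeFT e (-exp) i false u • oscRight e μ α F d' u q) := by
  obtain ⟨d', hd', hdd⟩ := hd.exists_deriv (Pi.single i 1)
  set γ : ℝ →+ V :=
    { toFun := fun t => exp (t • Pi.single i 1)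
      map_zero' := by simp
      map_add' := fun s t => by rw [add_smul, map_add] } with hγ
  have hγc : Continuous γ := continuous_edge hexp i
  obtain ⟨F', hF', hdF⟩ := exists_deriv_mem_amplitudes hE hγc hF
  have iF := integrable_of_mem_amplitudes hμ hE hEo hF
  have iF' := integrable_of_mem_amplitudes hμ hE hEo hF'
  have cF := continuous_of_mem_amplitudes hE hF
  have cF' := continuous_of_mem_amplitudes hE hF'
  refine ⟨F', d', hF', hd', fun u q => ?_⟩
  have hi : ∀ (G : V → ℂ) (x : A), Integrable G μ → Integrable (fun w => G w • α.aut (w + q) x) μ :=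
    fun G x hG => integrable_smul_aut hG (continuous_id.add continuous_const) x
  have hB : ∀ (G : V → ℂ) (x : A), oscRight e μ α G x u q =
      ∫ w, pair e u w • (G w • α.aut (w + q) x) ∂μ := by
    intro G x
    unfold oscRight
    simp only [smul_smul]
  have hi' : ∀ (G : V → ℂ) (x : A), Integrable G μ →
      Integrable (fun w => pair e u w • (G w • α.aut (w + q) x)) μ := fun G x hG =>
    (hi G x hG).bdd_smul (C := 1)
      (by fun_prop : Continuous fun w => pair e u w).aestronglyMeasurable
      (Eventually.of_forall fun z => (norm_pair _ _ _).le)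
  set Y : V → A := fun w => F w • α.aut (w + q) d with hY
  set Y' : V → A := fun w => F' w • α.aut (w + q) d + F w • α.aut (w + q) d' with hY'
  have hY'c : Continuous Y' :=
    (cF'.smul (α.continuous_aut_comp (continuous_id.add continuous_const) continuous_const)).add
    (cF.smul (α.continuous_aut_comp (continuous_id.add continuous_const) continuous_const))
  have hYc : Continuous Y :=
    (cF.smul (α.continuous_aut_comp (continuous_id.add continuous_const) continuous_const))
  have hYd : ∀ w t, HasDerivAt (fun t => Y (w + γ t)) (Y' (w + γ t)) t := by
    intro w t
    have h1 := (hdF w t).smul (hdd (w + q) t)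
    have h2 : ∀ s : ℝ, w + q + exp (s • Pi.single i 1) = w + γ s + q := fun s => by
      change _ = w + exp (s • Pi.single i 1) + q
      abel
    simp only [h2] at h1
    refine h1.congr_deriv ?_
    rw [hY', add_comm]
  have hYY : ∀ w, Y w = (∫ t in Set.Icc (0 : ℝ) 1, taylorWeight true t • Y (w + γ t)) +
      ∫ t in Set.Icc (0 : ℝ) 1, taylorWeight false t • Y' (w + γ t) := by
    intro w
    have := taylor_unit_interval (hYd w) (hY'c.comp (continuous_const.add hγc))
    rwa [map_zero, add_zero] at this
  have hYi : Integrable Y μ := hi _ _ iF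
  have hY'i : Integrable Y' μ := (hi _ _ iF').add (hi _ _ iF)
  have hint : ∀ (b : Bool) (G : V → A), Integrable G μ →
      Integrable (fun w => pair e u w • ∫ t in Set.Icc (0 : ℝ) 1,
        taylorWeight b t • G (w + γ t)) μ := by
    intro b G hG
    have h0 : Integrable (fun z : V × ℝ => taylorWeight b z.2 • G z.1)
      (μ.prod (volume.restrict (Set.Icc 0 1))) := ((integrable_taylorWeight b).smul_prod hG).swap
    have h1 := (integrable_comp_add_param h0 hγc.measurable).integral_prod_left
    exact h1.bdd_smul (C := 1)
      (by fun_prop : Continuous fun w => pair e u w).aestronglyMeasurable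
      (Eventually.of_forall fun z => (norm_pair _ _ _).le)
  have e1 := integral_param_right he hYi (integrable_taylorWeight true) hγc.measurable u
  have e2 := integral_param_right he hY'i (integrable_taylorWeight false) hγc.measurable u
  calc oscRight e μ α F d u q = ∫ w, pair e u w • Y w ∂μ := hB _ _
    _ = (∫ w, pair e u w • ∫ t in Set.Icc (0 : ℝ) 1, taylorWeight true t • Y (w + γ t) ∂volume ∂μ) +
        ∫ w, pair e u w • ∫ t in Set.Icc (0 : ℝ) 1, taylorWeight false t • Y' (w + γ t) ∂volume ∂μ := by
        rw [← integral_add (hint _ _ hYi) (hint _ _ hY'i)]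
        congr 1
        ext w
        rw [hYY w, smul_add]
    _ = _ := by
        rw [e1, e2, ← smul_add, hB F d, hB F' d, hB F d', ← integral_add (hi' _ _ iF') (hi' _ _ iF)]
        simp only [← smul_add]
        rfl

/-- Smoothing over the faces of a cube of an oscillatory integral in the second variable. -/
theorem oscRight_faces (he : ∀ u v, e u v = e v u) (hμ : UnitaryNormalised e μ)
    (hexp : Continuous exp)
    {E : (ι → ℝ) →+ V} (hE : Continuous E) (hEo : IsOpenMap E) {d : A}
    (hd : IsSmoothVector exp α d) {F : V → ℂ} (hF : F ∈ amplitudes e E) (s : Finset ι) :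
    ∃ (J : Type) (_ : Fintype J) (b : J → ι → Bool) (Fs : J → V → ℂ) (ds : J → A),
      (∀ j, Fs j ∈ amplitudes e E) ∧ (∀ j, IsSmoothVector exp α (ds j)) ∧
      ∀ u q, oscRight e μ α F d u q =
        ∑ j, (∏ i ∈ s, edgeFT e (-exp) i (b j i) u) • oscRight e μ α (Fs j) (ds j) u q := by
  induction s using Finset.induction_on with
  | empty =>
    exact ⟨Unit, inferInstance, fun _ _ => true, fun _ => F, fun _ => d, fun _ => hF, fun _ => hd,
      fun u q => by simp⟩
  | insert i s his ih =>
    obtain ⟨J, _, b, Fs, ds, hFs, hds, h⟩ := ih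
    choose F' d' hF' hd' h' using
      fun j => oscRight_edge he hμ hexp hE hEo (hds j) (hFs j) i
    -- The three terms of the edge formula: `none` keeps F and d with weight 1, `some true`
    -- differentiates F, `some false` differentiates d, the last two with weight t - 1.
    refine ⟨J × Option Bool, inferInstance,
      fun p => Function.update (b p.1) i p.2.isNone,
      fun p => if p.2 = some true then F' p.1 else Fs p.1,
      fun p => if p.2 = some false then d' p.1 else ds p.1, ?_, ?_, fun u q => ?_⟩
    · intro p
      dsimp only
      split_ifs
      exacts [hF' _, hFs _]
    · intro p
      dsimp only
      split_ifs
      exacts [hd' _, hds _]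
    · rw [h u q, Fintype.sum_prod_type]
      congr 1
      ext j
      have hp : ∀ b', (∏ k ∈ insert i s, edgeFT e (-exp) k (Function.update (b j) i b' k) u) =
          (∏ k ∈ s, edgeFT e (-exp) k (b j k) u) * edgeFT e (-exp) i b' u := by
        intro b'
        rw [Finset.prod_insert his, Function.update_self, mul_comm]
        congr 1
        refine Finset.prod_congr rfl fun k hk => ?_
        rw [Function.update_of_ne (fun h : k = i => his (h ▸ hk))]
      rw [h' j u q, Fintype.sum_option, Fintype.sum_bool]
      simp [hp, smul_add, smul_smul]

/-- Smoothing of an oscillatory integral in the second variable. -/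
theorem oscRight_smoothing (he : ∀ u v, e u v = e v u) (hμ : UnitaryNormalised e μ)
    (hexp : Continuous exp)
    {E : (ι → ℝ) →+ V} (hE : Continuous E) (hEo : IsOpenMap E) {d : A}
    (hd : IsSmoothVector exp α d) {F : V → ℂ} (hF : F ∈ amplitudes e E) :
    ∃ (J : Type) (_ : Fintype J) (G Fs : J → V → ℂ) (ds : J → A),
      (∀ j, G j ∈ amplitudes e (-exp)) ∧ (∀ j, Fs j ∈ amplitudes e E) ∧
      (∀ j, IsSmoothVector exp α (ds j)) ∧
      ∀ u q, oscRight e μ α F d u q =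
        ∑ j, G j u • oscRight e μ α (Fs j) (ds j) u q := by
  obtain ⟨J, _, b, Fs, ds, hFs, hds, h⟩ := oscRight_faces he hμ hexp hE hEo hd hF Finset.univ
  choose J' i' b' Fs' ds' hFs' hds' h' using
    fun j => oscRight_faces he hμ hexp hE hEo (hds j) (hFs j) Finset.univ
  refine ⟨Σ j, J' j, inferInstance, fun p w => (∏ i, edgeFT e (-exp) i (b p.1 i) w) *
    ∏ i, edgeFT e (-exp) i (b' p.1 p.2 i) w, fun p => Fs' p.1 p.2, fun p => ds' p.1 p.2,
    fun p => prod_edgeFT_mul_mem_amplitudes _ _ _, fun p => hFs' _ _, fun p => hds' _ _,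
    fun u q => ?_⟩
  rw [h u q, Fintype.sum_sigma]
  congr 1
  ext j
  rw [h' j u q, Finset.smul_sum]
  simp only [smul_smul]

end Smoothing

/-! ### Convergence of the regularised oscillatory integrals -/

section Regularised

variable {V : Type*} [AddCommGroup V] [TopologicalSpace V] [IsTopologicalAddGroup V]
  [T2Space V] [LocallyCompactSpace V] [SecondCountableTopology V] [MeasurableSpace V]
  [BorelSpace V] {e : V ≃ₜ+ DualGroup V} {μ : Measure V} [SFinite μ] [μ.IsAddLeftInvariant]
  {A : Type*} [NonUnitalCStarAlgebra A] {α : CStarAction V A}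

/-- The bounded bilinear map `(c, d) ↦ ∫ K(z) α_{f(z)}(c) α_{g(z)}(d) dν(z)`. -/
def orbitBilin {X : Type*} [TopologicalSpace X] [SecondCountableTopology X] [MeasurableSpace X]
    [OpensMeasurableSpace X] (α : CStarAction V A) {ν : Measure X} {K : X → ℂ}
    (hK : Integrable K ν) {f g : X → V} (hf : Continuous f) (hg : Continuous g) :
    A →L[ℂ] A →L[ℂ] A :=
  have hi : ∀ c d, Integrable (fun z => K z • (α.aut (f z) c * α.aut (g z) d)) ν := fun c d => by
    refine hK.smul_bdd (C := ‖c‖ * ‖d‖) ?_ (Eventually.of_forall fun x => ?_)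
    · exact (((α.continuous_aut c).comp hf).mul ((α.continuous_aut d).comp hg)).aestronglyMeasurable
    · exact (norm_mul_le _ _).trans_eq (by rw [α.norm_aut, α.norm_aut])
  LinearMap.mkContinuous₂
    (LinearMap.mk₂ ℂ (fun c d => ∫ z, K z • (α.aut (f z) c * α.aut (g z) d) ∂ν)
      (fun c c' d => by
        simp only [map_add, add_mul, smul_add]
        exact integral_add (hi _ _) (hi _ _))
      (fun r c d => by
        simp only [map_smul, smul_mul_assoc, smul_comm _ r]
        exact integral_smul _ _)
      (fun c d d' => by
        simp only [map_add, mul_add, smul_add]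
        exact integral_add (hi _ _) (hi _ _))
      (fun r c d => by
        simp only [map_smul, mul_smul_comm, smul_comm _ r]
        exact integral_smul _ _))
    (∫ z, ‖K z‖ ∂ν) fun c d => by
      refine (norm_integral_le_of_norm_le ((hK.norm.mul_const ‖c‖).mul_const ‖d‖)
        (Eventually.of_forall fun z => ?_)).trans_eq ?_
      · rw [norm_smul, mul_assoc]
        gcongr
        exact (norm_mul_le _ _).trans_eq (by rw [α.norm_aut, α.norm_aut])
      · rw [integral_mul_const, integral_mul_const]

theorem orbitBilin_apply {X : Type*} [TopologicalSpace X] [SecondCountableTopology X]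
    [MeasurableSpace X]
    [OpensMeasurableSpace X] {ν : Measure X} {K : X → ℂ}
    (hK : Integrable K ν) {f g : X → V} (hf : Continuous f) (hg : Continuous g) (c d : A) :
    orbitBilin α hK hf hg c d = ∫ z, K z • (α.aut (f z) c * α.aut (g z) d) ∂ν := rfl

/-- V is commutative, so α_v passes through the translations inside the integral. This equivariance
is what makes the oscillatory product of smooth vectors smooth. -/
theorem aut_orbitBilin {X : Type*} [TopologicalSpace X] [SecondCountableTopology X]
    [MeasurableSpace X]
    [OpensMeasurableSpace X] {ν : Measure X} {K : X → ℂ}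
    (hK : Integrable K ν) {f g : X → V} (hf : Continuous f) (hg : Continuous g) (c d : A) (v : V) :
    α.aut v (orbitBilin α hK hf hg c d) = orbitBilin α hK hf hg (α.aut v c) (α.aut v d) := by
  rw [orbitBilin_apply, orbitBilin_apply, α.aut_integral]
  congr 1
  ext z
  rw [map_smul, map_mul, ← α.aut_add, ← α.aut_add, ← α.aut_add, ← α.aut_add, add_comm v,
    add_comm v]

variable {ψ₁ ψ₂ F : V → ℂ}

theorem continuous_fourierE_mul_translate (hψ : Integrable ψ₁ μ) (cF : Continuous F)
    (bF : ∃ C, ∀ w, ‖F w‖ ≤ C) :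
    Continuous fun z : V × V => fourierE e μ (fun p => ψ₁ p * F (z.2 + p)) z.1 := by
  obtain ⟨C, hC⟩ := bF
  unfold fourierE
  refine continuous_of_dominated (bound := fun p => ‖ψ₁ p‖ * C) (fun z => ?_) (fun z => ?_)
    (hψ.norm.mul_const C) ?_
  · exact ((by fun_prop : Continuous fun p => pair e p z.1)).aestronglyMeasurable.mul
      (hψ.aestronglyMeasurable.mul
        (cF.comp (continuous_const.add continuous_id)).aestronglyMeasurable)
  · refine Eventually.of_forall fun p => ?_
    rw [norm_mul, norm_pair, one_mul, norm_mul]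
    exact mul_le_mul_of_nonneg_left (hC _) (norm_nonneg _)
  · exact Eventually.of_forall fun p => by fun_prop

/-- The majorant of the first transform does not depend on w, so the integrand is dominated by a
product of integrable functions of u and of w. -/
theorem integrable_regularised (h₁ : FourierIntegrable e μ ψ₁) (h₂ : FourierIntegrable e μ ψ₂)
    (hF : IsFourierMultiplier e μ F) :
    Integrable (fun z : V × V => fourierE e μ (fun p => ψ₁ p * F (z.2 + p)) z.1 *
      fourierE e μ ψ₂ z.2 * pair e z.1 z.2) (μ.prod μ) := by
  have h0 := continuous_fourierE_mul_translate (e := e) h₁.1 hF.1 hF.2.1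
  obtain ⟨h', hm', hh', hle⟩ := hF.2.2 (fun u => ‖fourierE e μ ψ₁ u‖ₑ)
    (continuous_fourierE e h₁.1).measurable.enorm h₁.2.2
  refine Integrable.mul_bdd (c := 1) ⟨?_, ?_⟩ (continuous_pair e).aestronglyMeasurable
    (Eventually.of_forall fun z => (norm_pair _ _ _).le)
  · exact (h0.mul ((continuous_fourierE e h₂.1).comp continuous_snd)).aestronglyMeasurable
  · calc ∫⁻ z : V × V, ‖fourierE e μ (fun p => ψ₁ p * F (z.2 + p)) z.1 *
        fourierE e μ ψ₂ z.2‖ₑ ∂(μ.prod μ)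
        ≤ ∫⁻ z : V × V, h' z.1 * ‖fourierE e μ ψ₂ z.2‖ₑ ∂(μ.prod μ) := by
          refine lintegral_mono fun z => ?_
          rw [enorm_mul]
          gcongr
          exact hle _ _ h₁.1 (fun u => le_rfl) _
      _ = (∫⁻ u, h' u ∂μ) * ∫⁻ w, ‖fourierE e μ ψ₂ w‖ₑ ∂μ :=
          lintegral_prod_mul hm'.aemeasurable
            (continuous_fourierE e h₂.1).measurable.enorm.aemeasurable
      _ < ⊤ := ENNReal.mul_lt_top hh' h₂.2.2

theorem integrable_smul_mul_aut {X : Type*} [TopologicalSpace X] [SecondCountableTopology X]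
    [MeasurableSpace X] [OpensMeasurableSpace X] {ν : Measure X} {K : X → ℂ}
    (hK : Integrable K ν) {f g : X → V} (hf : Continuous f) (hg : Continuous g) (c d : A) :
    Integrable (fun z => K z • (α.aut (f z) c * α.aut (g z) d)) ν := by
  refine hK.smul_bdd (C := ‖c‖ * ‖d‖) ?_ (Eventually.of_forall fun x => ?_)
  · exact (((α.continuous_aut c).comp hf).mul ((α.continuous_aut d).comp hg)).aestronglyMeasurable
  · exact (norm_mul_le _ _).trans_eq (by rw [α.norm_aut, α.norm_aut])

theorem regularised_eq_left (h₁ : FourierIntegrable e μ ψ₁) (h₂ : FourierIntegrable e μ ψ₂)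
    (hF : IsFourierMultiplier e μ F) (S : V →ₜ+ V) (c d : A) :
    Integrable (fun w => fourierE e μ ψ₂ w •
      (oscLeft e μ α S (fun p => ψ₁ p * F (w + p)) c w * α.aut w d)) μ ∧
    ∫ u, ∫ w, (fourierE e μ (fun p => ψ₁ p * F (w + p)) u * fourierE e μ ψ₂ w * pair e u w) •
      (α.aut (S u) c * α.aut w d) ∂μ ∂μ =
    ∫ w, fourierE e μ ψ₂ w •
      (oscLeft e μ α S (fun p => ψ₁ p * F (w + p)) c w * α.aut w d) ∂μ := by
  have hi := integrable_smul_mul_aut (α := α) (integrable_regularised h₁ h₂ hF)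
    (S.continuous_toFun.comp continuous_fst) continuous_snd c d
  have key : ∀ w, ∫ u, (fourierE e μ (fun p => ψ₁ p * F (w + p)) u * fourierE e μ ψ₂ w *
      pair e u w) • (α.aut (S u) c * α.aut w d) ∂μ = fourierE e μ ψ₂ w •
      (oscLeft e μ α S (fun p => ψ₁ p * F (w + p)) c w * α.aut w d) := by
    intro w
    have hiw : Integrable (fun u => (fourierE e μ (fun p => ψ₁ p * F (w + p)) u * pair e u w) •
        α.aut (S u) c) μ :=
      integrable_smul_aut (integrable_fourierE_mul_pair (h₁.mul hF w) w) S.continuous_toFun c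
    unfold oscLeft
    have := ((ContinuousLinearMap.mul ℂ A).flip (α.aut w d)).integral_comp_comm hiw
    simp only [ContinuousLinearMap.flip_apply, ContinuousLinearMap.mul_apply'] at this
    rw [← this, ← integral_smul]
    congr 1
    ext u
    rw [smul_mul_assoc, smul_smul]
    congr 1
    ring
  refine ⟨?_, ?_⟩
  · exact hi.integral_prod_right.congr (Eventually.of_forall key)
  · rw [← integral_congr_ae (Eventually.of_forall key)]
    exact integral_integral_swap hi

theorem continuous_oscRight (hF : Integrable F μ) (d : A) :
    Continuous fun z : V × V => oscRight e μ α F d z.1 z.2 := by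
  unfold oscRight
  refine continuous_of_dominated (bound := fun w => ‖F w‖ * ‖d‖) (fun z => ?_) (fun z => ?_)
    (hF.norm.mul_const _) ?_
  · exact (integrable_smul_aut (integrable_pair_mul' e hF z.1)
      (continuous_id.add continuous_const) d).aestronglyMeasurable
  · exact Eventually.of_forall fun w => by
      rw [norm_smul, norm_mul, norm_pair, one_mul, α.norm_aut]
  · exact Eventually.of_forall fun w => by fun_prop

/-- Since ψ₂^ need not be differentiable, it has to leave the w-integral before that integral is
smoothed. Both transforms are opened as integrals over (p, q) = z: then q merely shifts u, and the
substitution w ↦ w - p moves p from F to the orbit of d. -/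
theorem regularised_eq_right (he : ∀ u v, e u v = e v u) (h₁ : Integrable ψ₁ μ)
    (h₂ : Integrable ψ₂ μ) (hF : Integrable F μ) (d : A) (u : V) :
    ∫ w, (fourierE e μ (fun p => ψ₁ p * F (w + p)) u * fourierE e μ ψ₂ w * pair e u w) •
      α.aut w d ∂μ =
    ∫ z : V × V, (ψ₁ z.1 * ψ₂ z.2 * pair e (-z.2) z.1) •
      oscRight e μ α F d (u + z.2) (-z.1) ∂(μ.prod μ) := by
  set k : V → V × V → ℂ := fun w z => (pair e z.1 u * pair e z.2 w * pair e u w) *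
    (F (w + z.1) * (ψ₁ z.1 * ψ₂ z.2)) with hk
  have hki : Integrable (Function.uncurry k) (μ.prod (μ.prod μ)) := by
    have h0 : Integrable (fun y : V × (V × V) => F y.1 * (ψ₁ y.2.1 * ψ₂ y.2.2))
      (μ.prod (μ.prod μ)) := hF.mul_prod (h₁.mul_prod h₂)
    refine (integrable_comp_add_param h0 measurable_fst).bdd_mul (c := 1) ?_
      (Eventually.of_forall fun y => by simp [norm_pair])
    refine Continuous.aestronglyMeasurable ?_
    fun_prop
  have hki' : Integrable (fun y : V × (V × V) => k y.1 y.2 • α.aut y.1 d) (μ.prod (μ.prod μ)) :=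
    integrable_smul_aut hki continuous_fst d
  calc _ = ∫ w, ∫ z, k w z • α.aut w d ∂(μ.prod μ) ∂μ := by
        congr 1
        ext w
        rw [integral_smul_const]
        congr 1
        unfold fourierE
        rw [← integral_prod_mul, ← integral_mul_const]
        congr 1
        ext z
        simp only [hk]
        ring
    _ = ∫ z, ∫ w, k w z • α.aut w d ∂μ ∂(μ.prod μ) := integral_integral_swap hki'
    _ = _ := by
        congr 1
        ext z
        unfold oscRight
        rw [← integral_add_right_eq_self (μ := μ) _ (-z.1), ← integral_smul]
        congr 1
        ext w
        rw [smul_smul, hk]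
        congr 1
        simp only [neg_add_cancel_right, pair_add_right, pair_add_left, pair_neg_left,
          pair_neg_right]
        have h1 : star (pair e u z.1) * pair e z.1 u = 1 := by
          rw [pair_comm he z.1 u, ← pair_neg_right, ← pair_add_right, neg_add_cancel,
            pair_zero_right]
        linear_combination (pair e z.2 w * star (pair e z.2 z.1) * pair e u w * F w * ψ₁ z.1 *
          ψ₂ z.2) * h1

/-- With G integrable the u-integral can be taken innermost, and u ↦ u - q moves q from G and the
phase onto c. What remains, apart from a phase, is one fixed bounded bilinear map evaluated on
translates of c and d. -/
theorem regularised_eq_bilin (h₁ : Integrable ψ₁ μ)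
    (h₂ : Integrable ψ₂ μ) {G : V → ℂ} (hG : Integrable G μ)
    (hF : Integrable F μ) (S : V →ₜ+ V) (c d : A)
    (hK : Integrable (fun z : V × V => G z.1 * (pair e z.1 z.2 * F z.2)) (μ.prod μ)) :
    (∀ᵐ u ∂μ, Integrable (fun z : V × V => (ψ₁ z.1 * ψ₂ z.2 * pair e (-z.2) z.1) •
      (α.aut (S u) c * (G (u + z.2) • oscRight e μ α F d (u + z.2) (-z.1)))) (μ.prod μ)) ∧
    Integrable (fun u => ∫ z : V × V, (ψ₁ z.1 * ψ₂ z.2 * pair e (-z.2) z.1) •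
      (α.aut (S u) c * (G (u + z.2) • oscRight e μ α F d (u + z.2) (-z.1))) ∂(μ.prod μ)) μ ∧
    ∫ u, ∫ z : V × V, (ψ₁ z.1 * ψ₂ z.2 * pair e (-z.2) z.1) •
      (α.aut (S u) c * (G (u + z.2) • oscRight e μ α F d (u + z.2) (-z.1))) ∂(μ.prod μ) ∂μ =
    ∫ z : V × V, (ψ₁ z.1 * ψ₂ z.2) • (pair e (-z.2) z.1 •
      orbitBilin α hK (S.continuous_toFun.comp continuous_fst) continuous_snd
        (α.aut (-(S z.2)) c) (α.aut (-z.1) d)) ∂(μ.prod μ) := by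
  set k : V → V × V → ℂ := fun u z =>
    pair e (-z.2) z.1 * (G (u + z.2) * (ψ₁ z.1 * ψ₂ z.2)) with hk
  set Y : V → V × V → A := fun u z => α.aut (S u) c * oscRight e μ α F d (u + z.2) (-z.1) with hY
  have hki : Integrable (Function.uncurry k) (μ.prod (μ.prod μ)) := by
    have h0 : Integrable (fun y : V × (V × V) => G y.1 * (ψ₁ y.2.1 * ψ₂ y.2.2))
      (μ.prod (μ.prod μ)) := hG.mul_prod (h₁.mul_prod h₂)
    refine (integrable_comp_add_param h0 measurable_snd).bdd_mul (c := 1) ?_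
      (Eventually.of_forall fun y => by simp [norm_pair])
    refine Continuous.aestronglyMeasurable ?_
    fun_prop
  have hYc : Continuous (Function.uncurry Y) := by
    have h1 : Continuous fun y : V × (V × V) => α.aut (S y.1) c :=
      (α.continuous_aut c).comp (S.continuous_toFun.comp continuous_fst)
    have h2 : Continuous fun y : V × (V × V) => (y.1 + y.2.2, -y.2.1) := by fun_prop
    have h3 := (continuous_oscRight (e := e) (α := α) hF d).comp h2
    exact h1.mul h3
  have hYb : ∀ u z, ‖Y u z‖ ≤ ‖c‖ * ((∫ w, ‖F w‖ ∂μ) * ‖d‖) := by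
    intro u z
    refine (norm_mul_le _ _).trans ?_
    rw [α.norm_aut]
    gcongr
    exact norm_oscRight_le _ _ _ _
  have hki' : Integrable (Function.uncurry fun u z => k u z • Y u z) (μ.prod (μ.prod μ)) :=
    Integrable.smul_bdd (f := Function.uncurry Y) (φ := Function.uncurry k)
      (C := ‖c‖ * ((∫ w, ‖F w‖ ∂μ) * ‖d‖)) hki hYc.aestronglyMeasurable
      (Eventually.of_forall fun y => hYb _ _)
  have hkY : ∀ u z, k u z • Y u z = (ψ₁ z.1 * ψ₂ z.2 * pair e (-z.2) z.1) •
      (α.aut (S u) c * (G (u + z.2) • oscRight e μ α F d (u + z.2) (-z.1))) := by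
    intro u z
    rw [mul_smul_comm, smul_smul, hk, hY]
    congr 1
    ring
  simp only [← hkY]
  refine ⟨hki'.prod_right_ae, hki'.integral_prod_left, ?_⟩
  rw [integral_integral_swap hki']
  congr 1
  ext z
  rw [smul_smul, orbitBilin_apply, integral_prod _ (integrable_smul_mul_aut hK
    (S.continuous_toFun.comp continuous_fst) continuous_snd _ _),
    ← integral_add_right_eq_self (μ := μ) _ (-z.2), ← integral_smul]
  congr 1
  ext u
  have hw : ∀ w : V, (G u * (pair e u w * F w)) • (α.aut (S u) (α.aut (-(S z.2)) c) *
      α.aut w (α.aut (-z.1) d)) = G u • (α.aut (S (u + -z.2)) c *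
        ((pair e u w * F w) • α.aut (w + -z.1) d)) := by
    intro w
    rw [mul_smul_comm, smul_smul, ← α.aut_add, ← α.aut_add, map_add, map_neg]
  have hw2 : ∫ w, (G u * (pair e u w * F w)) • (α.aut (S u) (α.aut (-(S z.2)) c) *
      α.aut w (α.aut (-z.1) d)) ∂μ =
      G u • (α.aut (S (u + -z.2)) c * oscRight e μ α F d u (-z.1)) := by
    simp only [hw]
    rw [integral_smul]
    congr 1
    exact (ContinuousLinearMap.mul ℂ A (α.aut (S (u + -z.2)) c)).integral_comp_comm
      (integrable_smul_aut (integrable_pair_mul' e hF u) (continuous_id.add continuous_const) d)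
  refine Eq.trans ?_ (congrArg (_ • ·) hw2.symm)
  simp only [hk, hY, neg_add_cancel_right, smul_smul]
  congr 1
  ring

end Regularised

/-! ### The regularised double integral as a pairing with a bounded continuous function, in
coordinates. -/

section OscillatoryProduct

variable {V : Type*} [AddCommGroup V] [TopologicalSpace V] [IsTopologicalAddGroup V]
  [T2Space V] [LocallyCompactSpace V] [SecondCountableTopology V] [MeasurableSpace V]
  [BorelSpace V] {e : V ≃ₜ+ DualGroup V} {μ : Measure V} [μ.IsAddHaarMeasure]
  {A : Type*} [NonUnitalCStarAlgebra A] {α : CStarAction V A}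
  {ι : Type*} [Fintype ι]

theorem exists_regularised_aux (he : ∀ u v, e u v = e v u) (hμ : UnitaryNormalised e μ)
    {exp : (ι → ℝ) →+ V} (hexp : Continuous exp) (hexpo : IsOpenMap exp) {S : V →ₜ+ V}
    {E : (ι → ℝ) →+ V} (hE : Continuous E) (hEo : IsOpenMap E) (hSE : ∀ x, S (E x) = - exp x)
    {c d : A} (hc : IsSmoothVector exp α c) (hd : IsSmoothVector exp α d) :
    ∃ Z : V × V → A, Continuous Z ∧ (∃ C, ∀ z, ‖Z z‖ ≤ C) ∧ IsSmoothVector exp α (Z 0) ∧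
      ∀ ψ₁ ψ₂, FourierIntegrable e μ ψ₁ → FourierIntegrable e μ ψ₂ →
      ∫ u, ∫ w, (fourierE e μ ψ₁ u * fourierE e μ ψ₂ w * pair e u w) •
        (α.aut (S u) c * α.aut w d) ∂μ ∂μ =
      ∫ z, (ψ₁ z.1 * ψ₂ z.2) • Z z ∂(μ.prod μ) := by
  classical
  obtain ⟨J, _, F, cs, hF, hFm, hcs, hL⟩ := oscLeft_smoothing (μ := μ) he hexp hE hSE hc
  choose J' i' G F' ds hG hF' hds hR using
    fun j => oscRight_smoothing he hμ hexp hE hEo hd (hF j)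
  have hEneg : Continuous (-exp) := hexp.neg
  have hEnego : IsOpenMap (-exp) := (Homeomorph.neg V).isOpenMap.comp hexpo
  have iF' := fun j l => integrable_of_mem_amplitudes hμ hE hEo (hF' j l)
  have iG := fun j l => integrable_of_mem_amplitudes hμ hEneg hEnego (hG j l)
  have hK : ∀ j l, Integrable (fun z : V × V => G j l z.1 * (pair e z.1 z.2 * F' j l z.2))
      (μ.prod μ) := by
    intro j l
    refine (((iG j l).mul_prod (iF' j l)).bdd_mul (c := 1)
      (continuous_pair e).aestronglyMeasurable
      (Eventually.of_forall fun z => (norm_pair _ _ _).le)).congr (Eventually.of_forall fun z => ?_)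
    simp only []
    ring
  have hSc : Continuous (fun z : V × V => S z.1) := S.continuous_toFun.comp continuous_fst
  set B : ∀ j l, A →L[ℂ] A →L[ℂ] A := fun j l =>
    orbitBilin α (hK j l) hSc continuous_snd with hB
  -- A finite sum of bounded bilinear maps on orbits: boundedness and continuity in z are immediate,
  -- and at z = 0 all phases and translations disappear.
  set Z : V × V → A := fun z => ∑ j, ∑ l, pair e (-z.2) z.1 •
    B j l (α.aut (-(S z.2)) (cs j)) (α.aut (-z.1) (ds j l)) with hZ
  have hterm_cont : ∀ j l, Continuous fun z : V × V => pair e (-z.2) z.1 •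
      B j l (α.aut (-(S z.2)) (cs j)) (α.aut (-z.1) (ds j l)) := by
    intro j l
    have h1 : Continuous fun z : V × V => α.aut (-(S z.2)) (cs j) :=
      (α.continuous_aut _).comp (S.continuous_toFun.comp continuous_snd).neg
    have h2 : Continuous fun z : V × V => α.aut (-z.1) (ds j l) :=
      (α.continuous_aut _).comp continuous_fst.neg
    have h3 : Continuous fun z : V × V => pair e (-z.2) z.1 := by fun_prop
    exact h3.smul (((B j l).continuous.comp h1).clm_apply h2)
  have hterm_le : ∀ j l (z : V × V), ‖pair e (-z.2) z.1 •
      B j l (α.aut (-(S z.2)) (cs j)) (α.aut (-z.1) (ds j l))‖ ≤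
      ‖B j l‖ * ‖cs j‖ * ‖ds j l‖ := by
    intro j l z
    rw [norm_smul, norm_pair, one_mul]
    refine ((B j l).le_opNorm₂ _ _).trans_eq ?_
    rw [α.norm_aut, α.norm_aut]
  have hZc : Continuous Z :=
    continuous_finsetSum _ fun j _ => continuous_finsetSum _ fun l _ => hterm_cont j l
  have hZb : ∀ z, ‖Z z‖ ≤ ∑ j, ∑ l, ‖B j l‖ * ‖cs j‖ * ‖ds j l‖ := fun z =>
    (norm_sum_le _ _).trans <| Finset.sum_le_sum fun j _ =>
      (norm_sum_le _ _).trans <| Finset.sum_le_sum fun l _ => hterm_le j l z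
  refine ⟨Z, hZc, ⟨_, hZb⟩, ?_, fun ψ₁ ψ₂ h₁ h₂ => ?_⟩
  · have h0 : Z 0 = ∑ j, ∑ l, B j l (cs j) (ds j l) := by
      simp [hZ, pair_zero_left, α.aut_zero]
    unfold IsSmoothVector
    have h1 : (fun x => α.aut (exp x) (Z 0)) = fun x => ∑ j, ∑ l,
        B j l (α.aut (exp x) (cs j)) (α.aut (exp x) (ds j l)) := by
      ext x
      rw [h0, map_sum]
      refine Finset.sum_congr rfl fun j _ => ?_
      rw [map_sum]
      exact Finset.sum_congr rfl fun l _ => aut_orbitBilin _ _ _ _ _ _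
    rw [h1]
    refine ContDiff.sum fun j _ => ContDiff.sum fun l _ => ?_
    have hBr : ContDiff ℝ ∞ fun p : A × A => B j l p.1 p.2 :=
      ((B j l).isBoundedBilinearMap.contDiff (n := ∞)).restrict_scalars ℝ
    exact hBr.comp ((hcs j).prodMk (hds j l))
  · have one := regularised_eq_left (α := α) h₁ h₂ isFourierMultiplier_one S c d
    simp only [mul_one] at one
    -- The u-integral is done first, so that it can be smoothed for each fixed w; afterwards the
    -- order is reversed to smooth the w-integral for each fixed u.
    rw [one.2]
    have step : ∀ j, Integrable (fun w => fourierE e μ ψ₂ w • (oscLeft e μ α S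
        (fun p => ψ₁ p * F j (w + p)) (cs j) w * α.aut w d)) μ := fun j =>
      (regularised_eq_left h₁ h₂ (hFm j) S (cs j) d).1
    have hFi := fun j => integrable_of_mem_amplitudes hμ hE hEo (hF j)
    have hiw0 : ∀ j u, Integrable (fun w => (fourierE e μ (fun p => ψ₁ p * F j (w + p)) u *
          fourierE e μ ψ₂ w * pair e u w) • α.aut w d) μ := by
      intro j u
      obtain ⟨C, hC⟩ := (hFm j).2.1
      refine integrable_smul_aut (Integrable.mul_bdd (c := 1)
        (h₂.2.bdd_mul (c := ∫ p, ‖ψ₁ p‖ * C ∂μ) ?_ ?_)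
        (by fun_prop : Continuous fun w => pair e u w).aestronglyMeasurable
        (Eventually.of_forall fun w => (norm_pair _ _ _).le)) continuous_id d
      · exact ((continuous_fourierE_mul_translate h₁.1 (hFm j).1 (hFm j).2.1).comp
          (continuous_const.prodMk continuous_id)).aestronglyMeasurable
      · refine Eventually.of_forall fun w => (norm_fourierE_le (e := e) (μ := μ) _ _).trans ?_
        refine integral_mono_of_nonneg (Eventually.of_forall fun _ => norm_nonneg _)
          (h₁.1.norm.mul_const _) (Eventually.of_forall fun p => ?_)
        simp only [norm_mul]
        gcongr
        exact hC _
    have hiz : ∀ j u, Integrable (fun z : V × V => (ψ₁ z.1 * ψ₂ z.2 * pair e (-z.2) z.1) •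
      oscRight e μ α (F j) d (u + z.2) (-z.1)) (μ.prod μ) := by
      intro j u
      refine Integrable.smul_bdd (C := (∫ w, ‖F j w‖ ∂μ) * ‖d‖)
        ((h₁.1.mul_prod h₂.1).mul_bdd (c := 1) ?_ (Eventually.of_forall fun w =>
          (norm_pair _ _ _).le)) ?_ (Eventually.of_forall fun z => norm_oscRight_le _ _ _ _)
      · exact (by fun_prop : Continuous fun z : V × V =>
          pair e (-z.2) z.1).aestronglyMeasurable
      · exact ((continuous_oscRight (hFi j) d).comp ((continuous_const.add
          continuous_snd).prodMk continuous_fst.neg)).aestronglyMeasurable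
    have hterm : ∀ j l, Integrable (fun z : V × V => (ψ₁ z.1 * ψ₂ z.2) • (pair e (-z.2) z.1 •
          B j l (α.aut (-(S z.2)) (cs j)) (α.aut (-z.1) (ds j l)))) (μ.prod μ) := by
      intro j l
      refine (h₁.1.mul_prod h₂.1).smul_bdd (C := ‖B j l‖ * ‖cs j‖ * ‖ds j l‖) ?_
        (Eventually.of_forall fun z => hterm_le j l z)
      exact (hterm_cont j l).aestronglyMeasurable
    have step2 : ∀ j, ∫ w, fourierE e μ ψ₂ w • (oscLeft e μ α S
        (fun p => ψ₁ p * F j (w + p)) (cs j) w * α.aut w d) ∂μ =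
        ∑ l, ∫ z : V × V, (ψ₁ z.1 * ψ₂ z.2) • (pair e (-z.2) z.1 •
          B j l (α.aut (-(S z.2)) (cs j)) (α.aut (-z.1) (ds j l))) ∂(μ.prod μ) := by
      intro j
      have bil := fun l => regularised_eq_bilin (α := α) h₁.1 h₂.1 (iG j l)
        (iF' j l) S (cs j) (ds j l) (hK j l)
      rw [← (regularised_eq_left h₁ h₂ (hFm j) S (cs j) d).2]
      rw [← Finset.sum_congr rfl fun l _ => (bil l).2.2]
      rw [← integral_finsetSum _ fun l _ => (bil l).2.1]
      have hae : ∀ᵐ u ∂μ, ∀ l, _ := ae_all_iff.2 fun l => (bil l).1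
      refine integral_congr_ae (hae.mono fun u hu => ?_)
      simp only []
      rw [← integral_finsetSum _ fun l _ => hu l]
      have hiw : Integrable (fun w => (fourierE e μ (fun p => ψ₁ p * F j (w + p)) u *
          fourierE e μ ψ₂ w * pair e u w) • α.aut w d) μ := hiw0 j u
      have h3 : ∀ w, (fourierE e μ (fun p => ψ₁ p * F j (w + p)) u * fourierE e μ ψ₂ w *
          pair e u w) • (α.aut (S u) (cs j) * α.aut w d) =
          ContinuousLinearMap.mul ℂ A (α.aut (S u) (cs j))
            ((fourierE e μ (fun p => ψ₁ p * F j (w + p)) u * fourierE e μ ψ₂ w *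
          pair e u w) • α.aut w d) := fun w => by
        rw [ContinuousLinearMap.mul_apply', mul_smul_comm]
      simp only [h3]
      rw [ContinuousLinearMap.integral_comp_comm _ hiw,
        regularised_eq_right he h₁.1 h₂.1 (hFi j) d u,
        ← ContinuousLinearMap.integral_comp_comm _ (hiz j u)]
      congr 1
      ext z
      rw [map_smul, hR, ContinuousLinearMap.mul_apply', Finset.mul_sum, Finset.smul_sum]
    calc _ = ∫ w, ∑ j, fourierE e μ ψ₂ w • (oscLeft e μ α S
        (fun p => ψ₁ p * F j (w + p)) (cs j) w * α.aut w d) ∂μ := by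
          congr 1
          ext w
          rw [hL ψ₁ h₁ w, Finset.sum_mul, Finset.smul_sum]
      _ = ∑ j, ∫ w, fourierE e μ ψ₂ w • (oscLeft e μ α S
        (fun p => ψ₁ p * F j (w + p)) (cs j) w * α.aut w d) ∂μ :=
          integral_finsetSum _ fun j _ => step j
      _ = ∑ j, ∑ l, ∫ z : V × V, (ψ₁ z.1 * ψ₂ z.2) • (pair e (-z.2) z.1 •
          B j l (α.aut (-(S z.2)) (cs j)) (α.aut (-z.1) (ds j l))) ∂(μ.prod μ) :=
          Finset.sum_congr rfl fun j _ => step2 j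
      _ = _ := by
        simp only [hZ, Finset.smul_sum]
        rw [integral_finsetSum _ fun j _ => integrable_finsetSum _ fun l _ => hterm j l]
        exact Finset.sum_congr rfl fun j _ =>
          (integral_finsetSum _ fun l _ => hterm j l).symm

end OscillatoryProduct

/-! ### Existence and uniqueness of the oscillatory product, and skew-adjointness of T. -/

section OscillatoryProduct

variable {V : Type*} [AddCommGroup V] [TopologicalSpace V] [IsTopologicalAddGroup V]
  [T2Space V] [LocallyCompactSpace V] [SecondCountableTopology V] [MeasurableSpace V]
  [BorelSpace V] {e : V ≃ₜ+ DualGroup V} {μ : Measure V} [μ.IsAddHaarMeasure]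
  {A : Type*} [NonUnitalCStarAlgebra A] {α : CStarAction V A}
  {𝔤 : Type*} [NormedAddCommGroup 𝔤] [NormedSpace ℝ 𝔤] [FiniteDimensional ℝ 𝔤]

/-- The regularised oscillatory integrals are the pairings with a bounded continuous function:
this is the content of the existence of the oscillatory integral. -/
theorem exists_regularised (he : ∀ u v, e u v = e v u) (hμ : UnitaryNormalised e μ)
    {exp : 𝔤 →+ V} (hexp : IsLocalHomeomorph exp) {S : V →ₜ+ V} (hS : Function.Bijective S)
    {c d : A} (hc : IsSmoothVector exp α c) (hd : IsSmoothVector exp α d) :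
    ∃ Z : V × V → A, Continuous Z ∧ (∃ C, ∀ z, ‖Z z‖ ≤ C) ∧ IsSmoothVector exp α (Z 0) ∧
      ∀ ψ₁ ψ₂, FourierIntegrable e μ ψ₁ → FourierIntegrable e μ ψ₂ →
      ∫ u, ∫ w, (fourierE e μ ψ₁ u * fourierE e μ ψ₂ w * pair e u w) •
        (α.aut (S u) c * α.aut w d) ∂μ ∂μ =
      ∫ z, (ψ₁ z.1 * ψ₂ z.2) • Z z ∂(μ.prod μ) := by
  -- The open mapping theorem for σ-compact groups makes S a homeomorphism, so that composing `exp`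
  -- with its inverse is again continuous and open.
  have hSo : IsOpenMap S :=
    S.toAddMonoidHom.isOpenMap_of_sigmaCompact hS.2 S.continuous_toFun
  let S' : V ≃+ V := AddEquiv.ofBijective S.toAddMonoidHom hS
  let Sh : V ≃ₜ V := (S' : V ≃ V).toHomeomorphOfContinuousOpen S.continuous_toFun hSo
  let b : 𝔤 ≃L[ℝ] (Fin (Module.finrank ℝ 𝔤) → ℝ) := (Module.finBasis ℝ 𝔤).equivFunL
  let exp' : (Fin (Module.finrank ℝ 𝔤) → ℝ) →+ V := exp.comp b.symm.toLinearMap.toAddMonoidHom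
  have hexp' : Continuous exp' := hexp.continuous.comp b.symm.continuous
  have hexpo : IsOpenMap exp' := hexp.isOpenMap.comp b.symm.toHomeomorph.isOpenMap
  have htrans : ∀ x, IsSmoothVector exp α x ↔ IsSmoothVector exp' α x := by
    intro x
    refine ⟨fun h => ContDiff.comp h b.symm.contDiff, fun h => ?_⟩
    have h1 : (fun x₁ => α.aut (exp x₁) x) = (fun y => α.aut (exp' y) x) ∘ b := by
      ext y
      exact congrArg (fun y => α.aut (exp y) x) (b.symm_apply_apply y).symm
    unfold IsSmoothVector
    rw [h1]
    exact ContDiff.comp h b.contDiff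
  -- E = -S⁻¹ ∘ exp, the only choice with S ∘ E = -exp; this is where the invertibility of T enters.
  let E : (Fin (Module.finrank ℝ 𝔤) → ℝ) →+ V := -(S'.symm.toAddMonoidHom.comp exp')
  have hE : Continuous E := (Sh.symm.continuous.comp hexp').neg
  have hEo : IsOpenMap E :=
    (Homeomorph.neg V).isOpenMap.comp (Sh.symm.isOpenMap.comp hexpo)
  have hSE : ∀ x, S (E x) = -exp' x := by
    intro x
    change S (-(S'.symm (exp' x))) = _
    rw [map_neg]
    exact congrArg Neg.neg (S'.apply_symm_apply (exp' x))
  obtain ⟨Z, h1, h2, h3, h4⟩ := exists_regularised_aux he hμ hexp' hexpo hE hEo hSE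
    ((htrans c).1 hc) ((htrans d).1 hd)
  exact ⟨Z, h1, h2, (htrans _).2 h3, h4⟩

theorem IsSummationKernel.fourierIntegrable {N : Set V} {ψ : V → ℂ}
    (h : IsSummationKernel e μ N ψ) : FourierIntegrable e μ ψ :=
  ⟨h.integrable, h.integrable_fourier⟩

theorem integrable_mul_smul {ψ₁ ψ₂ : V → ℂ} (h₁ : Integrable ψ₁ μ) (h₂ : Integrable ψ₂ μ)
    {Z : V × V → A} (hZ : Continuous Z) {C : ℝ} (hC : ∀ z, ‖Z z‖ ≤ C) :
    Integrable (fun z : V × V => (ψ₁ z.1 * ψ₂ z.2) • Z z) (μ.prod μ) :=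
  (h₁.mul_prod h₂).smul_bdd (C := C) hZ.aestronglyMeasurable (Eventually.of_forall hC)

theorem IsSummationKernel.norm_integral_prod_smul_sub_le {N : Set V} {ψ₁ ψ₂ : V → ℂ}
    (h₁ : IsSummationKernel e μ N ψ₁) (h₂ : IsSummationKernel e μ N ψ₂)
    {Z : V × V → A} (hZ : Continuous Z) {C : ℝ} (hC : ∀ z, ‖Z z‖ ≤ C) {z : A} {ε : ℝ}
    (hN : ∀ p ∈ N, ∀ q ∈ N, ‖Z (p, q) - z‖ ≤ ε) :
    ‖(∫ p, (ψ₁ p.1 * ψ₂ p.2) • Z p ∂(μ.prod μ)) - z‖ ≤ ε := by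
  have hi := integrable_mul_smul h₁.integrable h₂.integrable hZ hC
  have h : ∀ p, ∫ q, (ψ₁ p * ψ₂ q) • Z (p, q) ∂μ = ψ₁ p • ∫ q, ψ₂ q • Z (p, q) ∂μ := by
    intro p
    rw [← integral_smul]
    simp only [smul_smul]
  rw [integral_prod _ hi]
  simp only [h]
  refine h₁.norm_integral_smul_sub_le ?_ fun p hp => h₂.norm_integral_smul_sub_le ?_ fun q hq =>
    hN p hp q hq
  · exact hi.integral_prod_left.congr (Eventually.of_forall h)
  · exact h₂.integrable.smul_bdd (C := C) (hZ.comp (by fun_prop)).aestronglyMeasurable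
      (Eventually.of_forall fun q => hC _)

theorem exists_forall_norm_sub_le {X : Type*} [NormedAddCommGroup X] {Z : V × V → X}
    (hZ : Continuous Z) {ε : ℝ} (hε : 0 < ε) :
    ∃ N ∈ 𝓝 (0 : V), ∀ p ∈ N, ∀ q ∈ N, ‖Z (p, q) - Z 0‖ ≤ ε := by
  have h1 : ∀ᶠ z in 𝓝 (0 : V × V), ‖Z z - Z 0‖ ≤ ε := by
    have := (hZ.tendsto 0).eventually (Metric.closedBall_mem_nhds _ hε)
    exact this.mono fun z hz => by simpa [dist_eq_norm] using hz
  rw [show (0 : V × V) = (0, 0) from rfl, nhds_prod_eq] at h1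
  obtain ⟨N, hN, h⟩ := (𝓝 (0 : V)).basis_sets.prod_self.eventually_iff.1 h1
  exact ⟨N, hN, fun p hp q hq => h ⟨hp, hq⟩⟩

theorem isRieffelProduct_of_regularised
    {σ : DualGroup V →ₜ+ DualGroup (DualGroup V)} {c d : A} {Z : V × V → A}
    (hZ : Continuous Z) {C : ℝ} (hC : ∀ z, ‖Z z‖ ≤ C)
    (h : ∀ ψ₁ ψ₂, FourierIntegrable e μ ψ₁ → FourierIntegrable e μ ψ₂ →
      ∫ u, ∫ w, (fourierE e μ ψ₁ u * fourierE e μ ψ₂ w * pair e u w) •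
        (α.aut (adjointE e (opT e σ) u) c * α.aut w d) ∂μ ∂μ =
      ∫ z, (ψ₁ z.1 * ψ₂ z.2) • Z z ∂(μ.prod μ)) :
    IsRieffelProduct e σ μ α c d (Z 0) := by
  intro ε hε
  obtain ⟨N, hN, h1⟩ := exists_forall_norm_sub_le hZ (half_pos hε)
  refine ⟨N, hN, fun ψ₁ ψ₂ h₁ h₂ => ?_⟩
  rw [h _ _ h₁.fourierIntegrable h₂.fourierIntegrable]
  exact (h₁.norm_integral_prod_smul_sub_le h₂ hZ hC h1).trans_lt (half_lt_self hε)

theorem IsRieffelProduct.unique (he : ∀ u v, e u v = e v u) (hμ : UnitaryNormalised e μ)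
    {σ : DualGroup V →ₜ+ DualGroup (DualGroup V)} {c d x y : A}
    (hx : IsRieffelProduct e σ μ α c d x) (hy : IsRieffelProduct e σ μ α c d y) : y = x := by
  obtain ⟨ψ, hψ, -, -⟩ := exists_kernelSeq he hμ
  refine eq_of_forall_dist_le fun ε hε => ?_
  obtain ⟨N, hN, h1⟩ := hx (ε / 2) (half_pos hε)
  obtain ⟨N', hN', h2⟩ := hy (ε / 2) (half_pos hε)
  obtain ⟨n, hn, hn'⟩ := ((hψ N hN).and (hψ N' hN')).exists
  have h3 := h1 _ _ hn hn
  have h4 := h2 _ _ hn' hn'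
  rw [← dist_eq_norm] at h3 h4
  have := dist_triangle_left y x (∫ u, ∫ w, (fourierE e μ (ψ n) u * fourierE e μ (ψ n) w *
    pair e u w) • (α.aut (adjointE e (opT e σ) u) c * α.aut w d) ∂μ ∂μ)
  linarith

/-- The operator `T` is skew-adjoint. -/
theorem adjointE_opT (he : ∀ u v, e u v = e v u)
    {σ : DualGroup V →ₜ+ DualGroup (DualGroup V)} (hσ : ∀ ξ η, σ ξ η = -σ η ξ) (u : V) :
    adjointE e (opT e σ) u = -opT e σ u := by
  have hT : ∀ u v, e v (opT e σ u) = σ (e u) (e v) := fun u v => apply_sigmaOne e he σ (e u) (e v)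
  apply e.injective
  ext1 w
  have h1 : e (adjointE e (opT e σ) u) w = e u (opT e σ w) := by
    have h : e (adjointE e (opT e σ) u) = (e u).comp (opT e σ) := e.apply_symm_apply _
    rw [h]
    rfl
  rw [h1, hT, hσ, ← hT, map_neg, he w]
  rfl

end OscillatoryProduct

/-! ### Operators on `L²(V; H)` -/

section Operators

variable {V : Type*} [AddCommGroup V] [TopologicalSpace V] [IsTopologicalAddGroup V]
  [LocallyCompactSpace V] [SecondCountableTopology V] [MeasurableSpace V] [BorelSpace V]
  {H : Type*} [NormedAddCommGroup H] [InnerProductSpace ℂ H]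
  {e : V ≃ₜ+ DualGroup V} {σ : DualGroup V →ₜ+ DualGroup (DualGroup V)}
  {μ : Measure V} [μ.IsAddHaarMeasure]

theorem mulOp_ae (F : V → H →L[ℂ] H) (hF : MemLp F ∞ μ) (h : Lp H 2 μ) :
    mulOp μ F hF h =ᵐ[μ] fun v => F v (h v) := by
  have h1 := ContinuousLinearMap.coeFn_holder (ContinuousLinearMap.id ℂ (H →L[ℂ] H)) (r := 2) (hF.toLp F) h
  filter_upwards [h1, hF.coeFn_toLp] with v hv hv2
  refine Eq.trans hv ?_
  rw [hv2]
  rfl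

theorem charOp_ae (ξ : DualGroup V) (h : Lp H 2 μ) :
    charOp H μ ξ h =ᵐ[μ] fun v => charVal ξ v • h v :=
  mulOp_ae _ _ h

theorem lam_ae (u : V) (h : Lp H 2 μ) : lam H μ u h =ᵐ[μ] fun v => h (v - u) :=
  Lp.coeFn_compMeasurePreserving h (measurePreserving_sub_right μ u)

theorem charOp_neg_apply (ξ : DualGroup V) (h : Lp H 2 μ) :
    charOp H μ ξ (charOp H μ (-ξ) h) = h := by
  apply Lp.ext
  filter_upwards [charOp_ae ξ (charOp H μ (-ξ) h), charOp_ae (-ξ) h] with v h1 h2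
  rw [h1, h2, smul_smul]
  have : charVal ξ v * charVal (-ξ) v = 1 := by
    unfold charVal
    rw [← Circle.coe_mul, ← toMul_add]
    change ((Additive.toMul (ξ v + -ξ v) : Circle) : ℂ) = 1
    rw [add_neg_cancel]
    rfl
  rw [this, one_smul]

theorem norm_charOp_apply (ξ : DualGroup V) (h : Lp H 2 μ) : ‖charOp H μ ξ h‖ = ‖h‖ := by
  rw [Lp.norm_def, Lp.norm_def]
  congr 1
  refine eLpNorm_congr_norm_ae ((charOp_ae ξ h).mono fun v hv => ?_)
  rw [hv, norm_smul, norm_charVal, one_mul]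

theorem lam_neg_apply (u : V) (h : Lp H 2 μ) : lam H μ u (lam H μ (-u) h) = h := by
  apply Lp.ext
  have h2 := (measurePreserving_sub_right μ u).quasiMeasurePreserving.ae (lam_ae (-u) h)
  filter_upwards [lam_ae u (lam H μ (-u) h), h2] with v h1 h2
  rw [h1, h2]
  congr 1
  abel

theorem norm_lam_apply (u : V) (h : Lp H 2 μ) : ‖lam H μ u h‖ = ‖h‖ :=
  (Lp.compMeasurePreservingₗᵢ ℂ (fun v => v - u) (measurePreserving_sub_right μ u)).norm_map h

variable [CompleteSpace H]

theorem star_mul_self_of_isometry {K : Type*} [NormedAddCommGroup K] [InnerProductSpace ℂ K]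
    [CompleteSpace K] {X : K →L[ℂ] K} (hX : ∀ h, ‖X h‖ = ‖h‖) : star X * X = 1 :=
  (ContinuousLinearMap.norm_map_iff_adjoint_comp_self X).1 hX

/-- An isometry with a right inverse is unitary, and that inverse is its adjoint; this avoids
computing adjoints of `charOp` and `lam` by integrals. -/
theorem star_eq_of_isometry {K : Type*} [NormedAddCommGroup K] [InnerProductSpace ℂ K]
    [CompleteSpace K] {X Y : K →L[ℂ] K} (hX : ∀ h, ‖X h‖ = ‖h‖) (hXY : X * Y = 1) :
    star X = Y := by
  rw [← mul_one (star X), ← hXY, ← mul_assoc, star_mul_self_of_isometry hX, one_mul]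

theorem star_charOp (ξ : DualGroup V) : star (charOp H μ ξ) = charOp H μ (-ξ) :=
  star_eq_of_isometry (norm_charOp_apply ξ) (ContinuousLinearMap.ext (charOp_neg_apply ξ))

theorem star_lam (u : V) : star (lam H μ u) = lam H μ (-u) :=
  star_eq_of_isometry (norm_lam_apply u) (ContinuousLinearMap.ext (lam_neg_apply u))

theorem mul_star_charOp (ξ : DualGroup V) : charOp H μ ξ * star (charOp H μ ξ) = 1 := by
  rw [star_charOp]
  exact ContinuousLinearMap.ext (charOp_neg_apply ξ)

theorem mul_star_lam (u : V) : lam H μ u * star (lam H μ u) = 1 := by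
  rw [star_lam]
  exact ContinuousLinearMap.ext (lam_neg_apply u)

variable (e σ μ) in
/-- The unitary by whose adjoint action the deformed dual action is implemented. -/
def twist (H : Type*) [NormedAddCommGroup H] [InnerProductSpace ℂ H] [CompleteSpace H]
    (ξ : DualGroup V) : Lp H 2 μ →L[ℂ] Lp H 2 μ :=
  star (charOp H μ ξ) * lam H μ (sigmaOne e σ ξ)

theorem star_mul_conj_mul_eq_iff {R : Type*} [Monoid R] [StarMul R] {C U m : R}
    (hC : C * star C = 1) (hC' : star C * C = 1) (hU : U * star U = 1) (hU' : star U * U = 1) :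
    star U * (C * m * star C) * U = m ↔ m * (star C * U) = star C * U * m := by
  constructor
  · intro h
    calc m * (star C * U) = star C * (U * star U) * (C * m * star C * U) := by
          rw [hU, mul_one]
          simp only [← mul_assoc, hC', one_mul]
      _ = star C * U * (star U * (C * m * star C) * U) := by simp only [mul_assoc]
      _ = _ := by rw [h]
  · intro h
    calc star U * (C * m * star C) * U = star U * C * (m * (star C * U)) := by
          simp only [mul_assoc]
      _ = star U * (C * star C) * U * m := by rw [h]; simp only [mul_assoc]
      _ = m := by rw [hC, mul_one, hU', one_mul]

/-- The deformed action is conjugation by a unitary, so fixed points form a commutant; closure under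
products and linear combinations is then formal. -/
theorem deformedDualAction_eq_iff (ξ : DualGroup V) (m : Lp H 2 μ →L[ℂ] Lp H 2 μ) :
    deformedDualAction e σ μ ξ m = m ↔ m * twist e σ μ H ξ = twist e σ μ H ξ * m :=
  star_mul_conj_mul_eq_iff (mul_star_charOp ξ) (star_mul_self_of_isometry (norm_charOp_apply ξ))
    (mul_star_lam _) (star_mul_self_of_isometry (norm_lam_apply _))

theorem twist_ae (s : V) (h : Lp H 2 μ) : twist e σ μ H (e s) h =ᵐ[μ]
    fun v => pair e (-s) v • h (v - opT e σ s) := by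
  have h1 : twist e σ μ H (e s) h = charOp H μ (e (-s)) (lam H μ (opT e σ s) h) := by
    unfold twist
    rw [star_charOp, map_neg]
    rfl
  rw [h1]
  filter_upwards [charOp_ae (e (-s)) (lam H μ (opT e σ s) h), lam_ae (opT e σ s) h] with v h1 h2
  rw [h1, h2]
  rfl

variable {A : Type*} [NonUnitalCStarAlgebra A] {α : CStarAction V A}
  {π : A →⋆ₙₐ[ℂ] (H →L[ℂ] H)}

theorem mul_mem_fixedPointAlgebra {a b : Lp H 2 μ →L[ℂ] Lp H 2 μ}
    (ha : a ∈ fixedPointAlgebra e σ μ α π) (hb : b ∈ fixedPointAlgebra e σ μ α π) :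
    a * b ∈ fixedPointAlgebra e σ μ α π := by
  refine ⟨fun X hX => ⟨?_, ?_⟩, fun ξ => ?_⟩
  · rw [mul_assoc]
    exact (ha.1 _ (hb.1 X hX).1).1
  · rw [← mul_assoc]
    exact (hb.1 _ (ha.1 X hX).2).2
  · rw [deformedDualAction_eq_iff, mul_assoc, (deformedDualAction_eq_iff ξ b).1 (hb.2 ξ),
      ← mul_assoc, (deformedDualAction_eq_iff ξ a).1 (ha.2 ξ), mul_assoc]

theorem add_smul_mem_fixedPointAlgebra {a b : Lp H 2 μ →L[ℂ] Lp H 2 μ}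
    (ha : a ∈ fixedPointAlgebra e σ μ α π) (hb : b ∈ fixedPointAlgebra e σ μ α π) (z : ℂ) :
    a + z • b ∈ fixedPointAlgebra e σ μ α π := by
  refine ⟨fun X hX => ⟨?_, ?_⟩, fun ξ => ?_⟩
  · rw [add_mul, smul_mul_assoc]
    exact add_mem (ha.1 X hX).1 (SMulMemClass.smul_mem z (hb.1 X hX).1)
  · rw [mul_add, mul_smul_comm]
    exact add_mem (ha.1 X hX).2 (SMulMemClass.smul_mem z (hb.1 X hX).2)
  · rw [deformedDualAction_eq_iff, add_mul, mul_add, smul_mul_assoc, mul_smul_comm,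
      (deformedDualAction_eq_iff ξ b).1 (hb.2 ξ), (deformedDualAction_eq_iff ξ a).1 (ha.2 ξ)]

theorem HasSymbol.add_smul {he : ∀ u v, e u v = e v u} {m n : Lp H 2 μ →L[ℂ] Lp H 2 μ}
    {a b : Lp ℂ 1 μ →L[ℂ] A} (hm : HasSymbol e he μ α π m a) (hn : HasSymbol e he μ α π n b)
    (z : ℂ) : HasSymbol e he μ α π (m + z • n) (a + z • b) := by
  intro ψ hψ k h hh
  have h3 := Lp.coeFn_add (m h) (z • n h)
  have h4 := Lp.coeFn_smul z (n h)
  filter_upwards [hm ψ hψ k h hh, hn ψ hψ k h hh, h3, h4] with v h1 h2 h3 h4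
  change (m h + z • n h : Lp H 2 μ) v = _
  rw [h3, Pi.add_apply, h4, Pi.smul_apply, h1, h2]
  simp only [add_apply, FunLike.coe_smul, Pi.smul_apply, map_add, map_smul]

theorem HasIntegral.add_smul {he : ∀ u v, e u v = e v u} {m n : Lp H 2 μ →L[ℂ] Lp H 2 μ}
    {x y : A} (hm : HasIntegral e he μ α π m x) (hn : HasIntegral e he μ α π n y)
    (z : ℂ) : HasIntegral e he μ α π (m + z • n) (x + z • y) := by
  obtain ⟨a, ha, ha'⟩ := hm
  obtain ⟨b, hb, hb'⟩ := hn
  refine ⟨a + z • b, ha.add_smul hb z, fun ε hε => ?_⟩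
  have hz : 0 < 1 + ‖z‖ := by positivity
  obtain ⟨N, hN, h1⟩ := ha' (ε / (1 + ‖z‖)) (by positivity)
  obtain ⟨N', hN', h2⟩ := hb' (ε / (1 + ‖z‖)) (by positivity)
  refine ⟨N ∩ N', inter_mem hN hN', fun ψ hψ hk => ?_⟩
  have h3 := h1 ψ hψ (hk.mono Set.inter_subset_left)
  have h4 := h2 ψ hψ (hk.mono Set.inter_subset_right)
  calc ‖(a + z • b) (hψ.toL1 ψ) - (x + z • y)‖
      = ‖(a (hψ.toL1 ψ) - x) + z • (b (hψ.toL1 ψ) - y)‖ := by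
        congr 1
        rw [smul_sub]
        change a (hψ.toL1 ψ) + z • b (hψ.toL1 ψ) - _ = _
        abel
    _ ≤ ‖a (hψ.toL1 ψ) - x‖ + ‖z‖ * ‖b (hψ.toL1 ψ) - y‖ := by
        refine (norm_add_le _ _).trans_eq ?_
        rw [norm_smul]
    _ < ε / (1 + ‖z‖) + ‖z‖ * (ε / (1 + ‖z‖)) :=
        add_lt_add_of_lt_of_le h3 (mul_le_mul_of_nonneg_left h4.le (norm_nonneg _))
    _ = ε := by field_simp

end Operators

/-! ### Translations and convolution in `L¹(V)` -/

section Translation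

variable {V : Type*} [AddCommGroup V] [TopologicalSpace V] [IsTopologicalAddGroup V]
  [LocallyCompactSpace V] [SecondCountableTopology V] [MeasurableSpace V] [BorelSpace V]
  {e : V ≃ₜ+ DualGroup V} {μ : Measure V}

theorem toL1_congr {f g : V → ℂ} (hf : Integrable f μ) (hg : Integrable g μ) (h : ∀ v, f v = g v) :
    hf.toL1 f = hg.toL1 g :=
  (Integrable.toL1_eq_toL1_iff f g hf hg).2 (Eventually.of_forall h)

theorem continuous_toL1 {X : Type*} [TopologicalSpace X] [FirstCountableTopology X]
    {F : X → V → ℂ} (hF : ∀ x, Integrable (F x) μ) {b : V → ℝ} (hb : Integrable b μ)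
    (hFb : ∀ x s, ‖F x s‖ ≤ b s) (hc : ∀ s, Continuous fun x => F x s) :
    Continuous fun x => (hF x).toL1 (F x) := by
  rw [continuous_iff_continuousAt]
  intro x₀
  rw [ContinuousAt, tendsto_iff_norm_sub_tendsto_zero]
  have h : ∀ x, ‖(hF x).toL1 (F x) - (hF x₀).toL1 (F x₀)‖ = ∫ s, ‖F x s - F x₀ s‖ ∂μ := by
    intro x
    rw [← Integrable.toL1_sub, L1.norm_of_fun_eq_integral_norm]
    rfl
  simp only [h]
  have h0 : ∫ s, ‖F x₀ s - F x₀ s‖ ∂μ = 0 := by simp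
  rw [← h0]
  refine tendsto_integral_filter_of_dominated_convergence (fun s => b s + b s)
    (Eventually.of_forall fun x => ((hF x).sub (hF x₀)).norm.aestronglyMeasurable)
    (Eventually.of_forall fun x => Eventually.of_forall fun s => ?_) (hb.add hb)
    (Eventually.of_forall fun s => ?_)
  · rw [norm_norm]
    exact (norm_sub_le _ _).trans (add_le_add (hFb _ _) (hFb _ _))
  · exact (((hc s).sub continuous_const).norm.tendsto x₀)

variable [μ.IsAddHaarMeasure]

theorem continuous_reflectAt (he : ∀ u v, e u v = e v u) {ψ : V → ℂ} (hψ : Integrable ψ μ) :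
    Continuous fun v => (integrable_reflectAt e he μ hψ v).toL1 (reflectAt e ψ v) := by
  refine continuous_toL1 _ (b := fun s => ‖ψ (-s)‖) hψ.comp_neg.norm (fun v s => ?_) fun s => ?_
  · unfold reflectAt
    rw [norm_mul, norm_pair, one_mul]
  · unfold reflectAt
    fun_prop

/-- Translation on `L¹(V)`. -/
def translate (μ : Measure V) [μ.IsAddHaarMeasure] (s : V) (f : Lp ℂ 1 μ) : Lp ℂ 1 μ :=
  Lp.compMeasurePreserving (fun v => v - s) (measurePreserving_sub_right μ s) f

theorem norm_translate (s : V) (f : Lp ℂ 1 μ) : ‖translate μ s f‖ = ‖f‖ :=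
  Lp.norm_compMeasurePreserving _ _

theorem translate_zero (f : Lp ℂ 1 μ) : translate μ 0 f = f := by
  apply Lp.ext
  filter_upwards [Lp.coeFn_compMeasurePreserving f (measurePreserving_sub_right μ 0)] with v hv
  refine Eq.trans hv ?_
  simp

theorem continuous_translate [T2Space V] (f : Lp ℂ 1 μ) : Continuous fun s => translate μ s f := by
  have h : Continuous fun s : V => (⟨fun v => v - s, by fun_prop⟩ : C(V, V)) :=
    ContinuousMap.continuous_of_continuous_uncurry _ (by
      change Continuous fun p : V × V => p.2 - p.1
      fun_prop)
  exact (continuous_const (y := f)).compMeasurePreservingLp h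
    (fun s => measurePreserving_sub_right μ s) (by simp)

theorem translate_toL1 {r : V → ℂ} (hr : Integrable r μ) (s : V) :
    translate μ s (hr.toL1 r) = (hr.comp_sub_right s).toL1 (fun v => r (v - s)) := by
  apply Lp.ext
  refine (Lp.coeFn_compMeasurePreserving _ (measurePreserving_sub_right μ s)).trans ?_
  refine EventuallyEq.trans ?_ (Integrable.coeFn_toL1 (hr.comp_sub_right s)).symm
  exact (measurePreserving_sub_right μ s).quasiMeasurePreserving.ae_eq hr.coeFn_toL1

theorem integrable_smul_translate [T2Space V] {p : V → ℂ} (hp : Integrable p μ) (f : Lp ℂ 1 μ) :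
    Integrable (fun s => p s • translate μ s f) μ :=
  hp.smul_bdd (C := ‖f‖) (continuous_translate f).aestronglyMeasurable
    (Eventually.of_forall fun s => (norm_translate s f).le)

/-- The convolution of integrable functions is commutative. -/
theorem integral_smul_translate_comm [T2Space V] {p r : V → ℂ} (hp : Integrable p μ)
    (hr : Integrable r μ) :
    ∫ s, p s • translate μ s (hr.toL1 r) ∂μ = ∫ s, r s • translate μ s (hp.toL1 p) ∂μ := by
  -- Integration over E is a bounded functional, so it passes through the L¹-valued Bochner
  -- integral; the two sides are then compared set by set.
  have hT : ∀ E : Set V, ∃ T : Lp ℂ 1 μ →L[ℂ] ℂ, ∀ f, T f = ∫ v in E, f v ∂μ := by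
    intro E
    refine ⟨LinearMap.mkContinuous ⟨⟨fun f => ∫ v in E, f v ∂μ, fun f g => ?_⟩, fun c f => ?_⟩ 1
      fun f => ?_, fun f => rfl⟩
    · rw [← integral_add (L1.integrable_coeFn f).restrict (L1.integrable_coeFn g).restrict]
      exact integral_congr_ae (ae_restrict_of_ae (Lp.coeFn_add f g))
    · simp only [RingHom.id_apply]
      rw [← integral_smul]
      exact integral_congr_ae (ae_restrict_of_ae (Lp.coeFn_smul c f))
    · rw [one_mul, L1.norm_eq_integral_norm]
      refine (norm_integral_le_integral_norm _).trans ?_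
      exact setIntegral_le_integral (L1.integrable_coeFn f).norm
        (Eventually.of_forall fun v => norm_nonneg _)
  apply Lp.ext
  refine Integrable.ae_eq_of_forall_setIntegral_eq _ _ (L1.integrable_coeFn _)
    (L1.integrable_coeFn _) fun E hE _ => ?_
  obtain ⟨T, hTE⟩ := hT E
  have key : ∀ {p r : V → ℂ} (hp : Integrable p μ) (hr : Integrable r μ),
      ∫ v in E, (∫ s, p s • translate μ s (hr.toL1 r) ∂μ : Lp ℂ 1 μ) v ∂μ =
        ∫ v in E, ∫ s, p s * r (v - s) ∂μ ∂μ := by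
    intro p r hp hr
    have h1 : Integrable (fun z : V × V => p z.2 * r (z.1 - z.2)) ((μ.restrict E).prod μ) :=
      (hp.convolution_integrand (ContinuousLinearMap.mul ℂ ℂ) hr).mono_measure
        (Measure.prod_mono Measure.restrict_le_self le_rfl)
    rw [← hTE, ← T.integral_comp_comm (integrable_smul_translate hp _), integral_integral_swap h1]
    congr 1
    ext s
    rw [map_smul, hTE, translate_toL1, smul_eq_mul, ← integral_const_mul]
    refine integral_congr_ae (ae_restrict_of_ae ?_)
    filter_upwards [(hr.comp_sub_right s).coeFn_toL1] with v hv
    rw [hv]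
  rw [key hp hr, key hr hp]
  congr 1
  ext v
  rw [← integral_sub_left_eq_self _ μ v]
  congr 1
  ext s
  rw [sub_sub_cancel, mul_comm]

theorem IsKernelSeq.tendsto_integral_smul {X : Type*} [NormedAddCommGroup X] [NormedSpace ℂ X]
    [CompleteSpace X] {ψ : ℕ → V → ℂ} (hψ : IsKernelSeq e μ ψ) {g : V → X} (hg : Continuous g)
    {C : ℝ} (hC : ∀ v, ‖g v‖ ≤ C) : Tendsto (fun n => ∫ s, ψ n s • g s ∂μ) atTop (𝓝 (g 0)) := by
  rw [Metric.tendsto_nhds]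
  intro ε hε
  have hN : {p | ‖g p - g 0‖ ≤ ε / 2} ∈ 𝓝 (0 : V) := by
    have := (hg.tendsto 0).eventually (Metric.closedBall_mem_nhds _ (half_pos hε))
    exact this.mono fun z hz => by simpa [dist_eq_norm] using hz
  filter_upwards [hψ _ hN] with n hn
  rw [dist_eq_norm]
  refine (hn.norm_integral_smul_sub_le ?_ fun p hp => hp).trans_lt (half_lt_self hε)
  exact hn.integrable.smul_bdd (C := C) hg.aestronglyMeasurable (Eventually.of_forall hC)

end Translation

/-! ### Pseudomeasures representing the elements of the fixed point algebra -/

section Symbols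

variable {V : Type*} [AddCommGroup V] [TopologicalSpace V] [IsTopologicalAddGroup V]
  [T2Space V] [LocallyCompactSpace V] [SecondCountableTopology V] [MeasurableSpace V]
  [BorelSpace V] {e : V ≃ₜ+ DualGroup V} {σ : DualGroup V →ₜ+ DualGroup (DualGroup V)}
  {μ : Measure V} [μ.IsAddHaarMeasure]
  {A : Type*} [NonUnitalCStarAlgebra A] {α : CStarAction V A}

/-- The pseudomeasure `ψ ↦ ∫ ψ(s) α_{Ts}(c) ds`. -/
def orbitSymbol (μ : Measure V) (α : CStarAction V A) (T : V →ₜ+ V) (c : A) :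
    Lp ℂ 1 μ →L[ℂ] A :=
  have hi : ∀ f : Lp ℂ 1 μ, Integrable (fun s => f s • α.aut (T s) c) μ := fun f =>
    integrable_smul_aut (L1.integrable_coeFn f) T.continuous_toFun c
  LinearMap.mkContinuous ⟨⟨fun f => ∫ s, f s • α.aut (T s) c ∂μ, fun f g => by
      rw [← integral_add (hi f) (hi g)]
      refine integral_congr_ae ((Lp.coeFn_add f g).mono fun s hs => ?_)
      simp only [hs, Pi.add_apply, add_smul]⟩, fun r f => by
      simp only [RingHom.id_apply]
      rw [← integral_smul]
      refine integral_congr_ae ((Lp.coeFn_smul r f).mono fun s hs => ?_)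
      simp only [hs, Pi.smul_apply, smul_assoc]⟩ ‖c‖ fun f => by
    rw [L1.norm_eq_integral_norm, mul_comm, ← integral_mul_const]
    refine norm_integral_le_of_norm_le ((L1.integrable_coeFn f).norm.mul_const _)
      (Eventually.of_forall fun s => ?_)
    rw [norm_smul, α.norm_aut]

theorem orbitSymbol_toL1 (T : V →ₜ+ V) (c : A) {ψ : V → ℂ} (hψ : Integrable ψ μ) :
    orbitSymbol μ α T c (hψ.toL1 ψ) = ∫ s, ψ s • α.aut (T s) c ∂μ :=
  integral_congr_ae (hψ.coeFn_toL1.mono fun s hs => congrArg (· • α.aut (T s) c) hs)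

theorem IsSummationKernel.norm_orbitSymbol_sub_le {N : Set V} {ψ : V → ℂ}
    (h : IsSummationKernel e μ N ψ) (T : V →ₜ+ V) {c : A} {ε : ℝ}
    (hN : ∀ s ∈ N, ‖α.aut (T s) c - c‖ ≤ ε) (hψ : Integrable ψ μ) :
    ‖orbitSymbol μ α T c (hψ.toL1 ψ) - c‖ ≤ ε := by
  rw [orbitSymbol_toL1]
  exact h.norm_integral_smul_sub_le (integrable_smul_aut hψ T.continuous_toFun c) hN

variable {H : Type*} [NormedAddCommGroup H] [InnerProductSpace ℂ H] [CompleteSpace H]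
  {π : A →⋆ₙₐ[ℂ] (H →L[ℂ] H)} {he : ∀ u v, e u v = e v u}

theorem hasIntegral_of_hasSymbol_orbitSymbol {m : Lp H 2 μ →L[ℂ] Lp H 2 μ} {T : V →ₜ+ V} {c : A}
    (hm : HasSymbol e he μ α π m (orbitSymbol μ α T c)) : HasIntegral e he μ α π m c := by
  refine ⟨_, hm, fun ε hε => ?_⟩
  have hN : {s | ‖α.aut (T s) c - c‖ ≤ ε / 2} ∈ 𝓝 (0 : V) := by
    have hc : Continuous fun s => α.aut (T s) c := (α.continuous_aut c).comp T.continuous_toFun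
    have := (hc.tendsto 0).eventually (Metric.closedBall_mem_nhds _ (half_pos hε))
    refine this.mono fun z hz => ?_
    rw [map_zero, α.aut_zero] at hz
    simpa [dist_eq_norm] using hz
  exact ⟨_, hN, fun ψ hψ hk => (hk.norm_orbitSymbol_sub_le T (fun s hs => hs) hψ).trans_lt
    (half_lt_self hε)⟩

/-- Symbols are constrained only almost everywhere. Continuity in v allows evaluation at a chosen
point, since Haar measure charges nonempty open sets. -/
theorem continuous_symbol {X : Type*} [TopologicalSpace X] (q : Lp ℂ 1 μ →L[ℂ] A) {f : X → V}
    (hf : Continuous f) {g : X → Lp ℂ 1 μ} (hg : Continuous g) (k : H) :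
    Continuous fun v => π (α.aut (f v) (q (g v))) k :=
  ((continuous_of_nonUnitalStarAlgHom π).comp
    (α.continuous_aut_comp hf (q.continuous.comp hg))).clm_apply continuous_const

theorem memLp_smul_const {F : V → ℂ} (hF : MemLp F 2 μ) (k : H) :
    MemLp (fun v => F v • k) 2 μ :=
  (ContinuousLinearMap.toSpanSingleton ℂ k).comp_memLp' hF

/-- Evaluating the convolution formula at v = 0 reads off q on the reflection of χ, so the operator
determines its symbol on functions with transform in L². -/
theorem HasSymbol.apply_neg_eq {m : Lp H 2 μ →L[ℂ] Lp H 2 μ} {q q' : Lp ℂ 1 μ →L[ℂ] A}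
    (hq : HasSymbol e he μ α π m q) (hq' : HasSymbol e he μ α π m q')
    (hπ : Function.Injective π) {χ : V → ℂ} (hχ : Integrable χ μ)
    (hχ2 : MemLp (fourierE e μ χ) 2 μ) :
    q (hχ.comp_neg.toL1 fun s => χ (-s)) = q' (hχ.comp_neg.toL1 fun s => χ (-s)) := by
  apply hπ
  ext1 k
  have h1 : ∀ᵐ v ∂μ, _ := (hq χ hχ k _ (memLp_smul_const hχ2 k).coeFn_toLp).symm.trans
    (hq' χ hχ k _ (memLp_smul_const hχ2 k).coeFn_toLp)
  have h2 := congrFun ((Continuous.ae_eq_iff_eq μ (continuous_symbol (α := α) (π := π) q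
    continuous_neg (continuous_reflectAt he hχ) k) (continuous_symbol (α := α) (π := π) q'
    continuous_neg (continuous_reflectAt he hχ) k)).1 h1) 0
  have h3 : (integrable_reflectAt e he μ hχ 0).toL1 (reflectAt e χ 0) =
      hχ.comp_neg.toL1 fun s => χ (-s) := toL1_congr _ _ fun s => by
    unfold reflectAt
    rw [pair_zero_right, one_mul]
  rwa [h3, neg_zero, α.aut_zero, α.aut_zero] at h2

theorem fourierE_comp_neg (ψ : V → ℂ) (v : V) :
    fourierE e μ (fun s => ψ (-s)) v = fourierE e μ ψ (-v) := by
  unfold fourierE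
  rw [← integral_neg_eq_self]
  congr 1
  ext s
  simp only [neg_neg, pair_neg_left, pair_neg_right]

theorem memLp_comp_neg {F : V → ℂ} (hF : MemLp F 2 μ) : MemLp (fun v => F (-v)) 2 μ :=
  hF.comp_measurePreserving (Measure.measurePreserving_neg μ)

theorem HasSymbol.translate {m : Lp H 2 μ →L[ℂ] Lp H 2 μ} {q : Lp ℂ 1 μ →L[ℂ] A}
    (hq : HasSymbol e he μ α π m q) (hm : ∀ ξ, deformedDualAction e σ μ ξ m = m)
    (hπ : Function.Injective π) {ρ : V → ℂ} (hρ : Integrable ρ μ)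
    (hρ2 : MemLp (fourierE e μ ρ) 2 μ) (s : V) :
    q (LandstadKasprzak.translate μ s (hρ.toL1 ρ)) = α.aut (opT e σ s) (q (hρ.toL1 ρ)) := by
  set T := opT e σ
  set χ : V → ℂ := fun p => ρ (-p) with hχdef
  have hχ : Integrable χ μ := hρ.comp_neg
  have hχF : ∀ v, fourierE e μ χ v = fourierE e μ ρ (-v) := fourierE_comp_neg ρ
  have hχ2 : MemLp (fourierE e μ χ) 2 μ := (memLp_comp_neg hρ2).ae_eq
    (Eventually.of_forall fun v => (hχF v).symm)
  -- Chosen so that its transform is the twist applied to that of χ: v ↦ e(-s, v) χ^(v - Ts).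
  set χs : V → ℂ := fun p => pair e (-(p + s)) (T s) * χ (p + s) with hχsdef
  have hχs : Integrable χs μ := by
    refine (hχ.comp_add_right s).bdd_mul (c := 1) (Continuous.aestronglyMeasurable ?_)
      (Eventually.of_forall fun p => (norm_pair _ _ _).le)
    fun_prop
  have hχsF : ∀ v, fourierE e μ χs v = pair e (-s) v * fourierE e μ χ (v - T s) := by
    intro v
    unfold fourierE
    rw [← integral_sub_right_eq_self (μ := μ) _ s, ← integral_const_mul]
    congr 1
    ext p
    simp only [hχsdef, sub_add_cancel]
    rw [sub_eq_add_neg, pair_add_left, sub_eq_add_neg, pair_add_right, pair_neg_left _ p,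
      pair_neg_right _ p]
    ring
  have hk : ∀ k v, π (α.aut (-v) (q ((integrable_reflectAt e he μ hχs v).toL1 _))) k =
      pair e (-s) v • π (α.aut (-(v - T s))
        (q ((integrable_reflectAt e he μ hχ (v - T s)).toL1 _))) k := by
    intro k
    set h : Lp H 2 μ := (memLp_smul_const hχ2 k).toLp with hh
    have h1 : h =ᵐ[μ] fun v => fourierE e μ χ v • k := (memLp_smul_const hχ2 k).coeFn_toLp
    have hsub := (measurePreserving_sub_right μ (T s)).quasiMeasurePreserving
    have h2 : twist e σ μ H (e s) h =ᵐ[μ] fun v => fourierE e μ χs v • k := by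
      filter_upwards [twist_ae (e := e) (σ := σ) s h, hsub.ae h1] with v h3 h4
      rw [h3, h4, smul_smul, hχsF]
    have h3 := hq χs hχs k _ h2
    have h4 := hsub.ae (hq χ hχ k _ h1)
    have h5 : m (twist e σ μ H (e s) h) = twist e σ μ H (e s) (m h) :=
      congrArg (fun X => X h) ((deformedDualAction_eq_iff (e s) m).1 (hm (e s)))
    rw [h5] at h3
    have h6 := h3.symm.trans (twist_ae (e := e) (σ := σ) s (m h))
    have h7 : (fun v => π (α.aut (-v) (q ((integrable_reflectAt e he μ hχs v).toL1 _))) k) =ᵐ[μ]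
        fun v => pair e (-s) v • π (α.aut (-(v - T s))
          (q ((integrable_reflectAt e he μ hχ (v - T s)).toL1 _))) k := by
      filter_upwards [h6, h4] with v h8 h9
      rw [h8, h9]
    have c1 : Continuous fun v => v - T s := by fun_prop
    exact congrFun ((Continuous.ae_eq_iff_eq μ (continuous_symbol (α := α) (π := π) q
      continuous_neg (continuous_reflectAt he hχs) k)
      ((by fun_prop : Continuous fun v => pair e (-s) v).smul
        (continuous_symbol (α := α) (π := π) q c1.neg
          ((continuous_reflectAt he hχ).comp c1) k))).1 h7)
  -- The commutation relation is read at v = Ts, where the right-hand side is evaluated at 0 and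
  -- yields q(ρ). The same scalar e(-s, Ts) then occurs on both sides and cancels.
  have h1 : α.aut (-T s) (q ((integrable_reflectAt e he μ hχs (T s)).toL1 _)) =
      pair e (-s) (T s) • q ((integrable_reflectAt e he μ hχ 0).toL1 _) := by
    apply hπ
    ext1 k
    have := hk k (T s)
    simp only [sub_self, neg_zero, α.aut_zero] at this
    rw [this, map_smul]
    rfl
  have h2 : (integrable_reflectAt e he μ hχ 0).toL1 _ = hρ.toL1 ρ := toL1_congr _ _ fun p => by
    unfold reflectAt
    rw [pair_zero_right, one_mul, hχdef]
    simp only [neg_neg]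
  have h3 : (integrable_reflectAt e he μ hχs (T s)).toL1 _ =
      pair e (-s) (T s) • LandstadKasprzak.translate μ s (hρ.toL1 ρ) := by
    rw [translate_toL1, ← Integrable.toL1_smul]
    refine toL1_congr _ _ fun p => ?_
    simp only [reflectAt, hχsdef, hχdef, smul_eq_mul]
    rw [← mul_assoc, ← pair_add_left]
    congr 2 <;> abel
  rw [h2, h3, map_smul, map_smul] at h1
  have h4 : pair e (-s) (T s) ≠ 0 := fun h0 => by simpa [h0] using norm_pair e (-s) (T s)
  have h5 := smul_right_injective A h4 h1
  rw [← h5, ← α.aut_add, add_neg_cancel, α.aut_zero]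

theorem HasSymbol.eq_orbitSymbol {m : Lp H 2 μ →L[ℂ] Lp H 2 μ} {q : Lp ℂ 1 μ →L[ℂ] A}
    (hq : HasSymbol e he μ α π m q) (hm : ∀ ξ, deformedDualAction e σ μ ξ m = m)
    (hπ : Function.Injective π) (hμ : UnitaryNormalised e μ) {c : A}
    (hc : ∀ ε > 0, ∃ N ∈ 𝓝 (0 : V), ∀ (ψ : V → ℂ) (hψ : Integrable ψ μ),
      IsSummationKernel e μ N ψ → ‖q (hψ.toL1 ψ) - c‖ < ε) :
    q = orbitSymbol μ α (opT e σ) c := by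
  obtain ⟨ρ, hρ, hρu, -⟩ := exists_kernelSeq he hμ
  have hρi : ∀ n, Integrable (ρ n) μ := fun n => (hρu n).integrable
  have hlim : Tendsto (fun n => q ((hρi n).toL1 _)) atTop (𝓝 c) := by
    rw [Metric.tendsto_nhds]
    intro ε hε
    obtain ⟨N, hN, h⟩ := hc ε hε
    filter_upwards [hρ N hN] with n hn
    rw [dist_eq_norm]
    exact h _ _ hn
  suffices h : ∀ {ψ : V → ℂ} (hψ : Integrable ψ μ), q (hψ.toL1 ψ) =
      orbitSymbol μ α (opT e σ) c (hψ.toL1 ψ) by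
    ext1 f
    have := h (L1.integrable_coeFn f)
    rwa [Integrable.toL1_coeFn] at this
  intro ψ hψ
  have h1 : Tendsto (fun n => ∫ s, ρ n s • LandstadKasprzak.translate μ s (hψ.toL1 ψ) ∂μ) atTop
      (𝓝 (hψ.toL1 ψ)) := by
    have := hρ.tendsto_integral_smul (continuous_translate (hψ.toL1 ψ))
      (fun v => (norm_translate v _).le)
    rwa [translate_zero] at this
  -- Commutativity of convolution transfers the translations from ψ to ρ_n, whose transform is in
  -- L², so that covariance is available for arbitrary integrable ψ.
  have h2 : ∀ n, q (∫ s, ρ n s • LandstadKasprzak.translate μ s (hψ.toL1 ψ) ∂μ) =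
      ∫ s, ψ s • α.aut (opT e σ s) (q ((hρi n).toL1 _)) ∂μ := by
    intro n
    rw [integral_smul_translate_comm (hρi n) hψ,
      ← q.integral_comp_comm (integrable_smul_translate hψ _)]
    congr 1
    ext s
    rw [map_smul, hq.translate hm hπ (hρi n) (hμ.memLp_fourierE (hρi n) ?_)]
    exact (hρu n).continuous.memLp_of_hasCompactSupport (hρu n).hasCompactSupport
  have h3 : Tendsto (fun n => ∫ s, ψ s • α.aut (opT e σ s) (q ((hρi n).toL1 _)) ∂μ) atTop
      (𝓝 (∫ s, ψ s • α.aut (opT e σ s) c ∂μ)) := by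
    rw [tendsto_iff_norm_sub_tendsto_zero]
    have h4 := (tendsto_iff_norm_sub_tendsto_zero.1 hlim).const_mul (∫ s, ‖ψ s‖ ∂μ)
    rw [mul_zero] at h4
    refine squeeze_zero (fun n => norm_nonneg _) (fun n => ?_) h4
    have hi : ∀ x, Integrable (fun s => ψ s • α.aut (opT e σ s) x) μ :=
      integrable_smul_aut hψ (opT e σ).continuous_toFun
    rw [← integral_sub (hi _) (hi _), ← integral_mul_const]
    refine norm_integral_le_of_norm_le (hψ.norm.mul_const _) (Eventually.of_forall fun s => ?_)
    rw [← smul_sub, ← map_sub, norm_smul, α.norm_aut]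
  rw [orbitSymbol_toL1]
  refine tendsto_nhds_unique ((q.continuous.tendsto _).comp h1) ?_
  exact h3.congr fun n => (h2 n).symm

/-- Two symbols of the same operator agree on summation kernels, whose transforms are in L², so
their limits along kernels coincide. -/
theorem HasIntegral.unique {m : Lp H 2 μ →L[ℂ] Lp H 2 μ}
    (hπ : Function.Injective π) (hμ : UnitaryNormalised e μ) {x y : A}
    (hx : HasIntegral e he μ α π m x) (hy : HasIntegral e he μ α π m y) : y = x := by
  obtain ⟨q, hq, hq'⟩ := hx
  obtain ⟨r, hr, hr'⟩ := hy
  obtain ⟨ρ, hρ, hρu, -⟩ := exists_kernelSeq he hμ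
  refine eq_of_forall_dist_le fun ε hε => ?_
  obtain ⟨N, hN, h1⟩ := hq' (ε / 2) (half_pos hε)
  obtain ⟨N', hN', h2⟩ := hr' (ε / 2) (half_pos hε)
  obtain ⟨n, hn, hn'⟩ := ((hρ N hN).and (hρ N' hN')).exists
  have h3 := h1 _ hn.integrable hn
  have h4 := h2 _ hn.integrable hn'
  have hχ2 : MemLp (fourierE e μ fun s => ρ n (-s)) 2 μ := by
    refine (memLp_comp_neg (hμ.memLp_fourierE hn.integrable
      (hn.continuous.memLp_of_hasCompactSupport hn.hasCompactSupport))).ae_eq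
      (Eventually.of_forall fun v => (fourierE_comp_neg _ v).symm)
  have h5 := hq.apply_neg_eq hr hπ hn.integrable.comp_neg hχ2
  have h6 : (hn.integrable.comp_neg.comp_neg.toL1 fun s => ρ n (- -s)) = hn.integrable.toL1 _ :=
    toL1_congr _ _ fun s => by rw [neg_neg]
  rw [h6] at h5
  rw [h5, ← dist_eq_norm] at h3
  rw [← dist_eq_norm] at h4
  linarith [dist_triangle_left y x (r (hn.integrable.toL1 (ρ n)))]

end Symbols

/-! ### Mollification on `L²(V; H)` -/

section Mollify

variable {V : Type*} [AddCommGroup V] [TopologicalSpace V] [IsTopologicalAddGroup V]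
  [T2Space V] [LocallyCompactSpace V] [SecondCountableTopology V] [MeasurableSpace V]
  [BorelSpace V] {e : V ≃ₜ+ DualGroup V} {μ : Measure V} [μ.IsAddHaarMeasure]
  {H : Type*} [NormedAddCommGroup H] [InnerProductSpace ℂ H] [CompleteSpace H]

/-- An `L²`-limit and a pointwise limit agree almost everywhere. -/
theorem ae_eq_of_tendsto_Lp {f : ℕ → Lp H 2 μ} {g : Lp H 2 μ} {F : ℕ → V → H} {G : V → H}
    (hf : Tendsto f atTop (𝓝 g)) (hfF : ∀ n, f n =ᵐ[μ] F n)
    (hF : ∀ v, Tendsto (fun n => F n v) atTop (𝓝 (G v))) : g =ᵐ[μ] G := by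
  obtain ⟨ns, hns, h⟩ := (tendstoInMeasure_of_tendsto_Lp hf).exists_seq_tendsto_ae
  filter_upwards [h, ae_all_iff.2 hfF] with v h1 h2
  simp only [h2] at h1
  exact tendsto_nhds_unique h1 ((hF v).comp hns.tendsto_atTop)

theorem memLp_smul_id {φ : V → ℂ} (hφ : Continuous φ) {C : ℝ} (hC : ∀ v, ‖φ v‖ ≤ C) :
    MemLp (fun v => φ v • ContinuousLinearMap.id ℂ H) ∞ μ := by
  refine memLp_top_of_bound (C := C * ‖ContinuousLinearMap.id ℂ H‖)
    (hφ.smul continuous_const).aestronglyMeasurable (Eventually.of_forall fun v => ?_)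
  rw [norm_smul]
  exact mul_le_mul_of_nonneg_right (hC v) (norm_nonneg _)

/-- Multiplication by a bounded continuous function. -/
def scalarOp (H : Type*) [NormedAddCommGroup H] [InnerProductSpace ℂ H] [CompleteSpace H]
    (μ : Measure V) [μ.IsAddHaarMeasure]
    {φ : V → ℂ} (hφ : Continuous φ) {C : ℝ} (hC : ∀ v, ‖φ v‖ ≤ C) : Lp H 2 μ →L[ℂ] Lp H 2 μ :=
  mulOp μ (fun v => φ v • ContinuousLinearMap.id ℂ H) (memLp_smul_id hφ hC)

theorem scalarOp_ae {φ : V → ℂ} (hφ : Continuous φ) {C : ℝ} (hC : ∀ v, ‖φ v‖ ≤ C)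
    (h : Lp H 2 μ) : scalarOp H μ hφ hC h =ᵐ[μ] fun v => φ v • h v :=
  mulOp_ae _ _ h

theorem tendsto_scalarOp {φ : ℕ → V → ℂ} (hφ : ∀ n, Continuous (φ n)) (hC : ∀ n v, ‖φ n v‖ ≤ 1)
    (h1 : ∀ v, Tendsto (fun n => φ n v) atTop (𝓝 1)) (g : Lp H 2 μ) :
    Tendsto (fun n => scalarOp H μ (hφ n) (hC n) g) atTop (𝓝 g) := by
  rw [tendsto_iff_norm_sub_tendsto_zero]
  have hsq : Tendsto (fun n => ((‖scalarOp H μ (hφ n) (hC n) g - g‖ ^ 2 : ℝ) : ℂ)) atTop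
      (𝓝 0) := by
    have h2 : ∀ n, ((‖scalarOp H μ (hφ n) (hC n) g - g‖ ^ 2 : ℝ) : ℂ) =
        ∫ v, ((‖φ n v - 1‖ ^ 2 * ‖g v‖ ^ 2 : ℝ) : ℂ) ∂μ := by
      intro n
      have := inner_self_eq_norm_sq_to_K (𝕜 := ℂ) (scalarOp H μ (hφ n) (hC n) g - g)
      rw [L2.inner_def] at this
      push_cast
      refine this.symm.trans (integral_congr_ae ?_)
      filter_upwards [Lp.coeFn_sub (scalarOp H μ (hφ n) (hC n) g) g,
        scalarOp_ae (hφ n) (hC n) g] with v h3 h4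
      rw [h3, Pi.sub_apply, h4, inner_self_eq_norm_sq_to_K,
        show φ n v • g v - g v = (φ n v - 1) • g v by rw [sub_smul, one_smul], norm_smul]
      change ((‖φ n v - 1‖ * ‖g v‖ : ℝ) : ℂ) ^ 2 = _
      push_cast
      ring
    simp only [h2]
    have h3 : ∫ v : V, (0 : ℂ) ∂μ = 0 := by simp
    rw [← h3]
    have hg := (memLp_two_iff_integrable_sq_norm (Lp.memLp g).1).1 (Lp.memLp g)
    refine tendsto_integral_of_dominated_convergence (fun v => 2 ^ 2 * ‖g v‖ ^ 2)
      (fun n => ?_) (hg.const_mul _) (fun n => Eventually.of_forall fun v => ?_)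
      (Eventually.of_forall fun v => ?_)
    · refine Complex.continuous_ofReal.comp_aestronglyMeasurable ?_
      exact (((hφ n).sub continuous_const).norm.pow 2).aestronglyMeasurable.mul hg.1
    · rw [Complex.norm_real, Real.norm_of_nonneg (by positivity)]
      gcongr
      exact (norm_sub_le _ _).trans (by rw [norm_one]; linarith [hC n v])
    · have h4 : Tendsto (fun n => ‖φ n v - 1‖ ^ 2 * ‖g v‖ ^ 2) atTop (𝓝 0) := by
        have h5 := ((((h1 v).sub_const 1).norm).pow 2).mul_const (‖g v‖ ^ 2)
        simpa using h5
      exact_mod_cast (Complex.continuous_ofReal.tendsto 0).comp h4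
  have h2 : Tendsto (fun n => ‖scalarOp H μ (hφ n) (hC n) g - g‖ ^ 2) atTop (𝓝 0) := by
    have := (Complex.continuous_re.tendsto 0).comp hsq
    simpa only [Function.comp_def, Complex.ofReal_re, Complex.zero_re] using this
  have h3 := (Real.continuous_sqrt.tendsto 0).comp h2
  simpa [Function.comp_def, Real.sqrt_sq (norm_nonneg _)] using h3

theorem continuous_lam (y : Lp H 2 μ) : Continuous fun p => lam H μ (-p) y := by
  have h : Continuous fun s : V => (⟨fun v => v - -s, by fun_prop⟩ : C(V, V)) :=
    ContinuousMap.continuous_of_continuous_uncurry _ (by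
      change Continuous fun p : V × V => p.2 - -p.1
      fun_prop)
  exact (continuous_const (y := y)).compMeasurePreservingLp h
    (fun _ => measurePreserving_sub_right μ _) (by simp)

theorem integrable_smul_lam {ρ : V → ℂ} (hρ : Integrable ρ μ) (y : Lp H 2 μ) :
    Integrable (fun p => ρ p • lam H μ (-p) y) μ :=
  hρ.smul_bdd (C := ‖y‖) (continuous_lam y).aestronglyMeasurable
    (Eventually.of_forall fun _ => (norm_lam_apply _ y).le)

/-- The operator `(M y)(v) = ∫ ρ(p) y(v + p) dp`. -/
def mollify (H : Type*) [NormedAddCommGroup H] [InnerProductSpace ℂ H] [CompleteSpace H]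
    {ρ : V → ℂ} (hρ : Integrable ρ μ) : Lp H 2 μ →L[ℂ] Lp H 2 μ :=
  LinearMap.mkContinuous ⟨⟨fun y => ∫ p, ρ p • lam H μ (-p) y ∂μ, fun y z => by
      rw [← integral_add (integrable_smul_lam hρ y) (integrable_smul_lam hρ z)]
      simp only [map_add, smul_add]⟩, fun r y => by
      simp only [RingHom.id_apply]
      rw [← integral_smul]
      simp only [map_smul, smul_comm r]⟩ (∫ p, ‖ρ p‖ ∂μ) fun y => by
    rw [← integral_mul_const]
    refine norm_integral_le_of_norm_le (hρ.norm.mul_const _) (Eventually.of_forall fun p => ?_)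
    rw [norm_smul, norm_lam_apply]

theorem mollify_apply {ρ : V → ℂ} (hρ : Integrable ρ μ) (y : Lp H 2 μ) :
    mollify H hρ y = ∫ p, ρ p • lam H μ (-p) y ∂μ := rfl

theorem norm_mollify_apply_le {N : Set V} {ρ : V → ℂ} (hρ : IsSummationKernel e μ N ρ)
    (hρi : Integrable ρ μ) (y : Lp H 2 μ) : ‖mollify H hρi y‖ ≤ ‖y‖ := by
  have : ‖y‖ = ∫ p, ‖ρ p‖ * ‖y‖ ∂μ := by
    rw [integral_mul_const, hρ.integral_norm, one_mul]
  rw [this, mollify_apply]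
  refine norm_integral_le_of_norm_le (hρi.norm.mul_const _) (Eventually.of_forall fun p => ?_)
  rw [norm_smul, norm_lam_apply]

theorem lam_zero (y : Lp H 2 μ) : lam H μ 0 y = y := by
  apply Lp.ext
  filter_upwards [lam_ae 0 y] with v hv
  rw [hv, sub_zero]

theorem IsKernelSeq.tendsto_mollify {ρ : ℕ → V → ℂ} (hρ : IsKernelSeq e μ ρ)
    (hρi : ∀ n, Integrable (ρ n) μ) (y : Lp H 2 μ) :
    Tendsto (fun n => mollify H (hρi n) y) atTop (𝓝 y) := by
  have := hρ.tendsto_integral_smul (continuous_lam y) (fun v => (norm_lam_apply _ y).le)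
  rwa [neg_zero, lam_zero] at this

/-- The Bochner integral in L² has no pointwise values, so both sides are integrated over sets of
finite measure and paired with vectors of H, which are bounded functionals on L². -/
theorem mollify_ae {ρ : V → ℂ} (hρ : Integrable ρ μ) {f : V → ℂ} (hf : Integrable f μ) (k : H)
    {y : Lp H 2 μ} (hy : y =ᵐ[μ] fun v => f v • k) :
    mollify H hρ y =ᵐ[μ] fun v => (∫ p, ρ p * f (v + p) ∂μ) • k := by
  have hi : Integrable (fun z : V × V => f (z.1 + z.2) * ρ z.2) (μ.prod μ) :=
    integrable_comp_add_param (hf.mul_prod hρ) measurable_id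
  have hi' : Integrable (fun z : V × V => ρ z.2 * f (z.1 + z.2)) (μ.prod μ) :=
    hi.congr (Eventually.of_forall fun z => mul_comm _ _)
  refine ae_eq_of_forall_setIntegral_eq_of_sigmaFinite (fun E hE hμE => ?_)
    (fun E _ _ => (hi'.integral_prod_left.smul_const k).integrableOn) fun E hE hμE => ?_
  · have : IsFiniteMeasure (μ.restrict E) := ⟨by rwa [Measure.restrict_apply_univ]⟩
    exact ((Lp.memLp _).restrict E).integrable (by norm_num)
  · have hiE : Integrable (fun z : V × V => ρ z.2 * f (z.1 + z.2)) ((μ.restrict E).prod μ) :=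
      hi'.mono_measure (Measure.prod_mono Measure.restrict_le_self le_rfl)
    refine ext_inner_left ℂ fun c => ?_
    rw [← L2.inner_indicatorConstLp_eq_inner_setIntegral ℂ hE hμE.ne, mollify_apply,
      ← integral_inner (integrable_smul_lam hρ y), integral_smul_const, inner_smul_right,
      integral_integral_swap hiE, ← integral_mul_const]
    congr 1
    ext p
    rw [L2.inner_indicatorConstLp_eq_inner_setIntegral ℂ hE hμE.ne, ← inner_smul_right,
      ← integral_smul_const]
    congr 1
    refine integral_congr_ae (ae_restrict_of_ae ?_)
    have h2 := (measurePreserving_sub_right μ (-p)).quasiMeasurePreserving.ae hy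
    filter_upwards [Lp.coeFn_smul (ρ p) (lam H μ (-p) y), lam_ae (-p) y, h2] with v h3 h4 h5
    rw [h3, Pi.smul_apply, h4, h5, sub_neg_eq_add, smul_smul]

/-- Fourier inversion for ρ exhibits a mollified function as the transform of an integrable one, the
form in which a symbol can act on it. -/
theorem integral_mul_comp_add_eq_fourierE (he : ∀ u v, e u v = e v u) {ρ : V → ℂ} (hρ : Integrable (fourierE e μ ρ) μ)
    (hρ2 : ∀ v, fourierE e μ (fourierE e μ ρ) v = ρ (-v)) {f : V → ℂ} (hf : Integrable f μ)
    (v : V) : ∫ p, ρ p * f (v + p) ∂μ =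
      fourierE e μ (fun r => fourierE e μ ρ r * fourierE e μ f (-r)) v := by
  have hi : Integrable (fun z : V × V => pair e z.2 (v - z.1) * (f z.1 * fourierE e μ ρ z.2))
      (μ.prod μ) :=
    (hf.mul_prod hρ).bdd_mul (c := 1) (by fun_prop : Continuous fun z : V × V =>
      pair e z.2 (v - z.1)).aestronglyMeasurable
      (Eventually.of_forall fun z => (norm_pair _ _ _).le)
  calc ∫ p, ρ p * f (v + p) ∂μ = ∫ w, ρ (w - v) * f w ∂μ := by
        rw [← integral_sub_right_eq_self (μ := μ) _ v]
        simp only [add_sub_cancel]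
    _ = ∫ w, ∫ r, pair e r (v - w) * (f w * fourierE e μ ρ r) ∂μ ∂μ := by
        congr 1
        ext w
        have h1 : ρ (w - v) = ∫ r, pair e r (v - w) * fourierE e μ ρ r ∂μ := by
          rw [← neg_sub v w, ← hρ2]
          rfl
        rw [h1, ← integral_mul_const]
        congr 1
        ext r
        ring
    _ = ∫ r, ∫ w, pair e r (v - w) * (f w * fourierE e μ ρ r) ∂μ ∂μ := integral_integral_swap hi
    _ = _ := by
        refine integral_congr_ae (Eventually.of_forall fun r => ?_)
        have h1 : fourierE e μ f (-r) = ∫ w, pair e w (-r) * f w ∂μ := rfl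
        simp only [h1]
        rw [← integral_const_mul, ← integral_const_mul]
        congr 1
        ext w
        rw [sub_eq_add_neg, pair_add_right, pair_neg_right, pair_neg_right, pair_comm he w r]
        ring

end Mollify

/-! ### The product of two elements of the fixed point algebra -/

section Product

variable {V : Type*} [AddCommGroup V] [TopologicalSpace V] [IsTopologicalAddGroup V]
  [T2Space V] [LocallyCompactSpace V] [SecondCountableTopology V] [MeasurableSpace V]
  [BorelSpace V] {e : V ≃ₜ+ DualGroup V} {μ : Measure V} [μ.IsAddHaarMeasure]
  {A : Type*} [NonUnitalCStarAlgebra A] {α : CStarAction V A} {T : V →ₜ+ V}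

theorem aut_orbitSymbol_reflectAt (he : ∀ u v, e u v = e v u) {ψ : V → ℂ} (hψ : Integrable ψ μ)
    (c : A) (v : V) :
    α.aut (-v) (orbitSymbol μ α T c ((integrable_reflectAt e he μ hψ v).toL1 (reflectAt e ψ v))) =
      ∫ s, (pair e s v * ψ s) • α.aut (-v - T s) c ∂μ := by
  rw [orbitSymbol_toL1, α.aut_integral, ← integral_neg_eq_self]
  congr 1
  ext s
  rw [map_smul, ← α.aut_add, map_neg, ← sub_eq_add_neg]
  unfold reflectAt
  rw [neg_neg]

theorem norm_integral_smul_aut_le {φ : V → ℂ} (hφ : Integrable φ μ) (χ : V → ℂ)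
    (hχ : ∀ r, ‖χ r‖ = 1) (g : V → V) (c : A) :
    ‖∫ r, (χ r * φ r) • α.aut (g r) c ∂μ‖ ≤ (∫ r, ‖φ r‖ ∂μ) * ‖c‖ := by
  rw [← integral_mul_const]
  refine norm_integral_le_of_norm_le (hφ.norm.mul_const _) (Eventually.of_forall fun r => ?_)
  rw [norm_smul, norm_mul, hχ, one_mul, α.norm_aut]

theorem integrable_pair_mul_smul_aut {φ : V → ℂ} (hφ : Integrable φ μ) {f : V → V}
    (hf : Continuous f) {g : V → V} (hg : Continuous g) (c : A) :
    Integrable (fun r => (pair e r (f r) * φ r) • α.aut (g r) c) μ :=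
  integrable_smul_aut (hφ.bdd_mul (c := 1)
    (by fun_prop : Continuous fun r => pair e r (f r)).aestronglyMeasurable
    (Eventually.of_forall fun r => (norm_pair _ _ _).le)) hg c

theorem continuous_integral_pair_mul_smul_aut {φ : V → ℂ} (hφ : Integrable φ μ) {f : V → V}
    (hf : Continuous f) {g : V → V → V} (hg : Continuous fun p : V × V => g p.1 p.2) (c : A) :
    Continuous fun w => ∫ r, (pair e r (f w) * φ r) • α.aut (g w r) c ∂μ := by
  refine continuous_of_dominated (bound := fun r => ‖φ r‖ * ‖c‖) (fun w => ?_) (fun w => ?_)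
    (hφ.norm.mul_const _) (Eventually.of_forall fun r => ?_)
  · exact (integrable_pair_mul_smul_aut hφ continuous_const
      (hg.comp (by fun_prop : Continuous fun r => (w, r))) c).aestronglyMeasurable
  · refine Eventually.of_forall fun r => ?_
    rw [norm_smul, norm_mul, norm_pair, one_mul, α.norm_aut]
  · have h1 : Continuous fun w => pair e r (f w) * φ r := by fun_prop
    exact h1.smul ((α.continuous_aut c).comp
      (hg.comp (by fun_prop : Continuous fun w => (w, r))))

/-- The integral kernel `∫ e(r, v - w) φ(r) α_{-v-Tr}(c) dr` of the operator with symbol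
`orbitSymbol μ α T c`, regularised by `φ`. -/
def convKernel (e : V ≃ₜ+ DualGroup V) (μ : Measure V) (α : CStarAction V A) (T : V →ₜ+ V)
    (φ : V → ℂ) (c : A) (v w : V) : A :=
  ∫ r, (pair e r (v - w) * φ r) • α.aut (-v - T r) c ∂μ

theorem norm_convKernel_le {φ : V → ℂ} (hφ : Integrable φ μ) (c : A) (v w : V) :
    ‖convKernel e μ α T φ c v w‖ ≤ (∫ r, ‖φ r‖ ∂μ) * ‖c‖ :=
  norm_integral_smul_aut_le hφ _ (fun _ => norm_pair _ _ _) _ c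

theorem continuous_convKernel {φ : V → ℂ} (hφ : Integrable φ μ) (c : A) (v : V) :
    Continuous fun w => convKernel e μ α T φ c v w :=
  continuous_integral_pair_mul_smul_aut hφ (by fun_prop : Continuous fun w => v - w)
    (g := fun _ => fun r => -v - T r)
    (continuous_const.sub (T.continuous_toFun.comp continuous_snd)) c

theorem integrable_mul_fourierE_neg {φ f : V → ℂ} (hφ : Integrable φ μ) (hf : Integrable f μ) :
    Integrable (fun r => φ r * fourierE e μ f (-r)) μ :=
  hφ.mul_bdd (c := ∫ s, ‖f s‖ ∂μ)
    ((continuous_fourierE e hf).comp continuous_neg).aestronglyMeasurable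
    (Eventually.of_forall fun _ => norm_fourierE_le e f _)

/-- Opening the transform of f and exchanging integrals turns the action of the symbol into
integration against a genuine, bounded operator kernel. -/
theorem aut_orbitSymbol_eq_integral_convKernel (he : ∀ u v, e u v = e v u) {φ f : V → ℂ}
    (hφ : Integrable φ μ) (hf : Integrable f μ) (c : A) (v : V) :
    α.aut (-v) (orbitSymbol μ α T c ((integrable_reflectAt e he μ
      (integrable_mul_fourierE_neg (e := e) hφ hf) v).toL1 _)) =
      ∫ w, f w • convKernel e μ α T φ c v w ∂μ := by
  rw [aut_orbitSymbol_reflectAt he (integrable_mul_fourierE_neg hφ hf)]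
  have hi : Integrable (Function.uncurry fun w r => (f w * (pair e r (v - w) * φ r)) •
      α.aut (-v - T r) c) (μ.prod μ) := by
    refine integrable_smul_aut ?_
      (continuous_const.sub (T.continuous_toFun.comp continuous_snd)) c
    refine ((hf.mul_prod hφ).bdd_mul (c := 1) (by fun_prop : Continuous fun z : V × V =>
      pair e z.2 (v - z.1)).aestronglyMeasurable
      (Eventually.of_forall fun z => (norm_pair _ _ _).le)).congr
      (Eventually.of_forall fun z => ?_)
    simp only []
    ring
  calc _ = ∫ r, ∫ w, (f w * (pair e r (v - w) * φ r)) • α.aut (-v - T r) c ∂μ ∂μ := by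
        congr 1
        ext r
        rw [integral_smul_const]
        congr 1
        unfold fourierE
        rw [← integral_const_mul, ← integral_const_mul]
        congr 1
        ext w
        rw [sub_eq_add_neg, pair_add_right, pair_neg_right, pair_neg_right, pair_comm he w r]
        ring
    _ = ∫ w, ∫ r, (f w * (pair e r (v - w) * φ r)) • α.aut (-v - T r) c ∂μ ∂μ :=
        (integral_integral_swap hi).symm
    _ = _ := by
        congr 1
        ext w
        unfold convKernel
        rw [← integral_smul]
        simp only [smul_smul]

/-- Composition of the kernel of an operator with the values of another one. -/
theorem integral_convKernel_mul (he : ∀ u v, e u v = e v u) {ρ ψ : V → ℂ}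
    (hφ : Integrable (fourierE e μ ρ) μ) (hψ : Integrable ψ μ) (c d : A) (v : V) :
    ∫ w, fourierE e μ ρ w • (convKernel e μ α T (fourierE e μ ρ) c v w *
      ∫ s, (pair e s w * ψ s) • α.aut (-w - T s) d ∂μ) ∂μ =
    ∫ s, (pair e s v * ψ s) • α.aut (-v - T s) (∫ u, ∫ w,
      (fourierE e μ (fun p => pair e s p * ρ p) u * fourierE e μ (reflectAt e ρ v) w * pair e u w) •
        (α.aut (-T u) c * α.aut w d) ∂μ ∂μ) ∂μ := by
  set φ := fourierE e μ ρ with hφdef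
  set K := convKernel e μ α T φ c v with hK
  have hT : Continuous T := T.continuous_toFun
  have hi : Integrable (Function.uncurry fun w s => (φ w * (pair e s w * ψ s)) •
      (K w * α.aut (-w - T s) d)) (μ.prod μ) := by
    have h1 : Integrable (fun z : V × V => φ z.1 * (pair e z.2 z.1 * ψ z.2)) (μ.prod μ) := by
      refine ((hφ.mul_prod hψ).bdd_mul (c := 1) (by fun_prop : Continuous fun z : V × V =>
        pair e z.2 z.1).aestronglyMeasurable
        (Eventually.of_forall fun z => (norm_pair _ _ _).le)).congr
        (Eventually.of_forall fun z => ?_)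
      simp only []
      ring
    refine Integrable.smul_bdd (C := (∫ r, ‖φ r‖ ∂μ) * ‖c‖ * ‖d‖)
      (f := fun z : V × V => K z.1 * α.aut (-z.1 - T z.2) d) h1 ?_
      (Eventually.of_forall fun z => ?_)
    · refine Continuous.aestronglyMeasurable ?_
      exact ((continuous_convKernel hφ c v).comp continuous_fst).mul ((α.continuous_aut d).comp
        (continuous_fst.neg.sub (hT.comp continuous_snd)))
    · refine (norm_mul_le _ _).trans ?_
      rw [α.norm_aut]
      exact mul_le_mul_of_nonneg_right (norm_convKernel_le hφ c v _) (norm_nonneg _)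
  calc _ = ∫ w, ∫ s, (φ w * (pair e s w * ψ s)) • (K w * α.aut (-w - T s) d) ∂μ ∂μ := by
        congr 1
        ext w
        have h1 : Integrable (fun s => (pair e s w * ψ s) • α.aut (-w - T s) d) μ :=
          integrable_pair_mul_smul_aut hψ continuous_const (continuous_const.sub hT) d
        have h2 := (ContinuousLinearMap.mul ℂ A (K w)).integral_comp_comm h1
        simp only [ContinuousLinearMap.mul_apply'] at h2
        rw [← h2, ← integral_smul]
        simp only [mul_smul_comm, smul_smul]
    _ = ∫ s, ∫ w, (φ w * (pair e s w * ψ s)) • (K w * α.aut (-w - T s) d) ∂μ ∂μ :=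
        integral_integral_swap hi
    _ = _ := by
        congr 1
        ext s
        have hi2 : Integrable (Function.uncurry fun w r => (φ w * (pair e s w * ψ s) *
            (pair e r (v - w) * φ r)) • (α.aut (-v - T r) c * α.aut (-w - T s) d))
            (μ.prod μ) := by
          refine integrable_smul_mul_aut ?_ (continuous_const.sub (hT.comp continuous_snd))
            (continuous_fst.neg.sub continuous_const) c d
          refine (((hφ.mul_prod hφ).const_mul (ψ s)).bdd_mul (c := 1)
            (by fun_prop : Continuous fun z : V × V =>
            pair e s z.1 * pair e z.2 (v - z.1)).aestronglyMeasurable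
            (Eventually.of_forall fun z => ?_)).congr
            (Eventually.of_forall fun z => ?_)
          · rw [norm_mul, norm_pair, norm_pair, one_mul]
          · simp only []
            ring
        calc _ = ∫ w, ∫ r, (φ w * (pair e s w * ψ s) *
            (pair e r (v - w) * φ r)) • (α.aut (-v - T r) c * α.aut (-w - T s) d) ∂μ ∂μ := by
              congr 1
              ext w
              have h1 : Integrable (fun r => (pair e r (v - w) * φ r) • α.aut (-v - T r) c) μ :=
                integrable_pair_mul_smul_aut hφ continuous_const (continuous_const.sub hT) c
              have h2 := ((ContinuousLinearMap.mul ℂ A).flip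
                (α.aut (-w - T s) d)).integral_comp_comm h1
              simp only [ContinuousLinearMap.flip_apply, ContinuousLinearMap.mul_apply'] at h2
              have h3 : K w = ∫ r, (pair e r (v - w) * φ r) • α.aut (-v - T r) c ∂μ := rfl
              rw [h3, ← h2, ← integral_smul]
              simp only [smul_mul_assoc, smul_smul]
          _ = ∫ r, ∫ w, (φ w * (pair e s w * ψ s) *
            (pair e r (v - w) * φ r)) • (α.aut (-v - T r) c * α.aut (-w - T s) d) ∂μ ∂μ :=
              integral_integral_swap hi2
          _ = _ := by
              -- Substituting r = u + s and v - w for w makes α_{-v-Ts} a common factor. The weights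
              -- φ(u + s) and φ(v - w) become the transforms of the modulated kernel and of its
              -- reflected counterpart.
              rw [α.aut_integral, ← integral_smul, ← integral_add_right_eq_self _ s]
              congr 1
              ext u
              rw [α.aut_integral, ← integral_smul, ← integral_sub_left_eq_self _ μ v]
              congr 1
              ext w
              rw [fourierE_pair_mul e s u he, fourierE_reflectAt, map_smul, map_mul, smul_smul,
                ← α.aut_add, ← α.aut_add, map_add, sub_sub_cancel]
              have h1 : pair e s (-w) * pair e s w = 1 := by
                rw [← pair_add_right, neg_add_cancel, pair_zero_right]
              congr 1
              · rw [sub_eq_add_neg, pair_add_right, pair_add_left, ← sub_eq_add_neg]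
                linear_combination (pair e s v * ψ s * pair e u w * φ (u + s) * φ (v - w)) * h1
              · congr 2
                · abel_nf
                · abel_nf

variable {H : Type*} [NormedAddCommGroup H] [InnerProductSpace ℂ H] [CompleteSpace H]
  {π : A →⋆ₙₐ[ℂ] (H →L[ℂ] H)} {he : ∀ u v, e u v = e v u}

theorem HasSymbol.apply_mollify {m : Lp H 2 μ →L[ℂ] Lp H 2 μ} {c : A}
    (hm : HasSymbol e he μ α π m (orbitSymbol μ α T c)) {ρ : V → ℂ} (hρi : Integrable ρ μ)
    (hρ : Integrable (fourierE e μ ρ) μ)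
    (hρ2 : ∀ v, fourierE e μ (fourierE e μ ρ) v = ρ (-v)) {φ : V → ℂ} (hφ : Continuous φ)
    {C : ℝ} (hC : ∀ v, ‖φ v‖ ≤ C) (hφi : Integrable φ μ) (hφ2 : MemLp φ 2 μ) (g : Lp H 2 μ) :
    m (mollify H hρi (scalarOp H μ hφ hC g)) =ᵐ[μ] fun v =>
      ∫ w, (φ w • π (convKernel e μ α T (fourierE e μ ρ) c v w)) (g w) ∂μ := by
  have hF : ∀ v, MemLp (fun w => φ w • π (convKernel e μ α T (fourierE e μ ρ) c v w)) 2 μ := by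
    intro v
    refine hφ2.of_le_mul (c := (∫ r, ‖fourierE e μ ρ r‖ ∂μ) * ‖c‖) ?_
      (Eventually.of_forall fun w => ?_)
    · exact (hφ.smul ((continuous_of_nonUnitalStarAlgHom π).comp
        (continuous_convKernel hρ c v))).aestronglyMeasurable
    · rw [norm_smul, mul_comm]
      exact mul_le_mul_of_nonneg_right ((NonUnitalStarAlgHom.norm_apply_le π _).trans
        (norm_convKernel_le hρ c v w)) (norm_nonneg _)
  -- The kernel is bounded and φ is in L², so for fixed v the product with g is a bounded map from
  -- L² to L¹. Hence the right-hand side is continuous in g, and the formula extends from indicators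
  -- to all of L².
  set L : V → Lp H 2 μ →L[ℂ] Lp H 1 μ := fun v =>
    (ContinuousLinearMap.id ℂ (H →L[ℂ] H)).holderL μ 2 2 1 ((hF v).toLp) with hL
  have hLae : ∀ v g, L v g =ᵐ[μ] fun w =>
      (φ w • π (convKernel e μ α T (fourierE e μ ρ) c v w)) (g w) := by
    intro v g
    have h1 := ContinuousLinearMap.coeFn_holder (ContinuousLinearMap.id ℂ (H →L[ℂ] H)) (r := 1)
      ((hF v).toLp) g
    filter_upwards [h1, (hF v).coeFn_toLp] with w hw hw2
    refine Eq.trans hw ?_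
    rw [hw2]
    rfl
  suffices h : m (mollify H hρi (scalarOp H μ hφ hC g)) =ᵐ[μ] fun v => ∫ w, L v g w ∂μ from
    h.trans (Eventually.of_forall fun v => integral_congr_ae (hLae v g))
  induction g using Lp.induction (by norm_num : (2 : ℝ≥0∞) ≠ ⊤) with
  | @indicatorConst k E hE hμE =>
    rw [Lp.simpleFunc.coe_indicatorConst]
    set g := indicatorConstLp 2 hE hμE.ne k with hg
    set f : V → ℂ := E.indicator φ with hf
    have hfi : Integrable f μ := hφi.indicator hE
    have hgf : ∀ᵐ w ∂μ, φ w • g w = f w • k := by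
      filter_upwards [(indicatorConstLp_coeFn : g =ᵐ[μ] _)] with w hw
      rw [hw, hf]
      by_cases hwE : w ∈ E <;> simp [hwE]
    have h1 : mollify H hρi (scalarOp H μ hφ hC g) =ᵐ[μ] fun v =>
        fourierE e μ (fun r => fourierE e μ ρ r * fourierE e μ f (-r)) v • k :=
      (mollify_ae hρi hfi k ((scalarOp_ae hφ hC g).trans hgf)).trans
        (Eventually.of_forall fun v => by
          simp only []
          rw [integral_mul_comp_add_eq_fourierE he hρ hρ2 hfi])
    refine (hm _ (integrable_mul_fourierE_neg hρ hfi) k _ h1).trans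
      (Eventually.of_forall fun v => ?_)
    simp only []
    rw [aut_orbitSymbol_eq_integral_convKernel he hρ hfi]
    have hi : Integrable (fun w => f w • convKernel e μ α T (fourierE e μ ρ) c v w) μ :=
      hfi.smul_bdd (C := (∫ r, ‖fourierE e μ ρ r‖ ∂μ) * ‖c‖)
        (continuous_convKernel hρ c v).aestronglyMeasurable
        (Eventually.of_forall fun w => norm_convKernel_le hρ c v w)
    have h2 := ((ContinuousLinearMap.apply ℂ H k).comp (starHomL π)).integral_comp_comm hi
    refine Eq.trans h2.symm (integral_congr_ae ?_)
    filter_upwards [hLae v g, hgf] with w h3 h4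
    rw [h3]
    change (π (f w • convKernel e μ α T (fourierE e μ ρ) c v w)) k = _
    rw [map_smul]
    set X := π (convKernel e μ α T (fourierE e μ ρ) c v w)
    exact (X.map_smul (f w) k).symm.trans ((congrArg X h4.symm).trans (X.map_smul _ _))
  | add hf hg _ h1 h2 =>
    simp only [map_add]
    filter_upwards [h1, h2, Lp.coeFn_add (m (mollify H hρi (scalarOp H μ hφ hC hf.toLp)))
      (m (mollify H hρi (scalarOp H μ hφ hC hg.toLp)))] with v h3 h4 h5
    rw [h5, Pi.add_apply, h3, h4, ← integral_add (L1.integrable_coeFn _) (L1.integrable_coeFn _)]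
    exact integral_congr_ae (Lp.coeFn_add _ _).symm
  | isClosed =>
    refine IsSeqClosed.isClosed fun g g₀ hg hlim => ?_
    refine ae_eq_of_tendsto_Lp ?_ hg fun v => ?_
    · exact ((m.comp ((mollify H hρi).comp (scalarOp H μ hφ hC))).continuous.tendsto _).comp hlim
    · exact (continuous_integral.tendsto _).comp (((L v).continuous.tendsto _).comp hlim)

end Product

/-! ### The symbol of a product. -/

section ProductSymbol

variable {V : Type*} [AddCommGroup V] [TopologicalSpace V] [IsTopologicalAddGroup V]
  [T2Space V] [LocallyCompactSpace V] [SecondCountableTopology V] [MeasurableSpace V]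
  [BorelSpace V] {e : V ≃ₜ+ DualGroup V} {μ : Measure V} [μ.IsAddHaarMeasure]
  {A : Type*} [NonUnitalCStarAlgebra A] {α : CStarAction V A} {T : V →ₜ+ V}
  {H : Type*} [NormedAddCommGroup H] [InnerProductSpace ℂ H] [CompleteSpace H]
  {π : A →⋆ₙₐ[ℂ] (H →L[ℂ] H)} {he : ∀ u v, e u v = e v u}

theorem IsKernelSeq.tendsto_fourierE {ρ : ℕ → V → ℂ} (hρ : IsKernelSeq e μ ρ) (v : V) :
    Tendsto (fun n => fourierE e μ (ρ n) v) atTop (𝓝 1) := by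
  have := hρ.tendsto_integral_smul (by fun_prop : Continuous fun s => pair e s v)
    (fun s => (norm_pair e s v).le)
  rw [pair_zero_left] at this
  refine this.congr fun n => ?_
  unfold fourierE
  congr 1
  ext s
  rw [smul_eq_mul, mul_comm]

theorem IsKernelSeq.tendsto_integral_prod_smul {ρ : ℕ → V → ℂ} (hρ : IsKernelSeq e μ ρ)
    {Z : V × V → A} (hZ : Continuous Z) {C : ℝ} (hC : ∀ z, ‖Z z‖ ≤ C) :
    Tendsto (fun n => ∫ z, (ρ n z.1 * ρ n z.2) • Z z ∂(μ.prod μ)) atTop (𝓝 (Z 0)) := by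
  rw [Metric.tendsto_nhds]
  intro ε hε
  obtain ⟨N, hN, h1⟩ := exists_forall_norm_sub_le hZ (half_pos hε)
  filter_upwards [hρ N hN] with n hn
  rw [dist_eq_norm]
  exact (hn.norm_integral_prod_smul_sub_le hn hZ hC h1).trans_lt (half_lt_self hε)

/-- Reflecting the second variable moves all dependence on s and v from the kernels to Z, leaving
the positive kernels ρ. -/
theorem integral_modulated_kernel (ρ : V → ℂ) (Z : V × V → A) (s v : V) :
    ∫ z, ((pair e s z.1 * ρ z.1) * reflectAt e ρ v z.2) • Z z ∂(μ.prod μ) =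
      ∫ z, (ρ z.1 * ρ z.2) • ((pair e s z.1 * pair e z.2 v) • Z (z.1, -z.2)) ∂(μ.prod μ) := by
  have h := ((MeasurePreserving.id μ).prod (Measure.measurePreserving_neg μ)).integral_comp'
    (f := (MeasurableEquiv.refl V).prodCongr (MeasurableEquiv.neg V))
    (fun z : V × V => ((pair e s z.1 * ρ z.1) * reflectAt e ρ v z.2) • Z z)
  rw [← h]
  congr 1
  ext z
  change ((pair e s z.1 * ρ z.1) * (pair e (- -z.2) v * ρ (- -z.2))) • Z (z.1, -z.2) = _
  rw [neg_neg, smul_smul]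
  congr 1
  ring

theorem norm_integral_prod_smul_le {N : Set V} {ρ : V → ℂ} (h : IsSummationKernel e μ N ρ)
    {Z : V × V → A} {C : ℝ} (hC : ∀ z, ‖Z z‖ ≤ C) :
    ‖∫ z, (ρ z.1 * ρ z.2) • Z z ∂(μ.prod μ)‖ ≤ C := by
  have h1 : ∫ z : V × V, ‖ρ z.1‖ * ‖ρ z.2‖ * C ∂(μ.prod μ) = C := by
    rw [integral_mul_const, integral_prod_mul (fun p => ‖ρ p‖) (fun p => ‖ρ p‖), h.integral_norm,
      one_mul, one_mul]
  rw [← h1]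
  refine norm_integral_le_of_norm_le ((h.integrable.norm.mul_prod h.integrable.norm).mul_const C)
    (Eventually.of_forall fun z => ?_)
  rw [norm_smul, norm_mul]
  exact mul_le_mul_of_nonneg_left (hC z) (by positivity)

theorem HasSymbol.mul {a b : Lp H 2 μ →L[ℂ] Lp H 2 μ} {c d : A}
    (ha : HasSymbol e he μ α π a (orbitSymbol μ α T c))
    (hb : HasSymbol e he μ α π b (orbitSymbol μ α T d)) (hμ : UnitaryNormalised e μ)
    {Z : V × V → A} (hZ : Continuous Z) {C : ℝ} (hC : ∀ z, ‖Z z‖ ≤ C)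
    (h : ∀ ψ₁ ψ₂, FourierIntegrable e μ ψ₁ → FourierIntegrable e μ ψ₂ →
      ∫ u, ∫ w, (fourierE e μ ψ₁ u * fourierE e μ ψ₂ w * pair e u w) •
        (α.aut (-T u) c * α.aut w d) ∂μ ∂μ =
      ∫ z, (ψ₁ z.1 * ψ₂ z.2) • Z z ∂(μ.prod μ)) :
    HasSymbol e he μ α π (a * b) (orbitSymbol μ α T (Z 0)) := by
  intro ψ hψ k y hy
  obtain ⟨ρ, hρ, hρu, hρ2⟩ := exists_kernelSeq he hμ
  have hρi : ∀ n, Integrable (ρ n) μ := fun n => (hρu n).integrable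
  have hT : Continuous T := T.continuous_toFun
  have hφc : ∀ n, Continuous (fourierE e μ (ρ n)) := fun n => continuous_fourierE e (hρi n)
  have hφ1 : ∀ n v, ‖fourierE e μ (ρ n) v‖ ≤ 1 := fun n => (hρu n).norm_fourierE_le_one
  have hφi : ∀ n, Integrable (fourierE e μ (ρ n)) μ := fun n => (hρu n).integrable_fourier
  have hφ2 : ∀ n, MemLp (fourierE e μ (ρ n)) 2 μ := fun n => hμ.memLp_fourierE (hρi n)
    ((hρu n).continuous.memLp_of_hasCompactSupport (hρu n).hasCompactSupport)
  set g : Lp H 2 μ := b y with hg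
  have hgae : g =ᵐ[μ] fun w => π (∫ s, (pair e s w * ψ s) • α.aut (-w - T s) d ∂μ) k :=
    (hb ψ hψ k y hy).trans (Eventually.of_forall fun w => by
      simp only []
      rw [aut_orbitSymbol_reflectAt he hψ])
  -- Cut-off and mollification vary together; the mollifications are contractions, so the error of
  -- the cut-off is not amplified.
  have hlim : Tendsto (fun n => a (mollify H (hρi n) (scalarOp H μ (hφc n) (hφ1 n) g))) atTop
      (𝓝 (a g)) := by
    refine (a.continuous.tendsto g).comp ?_
    have h1 := hρ.tendsto_mollify hρi g
    have h2 : Tendsto (fun n => mollify H (hρi n) (scalarOp H μ (hφc n) (hφ1 n) g - g)) atTop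
        (𝓝 0) := by
      refine squeeze_zero_norm (fun n => norm_mollify_apply_le (hρu n) (hρi n) _) ?_
      exact tendsto_iff_norm_sub_tendsto_zero.1
        (tendsto_scalarOp hφc hφ1 hρ.tendsto_fourierE g)
    have h3 := h2.add h1
    simpa [← map_add] using h3
  refine ae_eq_of_tendsto_Lp hlim (fun n => ha.apply_mollify (hρi n) (hφi n) (hρ2 n) (hφc n)
    (hφ1 n) (hφi n) (hφ2 n) g) fun v => ?_
  -- Z with the modulations absorbed: for every s it has the same bound C and the same value Z(0) at
  -- the origin, so the limit is independent of s and v and is dominated in s.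
  set Zs : V → V × V → A := fun s z => (pair e s z.1 * pair e z.2 v) • Z (z.1, -z.2) with hZs
  have hZsc : ∀ s, Continuous (Zs s) := fun s =>
    (by fun_prop : Continuous fun z : V × V => pair e s z.1 * pair e z.2 v).smul
      (hZ.comp (by fun_prop))
  have hZsb : ∀ s z, ‖Zs s z‖ ≤ C := fun s z => by
    rw [hZs]
    simp only []
    rw [norm_smul, norm_mul, norm_pair, norm_pair, one_mul, one_mul]
    exact hC _
  have hZs0 : ∀ s, Zs s 0 = Z 0 := fun s => by
    change (pair e s 0 * pair e 0 v) • Z (0, -0) = Z 0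
    rw [pair_zero_left, pair_zero_right, one_mul, one_smul, neg_zero]
    rfl
  have hval : ∀ n, ∫ w, (fourierE e μ (ρ n) w •
      π (convKernel e μ α T (fourierE e μ (ρ n)) c v w)) (g w) ∂μ =
      π (∫ s, (pair e s v * ψ s) • α.aut (-v - T s)
        (∫ z, (ρ n z.1 * ρ n z.2) • Zs s z ∂(μ.prod μ)) ∂μ) k := by
    intro n
    have hDc : Continuous fun w => ∫ s, (pair e s w * ψ s) • α.aut (-w - T s) d ∂μ :=
      continuous_integral_pair_mul_smul_aut hψ continuous_id (g := fun w s => -w - T s)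
        (continuous_fst.neg.sub (hT.comp continuous_snd)) d
    have hi : Integrable (fun w => fourierE e μ (ρ n) w •
        (convKernel e μ α T (fourierE e μ (ρ n)) c v w *
          ∫ s, (pair e s w * ψ s) • α.aut (-w - T s) d ∂μ)) μ := by
      refine (hφi n).smul_bdd
        (C := (∫ r, ‖fourierE e μ (ρ n) r‖ ∂μ) * ‖c‖ * ((∫ s, ‖ψ s‖ ∂μ) * ‖d‖))
        ((continuous_convKernel (hφi n) c v).mul hDc).aestronglyMeasurable
        (Eventually.of_forall fun w => (norm_mul_le _ _).trans ?_)
      exact mul_le_mul (norm_convKernel_le (hφi n) c v w)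
        (norm_integral_smul_aut_le hψ _ (fun _ => norm_pair _ _ _) _ d) (norm_nonneg _)
        (by positivity)
    have h1 : ∀ s, ∫ z, (ρ n z.1 * ρ n z.2) • Zs s z ∂(μ.prod μ) =
        ∫ u, ∫ w, (fourierE e μ (fun p => pair e s p * ρ n p) u *
          fourierE e μ (reflectAt e (ρ n) v) w * pair e u w) •
            (α.aut (-T u) c * α.aut w d) ∂μ ∂μ := by
      intro s
      rw [h, ← integral_modulated_kernel]
      · refine ⟨integrable_pair_mul' e (hρi n) s, ?_⟩
        refine ((hφi n).comp_add_right s).congr (Eventually.of_forall fun u => ?_)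
        exact (fourierE_pair_mul e s u he).symm
      · refine ⟨integrable_reflectAt e he μ (hρi n) v, ?_⟩
        refine ((hφi n).comp_sub_left v).congr (Eventually.of_forall fun u => ?_)
        exact (fourierE_reflectAt e μ (ρ n) v u).symm
    simp only [h1]
    rw [← integral_convKernel_mul he (hφi n) hψ]
    refine Eq.trans ?_ (((ContinuousLinearMap.apply ℂ H k).comp
      (starHomL π)).integral_comp_comm hi)
    refine integral_congr_ae (hgae.mono fun w hw => ?_)
    simp only [hw]
    change _ = (π (_ • (_ * _))) k
    rw [map_smul, map_mul]
    rfl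
  simp only [hval]
  rw [aut_orbitSymbol_reflectAt he hψ]
  refine (((continuous_of_nonUnitalStarAlgHom π).clm_apply continuous_const).tendsto _).comp ?_
  refine tendsto_integral_of_dominated_convergence (fun s => ‖ψ s‖ * C) (fun n => ?_)
    (hψ.norm.mul_const C) (fun n => Eventually.of_forall fun s => ?_)
    (Eventually.of_forall fun s => ?_)
  · have hc : Continuous fun s => ∫ z, (ρ n z.1 * ρ n z.2) • Zs s z ∂(μ.prod μ) := by
      refine continuous_of_dominated (bound := fun z => ‖ρ n z.1 * ρ n z.2‖ * C) (fun s => ?_)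
        (fun s => ?_) (((hρi n).mul_prod (hρi n)).norm.mul_const C) ?_
      · exact (integrable_mul_smul (hρi n) (hρi n) (hZsc s) (hZsb s)).aestronglyMeasurable
      · refine Eventually.of_forall fun z => ?_
        rw [norm_smul]
        exact mul_le_mul_of_nonneg_left (hZsb s z) (norm_nonneg _)
      · exact Eventually.of_forall fun z => by
          simp only [hZs]
          fun_prop
    refine ((by fun_prop : Continuous fun s => pair e s v).aestronglyMeasurable.mul
      hψ.aestronglyMeasurable).smul ?_
    exact (α.continuous_aut_comp (continuous_const.sub hT) hc).aestronglyMeasurable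
  · rw [norm_smul, norm_mul, norm_pair, one_mul, α.norm_aut]
    exact mul_le_mul_of_nonneg_left (norm_integral_prod_smul_le (hρu n) (hZsb s)) (norm_nonneg _)
  · have h1 := hρ.tendsto_integral_prod_smul (hZsc s) (hZsb s)
    rw [hZs0] at h1
    exact (((α.autL (-v - T s)).continuous.tendsto _).comp h1).const_smul _

end ProductSymbol

end LandstadKasprzak

end

/-! ### The homomorphism property. -/

open LandstadKasprzak in
theorem mainTheorem3
    {V : Type*} [AddCommGroup V] [TopologicalSpace V] [IsTopologicalAddGroup V] [T2Space V]
    [LocallyCompactSpace V] [SecondCountableTopology V] [MeasurableSpace V] [BorelSpace V]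
    {𝔤 : Type*} [NormedAddCommGroup 𝔤] [NormedSpace ℝ 𝔤] [FiniteDimensional ℝ 𝔤]
    (exp : 𝔤 →+ V) (hexp : IsLocalHomeomorph exp)
    (e : V ≃ₜ+ DualGroup V) (he : ∀ u v, e u v = e v u)
    (σ : DualGroup V →ₜ+ DualGroup (DualGroup V)) (hσ : ∀ ξ η, σ ξ η = -σ η ξ)
    (hT : Function.Bijective (opT e σ))
    (μ : Measure V) [μ.IsAddHaarMeasure] (hμ : UnitaryNormalised e μ)
    {A : Type*} [NonUnitalCStarAlgebra A] (α : CStarAction V A)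
    {H : Type*} [NormedAddCommGroup H] [InnerProductSpace ℂ H] [CompleteSpace H]
    (π : A →⋆ₙₐ[ℂ] (H →L[ℂ] H)) (hπ : Function.Injective π)
    (hπ_nondeg : Dense (Submodule.span ℂ {h : H | ∃ c k, h = π c k} : Set H))
    (a b : Lp H 2 μ →L[ℂ] Lp H 2 μ)
    (ha : a ∈ fixedPointAlgebra e σ μ α π) (hb : b ∈ fixedPointAlgebra e σ μ α π)
    (c d : A) (hc : IsSmoothVector exp α c) (hd : IsSmoothVector exp α d)
    (hac : HasIntegral e he μ α π a c) (hbd : HasIntegral e he μ α π b d) :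
    (a * b ∈ fixedPointAlgebra e σ μ α π ∧
      ∃ x : A, IsSmoothVector exp α x ∧
        (∀ y, IsRieffelProduct e σ μ α c d y ↔ y = x) ∧
        (∀ y, HasIntegral e he μ α π (a * b) y ↔ y = x)) ∧
    ∀ z : ℂ, a + z • b ∈ fixedPointAlgebra e σ μ α π ∧
      HasIntegral e he μ α π (a + z • b) (c + z • d) := by
  have hS : Function.Bijective (adjointE e (opT e σ)) := by
    have h : ⇑(adjointE e (opT e σ)) = Neg.neg ∘ opT e σ := funext (adjointE_opT he hσ)
    rw [h]
    exact (Equiv.neg V).bijective.comp hT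
  obtain ⟨Z, hZ, ⟨C, hC⟩, hZs, hZr⟩ := exists_regularised he hμ hexp hS hc hd
  obtain ⟨q, hq, hqc⟩ := id hac
  obtain ⟨r, hr, hrd⟩ := id hbd
  -- Invariance forces both symbols to be orbit symbols, so the product rule for such symbols
  -- applies.
  rw [hq.eq_orbitSymbol ha.2 hπ hμ hqc] at hq
  rw [hr.eq_orbitSymbol hb.2 hπ hμ hrd] at hr
  have hx : IsRieffelProduct e σ μ α c d (Z 0) := isRieffelProduct_of_regularised hZ hC hZr
  have hI : HasIntegral e he μ α π (a * b) (Z 0) :=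
    hasIntegral_of_hasSymbol_orbitSymbol (hq.mul hr hμ hZ hC
      (by simpa only [adjointE_opT he hσ] using hZr))
  exact ⟨⟨mul_mem_fixedPointAlgebra ha hb, Z 0, hZs,
    fun y => ⟨fun hy => hx.unique he hμ hy, fun hy => hy ▸ hx⟩,
    fun y => ⟨fun hy => hI.unique hπ hμ hy, fun hy => hy ▸ hI⟩⟩,
    fun z => ⟨add_smul_mem_fixedPointAlgebra ha hb z, hac.add_smul hbd z⟩⟩
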